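/- Let $X$ be a complex manifold of dimension $n$, with structure sheaf $\mathcal O_X$ of holomorphic functions, and let $k\ge 1$, $m\ge 0$ be integers. For $j\ge 0$ let $J^jX$ be the bundle of $j$-jets at $0$ of germs of holomorphic curves $f:(\mathbb C,0)\to X$: two germs through the same point have the same $j$-jet if in local holomorphic coordinates their derivatives of orders $1,\dots,j$ at $0$ agree (so $J^0X=X$). The group $\mathbb C^*$ acts on $J^jX$ by $\lambda\cdot j^jf=j^j(t\mapsto f(\lambda t))$. For an integer $w\ge 0$ let $\mathcal J_j^{w}X$ be the sheaf of $\mathcal O_X$-modules of $j$-jet differentials of weight $w$: its sections over an open set $U$ are the holomorphic functions $\omega:J^jX|_U\to\mathbb C$ with $\omega(\lambda\cdot\xi)=\lambda^{w}\omega(\xi)$ for all $\lambda\in\mathbb C^*$. Pull-back along the projection $J^kX\to J^{k-1}X$ is an injection $\mathcal J_{k-1}^mX\hookrightarrow\mathcal J_k^mX$, by which $\mathcal J_{k-1}^mX$ is regarded as a subsheaf of $\mathcal J_k^mX$. For $i\ge 0$ let $\mathcal F_k^i$ be the sheaf of functions that in local holomorphic coordinates $z=(z_1,\dots,z_n)$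 are of the form $$\omega(j^kf)=\sum_{\substack{|I_1|+2|I_2|+\cdots+k|I_k|=m\\ |I_k|\le i}}a_{I_1,\dots,I_k}(f(0))\,(f')^{I_1}(f'')^{I_2}\cdots(f^{(k)})^{I_k}$$ with holomorphic coefficients $a_{I_1,\dots,I_k}$; here $I_1,\dots,I_k\in\mathbb Z_{\ge0}^n$ are multi-indices, $f^{(p)}=((z_1\circ f)^{(p)}(0),\dots,(z_n\circ f)^{(p)}(0))$, and powers are in multi-index notation. Then $$\mathcal J_{k-1}^{m}X=\mathcal F_k^0\subset\mathcal F_k^1\subset\cdots\subset\mathcal F_k^{[m/k]}=\mathcal J_k^mX,$$ where $[m/k]$ is the greatest integer not exceeding $m/k$, is a filtration by sheaves of $\mathcal O_X$-modules, and for every $1\le i\le[m/k]$ there is an isomorphism of sheaves of $\mathcal O_X$-modules $$\mathcal F_k^i/\mathcal F_k^{i-1}\;\cong\;\mathcal J_{k-1}^{\,m-ki}X\otimes_{\mathcal O_X}\mathrm{Sym}^i\,T^*X .$$ -/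

import Mathlib

open CategoryTheory TopologicalSpace Opposite
open scoped Manifold ContDiff TensorProduct MonoidalCategory

noncomputable section

namespace JetDiff

universe u

/-- The model space `ℂⁿ` of an `n`-dimensional complex manifold. -/
abbrev Cn (n : ℕ) : Type := EuclideanSpace ℂ (Fin n)

variable (n : ℕ) {X : Type u} [TopologicalSpace X] [ChartedSpace (Cn n) X]

/-! ### Holomorphic curves and the restricted jet bundle -/

/-- Curves in `X` through `x` that are holomorphic near `0 ∈ ℂ`.  Only the germ at `0` matters. -/
structure HolCurve (x : X) where
  /-- the curve; its values away from `0` are irrelevant -/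
  toFun : ℂ → X
  map_zero : toFun 0 = x
  holo : ContMDiffAt 𝓘(ℂ) 𝓘(ℂ, Cn n) ω toFun 0

variable {n}

/-- The derivatives `(z ∘ f)'(0), …, (z ∘ f)^{(k)}(0)` of a curve in a coordinate system `z`;
the entry of index `p : Fin k` is the derivative of order `p + 1`. -/
def jetCoord (k : ℕ) (z : OpenPartialHomeomorph X (Cn n)) (f : ℂ → X) : Fin k → Cn n :=
  fun p ↦ iteratedDeriv ((p : ℕ) + 1) (z ∘ f) 0

variable (n) in
/-- `k`-equivalence of curves through `x`: equality of the derivatives of order `1, …, k` at `0`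
in a holomorphic coordinate system near `x`. -/
def jetSetoid (k : ℕ) (x : X) : Setoid (HolCurve n x) where
  r f g := jetCoord k (chartAt (Cn n) x) f.toFun = jetCoord k (chartAt (Cn n) x) g.toFun
  iseqv := ⟨fun _ ↦ rfl, fun h ↦ h.symm, fun h h' ↦ h.trans h'⟩

variable (n) in
/-- The fibre at `x` of the restricted `k`-jet bundle `J^k X`. -/
def JetFiber (k : ℕ) (x : X) : Type u := Quotient (jetSetoid n k x)

/-- The `k`-jet `j^k f (0)` of a curve. -/
def jet (k : ℕ) {x : X} (f : HolCurve n x) : JetFiber n k x := Quotient.mk (jetSetoid n k x) f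

/-- The projection `p_{kj} : J^k X → J^j X` for `j ≤ k`, sending `j^k f (0)` to `j^j f (0)`. -/
def jetProj {j k : ℕ} (h : j ≤ k) (x : X) : JetFiber n k x → JetFiber n j x :=
  Quotient.map' (s₁ := jetSetoid n k x) (s₂ := jetSetoid n j x) id
    (fun _ _ hfg ↦ funext fun p ↦ congrFun hfg (Fin.castLE h p))

/-- The reparametrized curve `f_c (t) = f (c t)`. -/
def HolCurve.reparam {x : X} (c : ℂ) (f : HolCurve n x) : HolCurve n x where
  toFun t := f.toFun (c * t)
  map_zero := by rw [mul_zero]; exact f.map_zero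
  holo := by
    have h1 : ContMDiffAt 𝓘(ℂ) 𝓘(ℂ) ω (fun t : ℂ ↦ c * t) 0 :=
      (contDiff_const.mul contDiff_id).contMDiff.contMDiffAt
    have h2 : ContMDiffAt 𝓘(ℂ) 𝓘(ℂ, Cn n) ω f.toFun (c * 0) := by
      rw [mul_zero]; exact f.holo
    exact ContMDiffAt.comp (0 : ℂ) h2 h1

theorem iteratedDeriv_comp_mul {F : Type*} [NormedAddCommGroup F] [NormedSpace ℂ F]
    (c : ℂ) (g : ℂ → F) (p : ℕ) :
    iteratedDeriv p (fun t ↦ g (c * t)) = fun t ↦ c ^ p • iteratedDeriv p g (c * t) := by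
  induction p with
  | zero => simp
  | succ p ih =>
    rw [iteratedDeriv_succ, ih]
    funext t
    rw [deriv_fun_const_smul_field, deriv_comp_mul_left, iteratedDeriv_succ, smul_smul, pow_succ]

/-- The action of `ℂ^*` on the fibres of `J^k X` by reparametrization: `c • j^k f = j^k f_c`. -/
def jetScale (k : ℕ) {x : X} (c : ℂˣ) : JetFiber n k x → JetFiber n k x :=
  Quotient.map' (s₁ := jetSetoid n k x) (s₂ := jetSetoid n k x) (HolCurve.reparam (c : ℂ))
    (fun f g hfg ↦ funext fun p ↦ by
      have key : ∀ f : HolCurve n x,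
          jetCoord k (chartAt (Cn n) x) (HolCurve.reparam (c : ℂ) f).toFun p =
            (c : ℂ) ^ ((p : ℕ) + 1) • jetCoord k (chartAt (Cn n) x) f.toFun p := fun f ↦ by
        have := congrFun (iteratedDeriv_comp_mul (c : ℂ) (chartAt (Cn n) x ∘ f.toFun)
          ((p : ℕ) + 1)) 0
        simpa [jetCoord, HolCurve.reparam, Function.comp_def] using this
      rw [key, key]
      exact congrArg _ (congrFun hfg p))

/-! ### The structure sheaf -/

variable (n) in
/-- The ring of holomorphic functions on an open subset `U` of `X`. -/
abbrev Holo (U : Opens X) : Type u := C^ω⟮𝓘(ℂ, Cn n), U; 𝓘(ℂ), ℂ⟯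

variable (n X) in
/-- The presheaf of rings of holomorphic functions on `X`. -/
def holoPresheaf : (Opens (TopCat.of X))ᵒᵖ ⥤ CommRingCat.{u} where
  obj U := CommRingCat.of (Holo (X := X) n U.unop)
  map h := CommRingCat.ofHom (ContMDiffMap.restrictRingHom 𝓘(ℂ, Cn n) 𝓘(ℂ) ℂ h.unop.le)
  map_id _ := rfl
  map_comp _ _ := rfl

variable (n X) in
/-- Holomorphy is a local condition on functions. -/
def holoPredicate : TopCat.LocalPredicate (X := TopCat.of X) (fun _ ↦ ℂ) where
  pred {U} f := ContMDiff (M := (U : Opens X)) 𝓘(ℂ, Cn n) 𝓘(ℂ) ω f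
  res {U V} i f h := h.comp (contMDiff_inclusion i.le)
  locality {U} f h := by
    classical
    intro x
    obtain ⟨V, hxV, i, h⟩ := h x
    let g : X → ℂ := fun y ↦ if hy : y ∈ U then f ⟨y, hy⟩ else 0
    have hU : f = fun y : U ↦ g y := by
      funext y
      simp [g]
    have hV : (fun y : V ↦ f ⟨y, i.le y.2⟩) = fun y : V ↦ g y := by
      funext y
      have hy : y.1 ∈ U := i.le y.2
      simp [g, hy]
    change ContMDiff 𝓘(ℂ, Cn n) 𝓘(ℂ) ω (fun y : V ↦ f ⟨y, i.le y.2⟩) at h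
    rw [hV] at h
    rw [hU]
    exact contMDiffAt_subtype_iff.2
      ((contMDiffAt_subtype_iff (U := V) (f := g) (x := ⟨x.1, hxV⟩)).1 (h ⟨x.1, hxV⟩))

variable (n X) in
theorem holoPresheaf_isSheaf :
    Presheaf.IsSheaf (Opens.grothendieckTopology (TopCat.of X))
      (holoPresheaf n X ⋙ forget₂ CommRingCat RingCat) := by
  rw [Presheaf.isSheaf_iff_isSheaf_forget _ _ (forget RingCat)]
  exact TopCat.subpresheafToTypes.isSheaf (holoPredicate n X)

variable (n X) in
/-- The structure sheaf `𝒪_X` of holomorphic functions on `X`. -/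
abbrev structureSheaf : Sheaf (Opens.grothendieckTopology (TopCat.of X)) RingCat.{u} where
  obj := holoPresheaf n X ⋙ forget₂ CommRingCat RingCat
  property := holoPresheaf_isSheaf n X

/-! ### Sheaves of `𝒪_X`-modules given by sections of a family of vector spaces -/

section Sections

variable (A : X → Type u) [∀ x, AddCommGroup (A x)] [∀ x, Module ℂ (A x)]

variable (n) in
/-- A sheaf of `𝒪_X`-modules whose sections over `U` are some of the families `(s x ∈ A x)`,
`x ∈ U`: a local condition on such families, stable under addition and under multiplication by
holomorphic functions. -/
structure SectionSheaf extends TopCat.LocalPredicate (X := TopCat.of X) A where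
  zero_mem : ∀ U : Opens X, pred (U := U) (fun x : U ↦ (0 : A x))
  add_mem : ∀ (U : Opens X) (s t : ∀ x : U, A x), pred (U := U) s → pred (U := U) t →
    pred (U := U) (fun x : U ↦ s x + t x)
  smul_mem : ∀ (U : Opens X) (g : Holo n U) (s : ∀ x : U, A x), pred (U := U) s →
    pred (U := U) (fun x : U ↦ g x • s x)

variable {A}

namespace SectionSheaf

/-- The sections over an open subset. -/
def sections (F : SectionSheaf n A) (U : Opens X) : Type u :=
  { s : ∀ x : U, A x // F.pred (U := U) s }

variable (F : SectionSheaf n A) (U : Opens X)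

theorem neg_mem (s : ∀ x : U, A x) (h : F.pred (U := U) s) :
    F.pred (U := U) (fun x : U ↦ -s x) := by
  have := F.smul_mem U (-1) s h
  simpa using this

instance : AddCommGroup (F.sections U) :=
  inferInstanceAs (AddCommGroup (
    { carrier := {s | F.pred (U := U) s}
      zero_mem' := F.zero_mem U
      add_mem' := fun {s t} hs ht ↦ F.add_mem U s t hs ht
      neg_mem' := fun {s} hs ↦ F.neg_mem U s hs } : AddSubgroup (∀ x : U, A x)))

instance : Module (Holo n U) (F.sections U) where
  smul g s := ⟨fun x ↦ g x • s.1 x, F.smul_mem U g s.1 s.2⟩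
  one_smul s := Subtype.ext (funext fun x ↦ one_smul ℂ (s.1 x))
  mul_smul g h s := Subtype.ext (funext fun x ↦ mul_smul (g x) (h x) (s.1 x))
  smul_zero g := Subtype.ext (funext fun x ↦ smul_zero (g x))
  smul_add g s t := Subtype.ext (funext fun x ↦ smul_add (g x) (s.1 x) (t.1 x))
  add_smul g h s := Subtype.ext (funext fun x ↦ add_smul (g x) (h x) (s.1 x))
  zero_smul s := Subtype.ext (funext fun x ↦ zero_smul ℂ (s.1 x))

/-- The same module structure, over the ring of sections of the presheaf of rings. -/
instance (U : (Opens (TopCat.of X))ᵒᵖ) :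
    Module ((holoPresheaf n X ⋙ forget₂ CommRingCat RingCat).obj U) (F.sections U.unop) :=
  inferInstanceAs (Module (Holo n U.unop) (F.sections U.unop))

/-- The underlying presheaf of abelian groups. -/
def toPresheaf : (Opens (TopCat.of X))ᵒᵖ ⥤ Ab.{u} where
  obj U := AddCommGrpCat.of (F.sections U.unop)
  map i := AddCommGrpCat.ofHom
    { toFun := fun s ↦ ⟨fun x ↦ s.1 ⟨x.1, i.unop.le x.2⟩, F.res i.unop s.1 s.2⟩
      map_zero' := rfl
      map_add' := fun _ _ ↦ rfl }
  map_id _ := rfl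
  map_comp _ _ := rfl

instance (U : (Opens (TopCat.of X))ᵒᵖ) :
    Module ((holoPresheaf n X ⋙ forget₂ CommRingCat RingCat).obj U) (F.toPresheaf.obj U) :=
  inferInstanceAs (Module (Holo n U.unop) (F.sections U.unop))

/-- The underlying presheaf of `𝒪_X`-modules. -/
def toPresheafOfModules :
    PresheafOfModules.{u} (holoPresheaf n X ⋙ forget₂ CommRingCat RingCat) :=
  PresheafOfModules.ofPresheaf F.toPresheaf (fun _ _ _ _ _ ↦ rfl)

/-- The sheaf of `𝒪_X`-modules. -/
def toSheafOfModules : SheafOfModules.{u} (structureSheaf n X) where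
  val := F.toPresheafOfModules
  isSheaf := by
    rw [Presheaf.isSheaf_iff_isSheaf_forget _ _ (forget AddCommGrpCat)]
    exact TopCat.subpresheafToTypes.isSheaf F.toLocalPredicate

/-- Every section of the first sheaf is a section of the second one. -/
instance : LE (SectionSheaf n A) where
  le F G := ∀ (U : Opens X) (s : ∀ x : U, A x), F.pred (U := U) s → G.pred (U := U) s

/-- The inclusion of a subsheaf. -/
def incl {F G : SectionSheaf n A} (h : F ≤ G) : F.toSheafOfModules ⟶ G.toSheafOfModules where
  val :=
    { app := fun U ↦ ModuleCat.ofHom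
        { toFun := fun s ↦ ⟨s.1, h U.unop s.1 s.2⟩
          map_add' := fun _ _ ↦ rfl
          map_smul' := fun _ _ ↦ rfl }
      naturality := fun _ ↦ rfl }

/-- The quotient sheaf `G / F` of a sheaf of `𝒪_X`-modules by a subsheaf. -/
def quotient {F G : SectionSheaf n A} (h : F ≤ G) :
    SheafOfModules.{u} (structureSheaf n X) :=
  Limits.cokernel (incl h)

end SectionSheaf

end Sections

/-! ### Symmetric powers and tensor products of sheaves of modules -/

section SymmetricPower

variable {R S : Type u} [CommRing R] [CommRing S] {φ : R →+* S}
  {M : Type u} {N : Type u} [AddCommGroup M] [AddCommGroup N] [Module R M] [Module S N]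

theorem symPower_induction {ι : Type u} {p : SymmetricPower R ι M → Prop}
    (tprod : ∀ m : ι → M, p (SymmetricPower.tprod R m)) (zero : p 0)
    (add : ∀ x y, p x → p y → p (x + y)) (smul : ∀ (c : R) x, p x → p (c • x))
    (x : SymmetricPower R ι M) : p x := by
  have hx : x ∈ Submodule.span R (Set.range (SymmetricPower.tprod R (ι := ι) (M := M))) := by
    rw [SymmetricPower.span_tprod_eq_top]
    trivial
  induction hx using Submodule.span_induction with
  | mem x h => obtain ⟨m, rfl⟩ := h; exact tprod m
  | zero => exact zero
  | add x y _ _ hx hy => exact add x y hx hy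
  | smul c x _ hx => exact smul c x hx

/-- The symmetric multilinear map `(m₁, …, mᵢ) ↦ ρ m₁ ⋯ ρ mᵢ` for a semilinear map `ρ`, where
the symmetric power of `N` is an `R`-module through `φ`. -/
def symPowerMultilinear (ι : Type u) (ρ : M →ₛₗ[φ] N)
    [Module R (SymmetricPower S ι N)]
    (hφ : ∀ (c : R) (x : SymmetricPower S ι N), c • x = φ c • x) :
    MultilinearMap R (fun _ : ι ↦ M) (SymmetricPower S ι N) where
  toFun m := SymmetricPower.tprod S (fun i ↦ ρ (m i))
  map_update_add' := fun {_} m i x y ↦ by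
    have key : ∀ z, (fun j ↦ ρ (Function.update m i z j)) =
        Function.update (fun j ↦ ρ (m j)) i (ρ z) := fun z ↦ by
      funext j
      exact Function.apply_update (fun _ ↦ ρ) m i z j
    simp only [key, map_add, MultilinearMap.map_update_add]
  map_update_smul' := fun {_} m i c x ↦ by
    have key : ∀ z, (fun j ↦ ρ (Function.update m i z j)) =
        Function.update (fun j ↦ ρ (m j)) i (ρ z) := fun z ↦ by
      funext j
      exact Function.apply_update (fun _ ↦ ρ) m i z j
    simp only [key, map_smulₛₗ, MultilinearMap.map_update_smul, hφ]

theorem exists_symPowerMap (ι : Type u) (ρ : M →ₛₗ[φ] N) :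
    ∃ f : SymmetricPower R ι M →ₛₗ[φ] SymmetricPower S ι N, ∀ m : ι → M,
      f (SymmetricPower.tprod R m) = SymmetricPower.tprod S (fun i ↦ ρ (m i)) := by
  let _ : Module R (SymmetricPower S ι N) := Module.compHom _ φ
  let T := symPowerMultilinear ι ρ (fun _ _ ↦ rfl)
  have hT : ∀ f : ι → M, PiTensorProduct.lift T (PiTensorProduct.tprod R f) =
      SymmetricPower.tprod S (fun i ↦ ρ (f i)) := fun f ↦ PiTensorProduct.lift.tprod f
  let G : SymmetricPower R ι M →+ SymmetricPower S ι N :=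
    AddCon.lift _ (PiTensorProduct.lift T).toAddMonoidHom
      (AddCon.addConGen_le.2 (by
        rintro _ _ ⟨e, f⟩
        rw [AddCon.ker_rel]
        exact (hT f).trans ((SymmetricPower.tprod_equiv e (fun i ↦ ρ (f i))).symm.trans
          (hT fun i ↦ f (e i)).symm)))
  refine ⟨
    { toFun := G
      map_add' := G.map_add
      map_smul' := fun c x ↦ ?_ }, hT⟩
  induction x using AddCon.induction_on with
  | H x => exact (PiTensorProduct.lift T).map_smul c x

/-- The map `m₁ ⋯ mᵢ ↦ ρ m₁ ⋯ ρ mᵢ` induced on symmetric powers by a semilinear map `ρ`. -/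
def symPowerMap (ι : Type u) (ρ : M →ₛₗ[φ] N) :
    SymmetricPower R ι M →ₛₗ[φ] SymmetricPower S ι N :=
  (exists_symPowerMap ι ρ).choose

theorem symPowerMap_tprod (ι : Type u) (ρ : M →ₛₗ[φ] N) (m : ι → M) :
    symPowerMap ι ρ (SymmetricPower.tprod R m) = SymmetricPower.tprod S (fun i ↦ ρ (m i)) :=
  (exists_symPowerMap ι ρ).choose_spec m

end SymmetricPower

section SheafSym

variable (M : PresheafOfModules.{u} (holoPresheaf n X ⋙ forget₂ CommRingCat RingCat))

/-- The restriction `Sym^i_{𝒪(U)} M(U) → Sym^i_{𝒪(V)} M(V)`. -/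
def symRestrict (i : ℕ) {U V : (Opens (TopCat.of X))ᵒᵖ} (h : U ⟶ V) :
    SymmetricPower ((holoPresheaf n X).obj U) (ULift.{u} (Fin i)) (M.obj U)
      →ₛₗ[((holoPresheaf n X).map h).hom]
    SymmetricPower ((holoPresheaf n X).obj V) (ULift.{u} (Fin i)) (M.obj V) :=
  symPowerMap (R := (holoPresheaf n X).obj U) (S := (holoPresheaf n X).obj V)
    (φ := ((holoPresheaf n X).map h).hom) (ULift.{u} (Fin i)) (M.restrictₛₗ h)

theorem symRestrict_tprod (i : ℕ) {U V : (Opens (TopCat.of X))ᵒᵖ} (h : U ⟶ V)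
    (m : ULift.{u} (Fin i) → M.obj U) :
    symRestrict M i h (SymmetricPower.tprod ((holoPresheaf n X).obj U) m) =
      SymmetricPower.tprod ((holoPresheaf n X).obj V) (fun j ↦ M.restrictₛₗ h (m j)) :=
  symPowerMap_tprod (R := (holoPresheaf n X).obj U) (S := (holoPresheaf n X).obj V)
    (φ := ((holoPresheaf n X).map h).hom) (ULift.{u} (Fin i)) (M.restrictₛₗ h) m

theorem symRestrict_id (i : ℕ) {U : (Opens (TopCat.of X))ᵒᵖ}
    (x : SymmetricPower ((holoPresheaf n X).obj U) (ULift.{u} (Fin i)) (M.obj U)) :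
    symRestrict M i (𝟙 U) x = x := by
  induction x using symPower_induction with
  | tprod m =>
    rw [symRestrict_tprod]
    congr 1
    funext j
    change M.map (𝟙 U) (m j) = m j
    rw [M.map_id]
    rfl
  | zero => exact map_zero _
  | add x y hx hy => rw [map_add, hx, hy]
  | smul c x hx =>
    rw [map_smulₛₗ, hx]
    rfl

theorem symRestrict_comp (i : ℕ) {U V W : (Opens (TopCat.of X))ᵒᵖ} (f : U ⟶ V) (g : V ⟶ W)
    (x : SymmetricPower ((holoPresheaf n X).obj U) (ULift.{u} (Fin i)) (M.obj U)) :
    symRestrict M i (f ≫ g) x = symRestrict M i g (symRestrict M i f x) := by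
  induction x using symPower_induction with
  | tprod m =>
    rw [symRestrict_tprod, symRestrict_tprod, symRestrict_tprod]
    congr 1
    funext j
    exact M.map_comp_apply f g (m j)
  | zero => simp only [map_zero]
  | add x y hx hy => simp only [map_add, hx, hy]
  | smul c x hx =>
    rw [map_smulₛₗ, map_smulₛₗ, map_smulₛₗ, hx]
    rfl

/-- The presheaf of abelian groups underlying `U ↦ Sym^i_{𝒪(U)} M(U)`. -/
def symPresheafAb (i : ℕ) : (Opens (TopCat.of X))ᵒᵖ ⥤ Ab.{u} where
  obj U := AddCommGrpCat.of
    (SymmetricPower ((holoPresheaf n X).obj U) (ULift.{u} (Fin i)) (M.obj U))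
  map {U V} h := AddCommGrpCat.ofHom
    (symRestrict M i h).toAddMonoidHom
  map_id U := by
    ext x
    exact symRestrict_id M i x
  map_comp f g := by
    ext x
    exact symRestrict_comp M i f g x

instance (i : ℕ) (U : (Opens (TopCat.of X))ᵒᵖ) :
    Module ((holoPresheaf n X ⋙ forget₂ CommRingCat RingCat).obj U) ((symPresheafAb M i).obj U) :=
  inferInstanceAs (Module ((holoPresheaf n X).obj U)
    (SymmetricPower ((holoPresheaf n X).obj U) (ULift.{u} (Fin i)) (M.obj U)))

/-- The presheaf `U ↦ Sym^i_{𝒪(U)} M(U)`. -/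
def symPresheaf (i : ℕ) :
    PresheafOfModules.{u} (holoPresheaf n X ⋙ forget₂ CommRingCat RingCat) :=
  PresheafOfModules.ofPresheaf (symPresheafAb M i) (fun _ _ h r m ↦
    (symRestrict M i h).map_smulₛₗ r m)

variable (n X) in
/-- The sheaf associated to a presheaf of `𝒪_X`-modules. -/
def sheafify : PresheafOfModules.{u} (holoPresheaf n X ⋙ forget₂ CommRingCat RingCat) ⥤
    SheafOfModules.{u} (structureSheaf n X) :=
  PresheafOfModules.sheafification (R₀ := (structureSheaf n X).obj) (R := structureSheaf n X) (𝟙 _)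

/-- The tensor product `M ⊗_{𝒪_X} Sym^i N` of sheaves of `𝒪_X`-modules: the sheaf associated to
the presheaf `U ↦ M(U) ⊗_{𝒪(U)} Sym^i_{𝒪(U)} N(U)`. -/
def tensorSym (M N : SheafOfModules.{u} (structureSheaf n X)) (i : ℕ) :
    SheafOfModules.{u} (structureSheaf n X) :=
  (sheafify n X).obj
    (PresheafOfModules.Monoidal.tensorObj (R := holoPresheaf n X) M.val (symPresheaf N.val i))

end SheafSym

/-! ### Sheaves of sections described in holomorphic charts -/

section Charts

variable {A : X → Type u} [∀ x, AddCommGroup (A x)] [∀ x, Module ℂ (A x)]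

/-- A family `s` over `U` satisfies `Q` locally: for every chart `z` of `X`, every point of `U` in
the domain of `z` has a neighbourhood `V` in this domain such that the restriction of `s` to `V`
satisfies `Q z V`. -/
def LocallyInCharts
    (Q : OpenPartialHomeomorph X (Cn n) → (V : Opens X) → (∀ x : V, A x) → Prop)
    (U : Opens X) (s : ∀ x : U, A x) : Prop :=
  ∀ z ∈ atlas (Cn n) X, ∀ x ∈ U, x ∈ z.source → ∃ V : Opens X, x ∈ V ∧ (V : Set X) ⊆ z.source ∧
    ∃ hVU : V ≤ U, Q z V (fun y ↦ s ⟨y, hVU y.2⟩)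

/-- The coordinate expression of a holomorphic function on an open subset of a chart domain. -/
theorem Holo.exists_analytic [IsManifold 𝓘(ℂ, Cn n) ω X]
    (z : OpenPartialHomeomorph X (Cn n)) (hz : z ∈ atlas (Cn n) X) (V : Opens X)
    (hV : (V : Set X) ⊆ z.source) (g : Holo n V) :
    ∃ a : Cn n → ℂ, AnalyticOnNhd ℂ a (z '' V) ∧ ∀ x : V, g x = a (z x) := by
  classical
  let g' : X → ℂ := fun y ↦ if hy : y ∈ V then g ⟨y, hy⟩ else 0
  have hg : (g : V → ℂ) = fun y : V ↦ g' y := by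
    funext y
    simp [g']
  refine ⟨g' ∘ z.symm, ?_, fun x ↦ ?_⟩
  · rintro _ ⟨x, hx, rfl⟩
    have h1 : ContMDiffAt 𝓘(ℂ, Cn n) 𝓘(ℂ) ω g' x := by
      have h := g.contMDiff ⟨x, hx⟩
      rw [hg] at h
      exact contMDiffAt_subtype_iff.1 h
    have hzx : z x ∈ z.target := z.map_source (hV hx)
    have h2 : ContMDiffAt 𝓘(ℂ, Cn n) 𝓘(ℂ, Cn n) ω z.symm (z x) :=
      contMDiffAt_symm_of_mem_maximalAtlas (IsManifold.subset_maximalAtlas hz) hzx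
    have h3 : ContMDiffAt 𝓘(ℂ, Cn n) 𝓘(ℂ) ω (g' ∘ z.symm) (z x) := by
      refine ContMDiffAt.comp (z x) ?_ h2
      rw [z.left_inv (hV hx)]
      exact h1
    exact h3.contDiffAt.analyticAt
  · rw [hg]
    exact congrArg g' (z.left_inv (hV x.2)).symm

/-- The sheaf of families that satisfy `Q` locally in charts. -/
def SectionSheaf.ofCharts
    (Q : OpenPartialHomeomorph X (Cn n) → (V : Opens X) → (∀ x : V, A x) → Prop)
    (res : ∀ z (V W : Opens X) (h : W ≤ V) (s : ∀ x : V, A x), Q z V s →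
      Q z W (fun x ↦ s ⟨x, h x.2⟩))
    (zero : ∀ z V, Q z V (fun _ ↦ 0))
    (add : ∀ z V s t, Q z V s → Q z V t → Q z V (fun x ↦ s x + t x))
    (smul : ∀ z ∈ atlas (Cn n) X, ∀ V : Opens X, (V : Set X) ⊆ z.source →
      ∀ (g : Holo n V) (s : ∀ x : V, A x), Q z V s → Q z V (fun x ↦ g x • s x)) :
    SectionSheaf n A where
  pred {U} s := LocallyInCharts Q U s
  res {U V} i s h z hz x hx hxz := by
    obtain ⟨W, hxW, hWz, hWV, hQ⟩ := h z hz x (i.le hx) hxz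
    exact ⟨W ⊓ U, ⟨hxW, hx⟩, fun y hy ↦ hWz hy.1, inf_le_right,
      res z W (W ⊓ U) inf_le_left _ hQ⟩
  locality {U} s h z hz x hx hxz := by
    obtain ⟨V, hxV, i, h⟩ := h ⟨x, hx⟩
    obtain ⟨W, hxW, hWz, hWV, hQ⟩ := h z hz x hxV hxz
    exact ⟨W, hxW, hWz, hWV.trans i.le, hQ⟩
  zero_mem U z hz x hx hxz :=
    ⟨U ⊓ ⟨z.source, z.open_source⟩, ⟨hx, hxz⟩, fun y hy ↦ hy.2, inf_le_left, zero z _⟩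
  add_mem U s t hs ht z hz x hx hxz := by
    obtain ⟨V, hxV, hVz, hVU, hQ⟩ := hs z hz x hx hxz
    obtain ⟨W, hxW, hWz, hWU, hQ'⟩ := ht z hz x hx hxz
    exact ⟨V ⊓ W, ⟨hxV, hxW⟩, fun y hy ↦ hVz hy.1, inf_le_left.trans hVU,
      add z _ _ _ (res z V _ inf_le_left _ hQ) (res z W _ inf_le_right _ hQ')⟩
  smul_mem U g s hs z hz x hx hxz := by
    obtain ⟨V, hxV, hVz, hVU, hQ⟩ := hs z hz x hx hxz
    exact ⟨V, hxV, hVz, hVU,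
      smul z hz V hVz (ContMDiffMap.restrictRingHom 𝓘(ℂ, Cn n) 𝓘(ℂ) ℂ hVU g) _ hQ⟩

end Charts

/-! ### The cotangent sheaf and the sheaves of jet differentials -/

variable [IsManifold 𝓘(ℂ, Cn n) ω X]

variable (n X) in
/-- The cotangent sheaf `T^*X`: its sections are the families of linear forms on the tangent spaces
that are of the form `∑ⱼ aⱼ(z) dzⱼ` in local coordinates `z`, with holomorphic coefficients; here
`∑ⱼ aⱼ dzⱼ` is written as the composite of `a : ℂⁿ → (ℂⁿ)^*` with the differential of `z`. -/
def cotangentSheaf :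
    SectionSheaf n (fun x : X ↦ ULift.{u} (TangentSpace 𝓘(ℂ, Cn n) x →L[ℂ] ℂ)) :=
  SectionSheaf.ofCharts
    (fun z V s ↦ ∃ a : Cn n → (Cn n →L[ℂ] ℂ), AnalyticOnNhd ℂ a (z '' V) ∧
      ∀ x : V, (s x).down = (a (z x)).comp (mfderiv 𝓘(ℂ, Cn n) 𝓘(ℂ, Cn n) z (x : X)))
    (by
      rintro z V W h s ⟨a, ha, hs⟩
      exact ⟨a, ha.mono (Set.image_mono h), fun x ↦ hs ⟨x, h x.2⟩⟩)
    (fun z V ↦ ⟨0, analyticOnNhd_const, fun x ↦ rfl⟩)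
    (by
      rintro z V s t ⟨a, ha, hs⟩ ⟨b, hb, ht⟩
      refine ⟨a + b, ha.add hb, fun x ↦ ?_⟩
      rw [ULift.add_down, hs, ht]
      rfl)
    (by
      rintro z hz V hV g s ⟨a, ha, hs⟩
      obtain ⟨b, hb, hg⟩ := Holo.exists_analytic z hz V hV g
      refine ⟨fun w ↦ b w • a w, hb.smul ha, fun x ↦ ?_⟩
      rw [ULift.smul_down, hs, hg]
      rfl)

variable (n X) in
/-- The sheaf of holomorphic functions `ω : J^k X|_U → ℂ`: functions which in local coordinates `z`
are holomorphic functions of the `z`-coordinates of `f(0), f'(0), …, f^{(k)}(0)`. -/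
def jetFunctions (k : ℕ) : SectionSheaf n (fun x : X ↦ JetFiber n k x → ℂ) :=
  SectionSheaf.ofCharts
    (fun z V s ↦ ∃ h : Cn n × (Fin k → Cn n) → ℂ, AnalyticOnNhd ℂ h ((z '' V) ×ˢ Set.univ) ∧
      ∀ (x : V) (f : HolCurve n (x : X)), s x (jet k f) = h (z x, jetCoord k z f.toFun))
    (by
      rintro z V W h s ⟨a, ha, hs⟩
      exact ⟨a, ha.mono (Set.prod_mono (Set.image_mono h) subset_rfl), fun x ↦ hs ⟨x, h x.2⟩⟩)
    (fun z V ↦ ⟨0, analyticOnNhd_const, fun x f ↦ rfl⟩)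
    (by
      rintro z V s t ⟨a, ha, hs⟩ ⟨b, hb, ht⟩
      refine ⟨a + b, ha.add hb, fun x f ↦ ?_⟩
      change s x (jet k f) + t x (jet k f) = _
      rw [hs, ht]
      rfl)
    (by
      rintro z hz V hV g s ⟨a, ha, hs⟩
      obtain ⟨b, hb, hg⟩ := Holo.exists_analytic z hz V hV g
      refine ⟨fun w ↦ b w.1 • a w, fun w hw ↦ ?_, fun x f ↦ ?_⟩
      · exact ((hb w.1 hw.1).comp (f := Prod.fst) (g := b) analyticAt_fst).smul (ha w hw)
      · change g x • s x (jet k f) = _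
        rw [hs, hg])

variable (n X) in
/-- The sheaf `𝒥_k^m X` of `k`-jet differentials of weight `m`: holomorphic functions `ω` on
`J^k X|_U` with `ω(c • j) = c^m ω(j)` for all `c ∈ ℂ^*`. -/
def jetDifferentials (k m : ℕ) : SectionSheaf n (fun x : X ↦ JetFiber n k x → ℂ) where
  pred {U} s := (jetFunctions n X k).pred (U := U) s ∧
    ∀ (x : U) (c : ℂˣ) (j : JetFiber n k (x : X)), s x (jetScale k c j) = (c : ℂ) ^ m * s x j
  res i s h := ⟨(jetFunctions n X k).res i s h.1, fun x ↦ h.2 ⟨x.1, i.le x.2⟩⟩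
  locality s h := ⟨(jetFunctions n X k).locality s fun x ↦ by
      obtain ⟨V, hxV, i, h⟩ := h x
      exact ⟨V, hxV, i, h.1⟩, fun x ↦ by
      obtain ⟨V, hxV, i, h⟩ := h x
      exact h.2 ⟨x.1, hxV⟩⟩
  zero_mem U := ⟨(jetFunctions n X k).zero_mem U, fun x c j ↦ by simp⟩
  add_mem U s t hs ht := ⟨(jetFunctions n X k).add_mem U s t hs.1 ht.1, fun x c j ↦ by
    simp only [Pi.add_apply, hs.2, ht.2, mul_add]⟩
  smul_mem U g s hs := ⟨(jetFunctions n X k).smul_mem U g s hs.1, fun x c j ↦ by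
    simp only [Pi.smul_apply, hs.2, smul_eq_mul, mul_left_comm]⟩

/-- The pull-back of a family of functions on the fibres of `J^j X` to `J^k X`, for `j ≤ k`:
`(p_{kj}^* ω)(j^k f) = ω(j^j f)`. -/
def jetPullback {j k : ℕ} (h : j ≤ k) (U : Opens X) (t : ∀ x : U, JetFiber n j (x : X) → ℂ) :
    ∀ x : U, JetFiber n k (x : X) → ℂ :=
  fun x ξ ↦ t x (jetProj h (x : X) ξ)

variable (n) in
/-- The exponents `(I_1, …, I_k)`, each `I_p` a multi-index in `ℕⁿ`, with
`|I_1| + 2 |I_2| + ⋯ + k |I_k| = m` and `|I_k| ≤ i`.  The entry `α p l` is the exponent of the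
`l`-th coordinate of `f^{(p + 1)}`; by the weight condition all entries are at most `m`. -/
def jetExponents (k m i : ℕ) : Finset (Fin k → Fin n → ℕ) :=
  (Fintype.piFinset fun _ ↦ Fintype.piFinset fun _ ↦ Finset.range (m + 1)).filter fun α ↦
    ∑ p : Fin k, ((p : ℕ) + 1) * ∑ l, α p l = m ∧ ∀ p : Fin k, (p : ℕ) + 1 = k → ∑ l, α p l ≤ i

variable (n X) in
/-- The sheaf `ℱ_k^i ⊆ 𝒥_k^m X` of functions that in local coordinates `z` are of the form
`∑ a_{I_1, …, I_k}(z) (f')^{I_1} ⋯ (f^{(k)})^{I_k}` with holomorphic coefficients, the sum being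
over the exponents with `|I_1| + 2 |I_2| + ⋯ + k |I_k| = m` and `|I_k| ≤ i`. -/
def jetFiltration (k m i : ℕ) : SectionSheaf n (fun x : X ↦ JetFiber n k x → ℂ) :=
  SectionSheaf.ofCharts
    (fun z V s ↦ ∃ a : (Fin k → Fin n → ℕ) → Cn n → ℂ,
      (∀ α ∈ jetExponents n k m i, AnalyticOnNhd ℂ (a α) (z '' V)) ∧
      ∀ (x : V) (f : HolCurve n (x : X)), s x (jet k f) =
        ∑ α ∈ jetExponents n k m i,
          a α (z x) * ∏ p, ∏ l, (jetCoord k z f.toFun p l) ^ (α p l))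
    (by
      rintro z V W h s ⟨a, ha, hs⟩
      exact ⟨a, fun α hα ↦ (ha α hα).mono (Set.image_mono h), fun x ↦ hs ⟨x, h x.2⟩⟩)
    (fun z V ↦ ⟨0, fun _ _ ↦ analyticOnNhd_const, fun x f ↦ by simp⟩)
    (by
      rintro z V s t ⟨a, ha, hs⟩ ⟨b, hb, ht⟩
      refine ⟨a + b, fun α hα ↦ (ha α hα).add (hb α hα), fun x f ↦ ?_⟩
      change s x (jet k f) + t x (jet k f) = _
      rw [hs, ht, ← Finset.sum_add_distrib]
      simp only [Pi.add_apply, add_mul])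
    (by
      rintro z hz V hV g s ⟨a, ha, hs⟩
      obtain ⟨b, hb, hg⟩ := Holo.exists_analytic z hz V hV g
      refine ⟨fun α w ↦ b w * a α w, fun α hα ↦ hb.mul (ha α hα), fun x f ↦ ?_⟩
      change g x • s x (jet k f) = _
      rw [hs, hg, smul_eq_mul, Finset.mul_sum]
      simp only [mul_assoc])

end JetDiff

end

/-!
Everything is read off in a holomorphic chart `z`. There the fibres of `J^k X` are identified with
`(ℂⁿ)^k` by `j^k f ↦ ((z ∘ f)', …, (z ∘ f)^{(k)})` (`coord_bijective`), and `ℂ^*` acts with weight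
`p` on the `p`-th derivative. A holomorphic function which is homogeneous of weight `m` for this
action is a polynomial with holomorphic coefficients (`isJetPolynomial_of_homogeneous`): Euler's
identity expresses it through its partial derivatives, which are homogeneous of smaller weight, and
vanish if this weight is negative. Hence a section of `𝒥_k^m` is locally a combination of the
monomials in the definition of `ℱ_k^{[m/k]}`, since its degree in the last derivative is at most
`m/k`.

To see the filtration without charts, let a tangent vector `v` translate a jet `ξ` in its last
derivative (`jetTranslate`). This does not depend on the chart, because a change of coordinates acts
on `f^{(k)}` by its differential, up to adding a function of the lower derivatives. So
`ℱ_k^i` consists of the functions which have degree at most `i` along these translations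
(`jetFiltration_pred_iff_fibreDegreeLE`). For `i = 0` these are the functions pulled back from
`J^{k-1} X`. In general, the coefficient of `t^i` of `t ↦ ω(ξ + t v)`, the symbol of `ω`, depends
only on `v` and on the image of `ξ` in `J^{k-1} X`, it is homogeneous of degree `i` in `v` and of
weight `m - k i` in the jet, and it vanishes precisely on `ℱ_k^{i-1}`. The symbol is locally
surjective onto the sheaf `symbolSheaf` of all such functions, which gives
`nonempty_quotient_iso_symbolSheaf`.

It remains to identify `symbolSheaf` with `𝒥_{k-1}^{m-ki} X ⊗ Sym^i T^*X`. The morphism sends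
`ω ⊗ θ_1 ⋯ θ_i` to `(ξ, v) ↦ ω(ξ) θ_1(v) ⋯ θ_i(v)`.
On an open subset of a chart domain `T^*X` is generated by the `dz_l`, so every element of the
tensor product is a sum of `ω_f ⊗ dz_{f 1} ⋯ dz_{f i}` over monotone `f`. As distinct monomials in
`v` are linearly independent, the morphism is injective there; it is locally surjective by the
polynomial form of symbols. A locally bijective morphism into a sheaf identifies the associated
sheaf with its target (`nonempty_sheafify_iso`).
-/

noncomputable section

namespace JetDiff

universe u

/-! ### Weighted homogeneous holomorphic functions are polynomial -/

section Euler

variable {n k : ℕ}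

/-- The weighted action of `c ∈ ℂ` on jet coordinates: the derivative of order `p` is multiplied
by `c ^ p`. -/
def scaleCoord (c : ℂ) (v : Fin k → Cn n) : Fin k → Cn n := fun p ↦ c ^ ((p : ℕ) + 1) • v p

/-- The monomial `(f')^{I_1} ⋯ (f^{(k)})^{I_k}` as a function of the jet coordinates. -/
def jetMonomial (α : Fin k → Fin n → ℕ) (v : Fin k → Cn n) : ℂ := ∏ p, ∏ l, v p l ^ α p l

/-- The weight `|I_1| + 2 |I_2| + ⋯ + k |I_k|`. -/
def jetWeight (α : Fin k → Fin n → ℕ) : ℕ := ∑ p : Fin k, ((p : ℕ) + 1) * ∑ l, α p l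

/-- The vector in the space of jet coordinates all of whose entries vanish, except for the `l`-th
coordinate of the derivative of order `p + 1`, which is `1`. -/
def coordVec (p : Fin k) (l : Fin n) : Fin k → Cn n := Pi.single p (EuclideanSpace.single l 1)

theorem scaleCoord_one (v : Fin k → Cn n) : scaleCoord 1 v = v := by
  funext p; simp [scaleCoord]

theorem scaleCoord_add_smul (c t : ℂ) (v : Fin k → Cn n) (p : Fin k) (l : Fin n) :
    scaleCoord c (v + t • coordVec p l) =
      scaleCoord c v + (t * c ^ ((p : ℕ) + 1)) • coordVec p l := by
  funext q
  by_cases h : q = p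
  · subst h
    simp [scaleCoord, coordVec, smul_add, smul_smul, mul_comm]
  · simp [scaleCoord, coordVec, h]

theorem eq_sum_coordVec (v : Fin k → Cn n) : v = ∑ p, ∑ l, v p l • coordVec p l := by
  funext q
  ext j
  simp only [Finset.sum_apply, Pi.smul_apply, coordVec, WithLp.ofLp_sum, WithLp.ofLp_smul]
  rw [Finset.sum_eq_single q]
  · simp
  · intro p _ hp
    simp [hp.symm]
  · simp

theorem tendsto_scaleCoord_zero (v : Fin k → Cn n) :
    Filter.Tendsto (fun c : ℂ ↦ scaleCoord c v) (nhdsWithin 0 {0}ᶜ) (nhds 0) := by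
  have h : Continuous fun c : ℂ ↦ scaleCoord c v := by
    unfold scaleCoord
    fun_prop
  have h0 : scaleCoord 0 v = 0 := by
    funext p; simp [scaleCoord]
  exact (h0 ▸ h.tendsto 0).mono_left nhdsWithin_le_nhds

/-- `h` is a polynomial in the jet coordinates, weighted homogeneous of weight `m`, with
coefficients that are holomorphic functions on `W`.  The monomials may be repeated, so that the
class is visibly stable under sums and products. -/
def IsJetPolynomial (m : ℕ) (W : Set (Cn n)) (h : Cn n × (Fin k → Cn n) → ℂ) : Prop :=
  ∃ (ι : Type) (_ : Fintype ι) (α : ι → Fin k → Fin n → ℕ) (a : ι → Cn n → ℂ),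
    (∀ i, jetWeight (α i) = m) ∧ (∀ i, AnalyticOnNhd ℂ (a i) W) ∧
      ∀ x ∈ W, ∀ v, h (x, v) = ∑ i, a i x * jetMonomial (α i) v

theorem IsJetPolynomial.congr {m : ℕ} {W : Set (Cn n)} {h h' : Cn n × (Fin k → Cn n) → ℂ}
    (H : IsJetPolynomial m W h) (e : ∀ x ∈ W, ∀ v, h' (x, v) = h (x, v)) :
    IsJetPolynomial m W h' := by
  obtain ⟨ι, _, α, a, h1, h2, h3⟩ := H
  exact ⟨ι, inferInstance, α, a, h1, h2, fun x hx v ↦ (e x hx v).trans (h3 x hx v)⟩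

theorem IsJetPolynomial.zero {m : ℕ} {W : Set (Cn n)} :
    IsJetPolynomial m W (fun _ : Cn n × (Fin k → Cn n) ↦ (0 : ℂ)) :=
  ⟨Empty, inferInstance, Empty.elim, Empty.elim, fun i ↦ i.elim, fun i ↦ i.elim, by simp⟩

theorem IsJetPolynomial.sum {m : ℕ} {W : Set (Cn n)} {κ : Type} [Fintype κ]
    {h : κ → Cn n × (Fin k → Cn n) → ℂ} (H : ∀ j, IsJetPolynomial m W (h j)) :
    IsJetPolynomial m W (fun y ↦ ∑ j, h j y) := by
  choose ι _ α a h1 h2 h3 using H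
  refine ⟨Σ j, ι j, inferInstance, fun i ↦ α i.1 i.2, fun i ↦ a i.1 i.2, fun i ↦ h1 i.1 i.2,
    fun i ↦ h2 i.1 i.2, fun x hx v ↦ ?_⟩
  rw [Fintype.sum_sigma]
  exact Finset.sum_congr rfl fun j _ ↦ h3 j x hx v

theorem IsJetPolynomial.const_mul {m : ℕ} {W : Set (Cn n)} {h : Cn n × (Fin k → Cn n) → ℂ}
    (H : IsJetPolynomial m W h) (c : ℂ) : IsJetPolynomial m W (fun y ↦ c * h y) := by
  obtain ⟨ι, _, α, a, h1, h2, h3⟩ := H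
  refine ⟨ι, inferInstance, α, fun i x ↦ c * a i x, h1, fun i ↦ analyticOnNhd_const.mul (h2 i),
    fun x hx v ↦ ?_⟩
  simp only [h3 x hx v, Finset.mul_sum, mul_assoc]

theorem jetWeight_add (α β : Fin k → Fin n → ℕ) :
    jetWeight (α + β) = jetWeight α + jetWeight β := by
  simp only [jetWeight, Pi.add_apply, Finset.sum_add_distrib, mul_add]

theorem jetMonomial_add (α β : Fin k → Fin n → ℕ) (v : Fin k → Cn n) :
    jetMonomial (α + β) v = jetMonomial α v * jetMonomial β v := by
  simp only [jetMonomial, Pi.add_apply, pow_add, Finset.prod_mul_distrib]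

theorem jetWeight_single (p : Fin k) (l : Fin n) :
    jetWeight (Pi.single p (Pi.single l 1) : Fin k → Fin n → ℕ) = (p : ℕ) + 1 := by
  unfold jetWeight
  rw [Finset.sum_eq_single p]
  · simp
  · intro q _ hq
    simp [hq]
  · simp

theorem jetMonomial_single (p : Fin k) (l : Fin n) (v : Fin k → Cn n) :
    jetMonomial (Pi.single p (Pi.single l 1)) v = v p l := by
  unfold jetMonomial
  rw [Finset.prod_eq_single p]
  · rw [Finset.prod_eq_single l]
    · simp
    · intro q _ hq
      simp [hq]
    · simp
  · intro q _ hq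
    simp [hq]
  · simp

theorem IsJetPolynomial.coord_mul {m : ℕ} {W : Set (Cn n)} {h : Cn n × (Fin k → Cn n) → ℂ}
    (H : IsJetPolynomial m W h) (p : Fin k) (l : Fin n) :
    IsJetPolynomial (m + ((p : ℕ) + 1)) W (fun y ↦ y.2 p l * h y) := by
  obtain ⟨ι, _, α, a, h1, h2, h3⟩ := H
  refine ⟨ι, inferInstance, fun i ↦ α i + Pi.single p (Pi.single l 1), a, fun i ↦ ?_, h2,
    fun x hx v ↦ ?_⟩
  · rw [jetWeight_add, h1, jetWeight_single]
  · simp only [h3 x hx v, Finset.mul_sum, jetMonomial_add, jetMonomial_single]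
    exact Finset.sum_congr rfl fun i _ ↦ by ring

theorem mem_jetExponents {m i : ℕ} {α : Fin k → Fin n → ℕ} :
    α ∈ jetExponents n k m i ↔
      jetWeight α = m ∧ ∀ p : Fin k, (p : ℕ) + 1 = k → ∑ l, α p l ≤ i := by
  unfold jetExponents
  rw [Finset.mem_filter]
  refine and_iff_right_iff_imp.2 ?_
  rintro ⟨h, -⟩
  simp only [Fintype.mem_piFinset, Finset.mem_range]
  intro p l
  have h1 : α p l ≤ ∑ l, α p l := Finset.single_le_sum (fun _ _ ↦ Nat.zero_le _)
    (Finset.mem_univ l)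
  have h2 : ((p : ℕ) + 1) * ∑ l, α p l ≤ m := h ▸ Finset.single_le_sum
    (f := fun p : Fin k ↦ ((p : ℕ) + 1) * ∑ l, α p l) (fun _ _ ↦ Nat.zero_le _)
    (Finset.mem_univ p)
  nlinarith

/-- Collecting equal monomials: a weighted homogeneous polynomial of weight `m` is a combination
of the monomials indexed by `jetExponents`; the bound `m / k` on `|I_k|` is automatic. -/
theorem IsJetPolynomial.exists_coeff {m : ℕ} {W : Set (Cn n)} {h : Cn n × (Fin k → Cn n) → ℂ}
    (H : IsJetPolynomial m W h) :
    ∃ a : (Fin k → Fin n → ℕ) → Cn n → ℂ, (∀ α, AnalyticOnNhd ℂ (a α) W) ∧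
      ∀ x ∈ W, ∀ v, h (x, v) = ∑ α ∈ jetExponents n k m (m / k), a α x * jetMonomial α v := by
  classical
  obtain ⟨ι, _, α, a, h1, h2, h3⟩ := H
  refine ⟨fun β x ↦ ∑ i with α i = β, a i x, fun β ↦ ?_, fun x hx v ↦ ?_⟩
  · exact Finset.analyticOnNhd_fun_sum _ fun i _ ↦ h2 i
  · have key : ∀ i ∈ Finset.univ, α i ∈ jetExponents n k m (m / k) := fun i _ ↦ by
      refine mem_jetExponents.2 ⟨h1 i, fun p hp ↦ ?_⟩
      rw [Nat.le_div_iff_mul_le (by omega), ← h1 i, mul_comm]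
      have h := Finset.single_le_sum
        (f := fun p : Fin k ↦ ((p : ℕ) + 1) * ∑ l, α i p l) (fun _ _ ↦ Nat.zero_le _)
        (Finset.mem_univ p)
      rw [jetWeight]
      simpa only [hp] using h
    rw [h3 x hx v, ← Finset.sum_fiberwise_of_maps_to key]
    refine Finset.sum_congr rfl fun β _ ↦ ?_
    rw [Finset.sum_mul]
    refine Finset.sum_congr rfl fun i hi ↦ ?_
    rw [(Finset.mem_filter.1 hi).2]

/-- The partial derivative of `h` with respect to the `l`-th coordinate of the derivative of order
`p + 1`. -/
def coordDeriv (h : Cn n × (Fin k → Cn n) → ℂ) (p : Fin k) (l : Fin n) :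
    Cn n × (Fin k → Cn n) → ℂ := fun y ↦ fderiv ℂ h y (0, coordVec p l)

theorem analyticOnNhd_coordDeriv {S : Set (Cn n × (Fin k → Cn n))}
    {h : Cn n × (Fin k → Cn n) → ℂ} (hh : AnalyticOnNhd ℂ h S) (p : Fin k) (l : Fin n) :
    AnalyticOnNhd ℂ (coordDeriv h p l) S := by
  have h1 := hh.fderiv
  exact ((ContinuousLinearMap.apply ℂ ℂ
    ((0, coordVec p l) : Cn n × (Fin k → Cn n))).analyticOnNhd Set.univ).comp h1
      (Set.mapsTo_univ _ _)

theorem hasDerivAt_coordDeriv {h : Cn n × (Fin k → Cn n) → ℂ} {x : Cn n} {v : Fin k → Cn n}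
    (hh : DifferentiableAt ℂ h (x, v)) (p : Fin k) (l : Fin n) :
    HasDerivAt (fun t : ℂ ↦ h (x, v + t • coordVec p l)) (coordDeriv h p l (x, v)) 0 := by
  have h1 : HasDerivAt (fun t : ℂ ↦ ((x, v + t • coordVec p l) : Cn n × (Fin k → Cn n)))
      (0, coordVec p l) 0 := by
    refine (hasDerivAt_const _ _).prodMk ?_
    simpa using ((hasDerivAt_id (0 : ℂ)).smul_const (coordVec p l)).const_add v
  have h2 : HasFDerivAt h (fderiv ℂ h (x, v)) (x, v + (0 : ℂ) • coordVec p l) := by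
    simpa using hh.hasFDerivAt
  exact h2.comp_hasDerivAt (0 : ℂ) h1

variable {W : Set (Cn n)} {h : Cn n × (Fin k → Cn n) → ℂ}

theorem coordDeriv_scaleCoord {m : ℕ} (hh : AnalyticOnNhd ℂ h (W ×ˢ Set.univ))
    (hw : ∀ x ∈ W, ∀ c : ℂ, c ≠ 0 → ∀ v, h (x, scaleCoord c v) = c ^ m * h (x, v))
    {x : Cn n} (hx : x ∈ W) {c : ℂ} (hc : c ≠ 0) (p : Fin k) (l : Fin n) (v : Fin k → Cn n) :
    c ^ ((p : ℕ) + 1) * coordDeriv h p l (x, scaleCoord c v) =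
      c ^ m * coordDeriv h p l (x, v) := by
  have h1 := (hasDerivAt_coordDeriv (hh (x, v) ⟨hx, trivial⟩).differentiableAt p l).const_mul
    (c ^ m)
  have h2 := hasDerivAt_coordDeriv (hh (x, scaleCoord c v) ⟨hx, trivial⟩).differentiableAt p l
  have h3 : HasDerivAt (fun t : ℂ ↦ t * c ^ ((p : ℕ) + 1)) (c ^ ((p : ℕ) + 1)) 0 := by
    simpa using (hasDerivAt_id (0 : ℂ)).mul_const (c ^ ((p : ℕ) + 1))
  have h4 := HasDerivAt.comp (0 : ℂ) (h := fun t : ℂ ↦ t * c ^ ((p : ℕ) + 1))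
    (by rw [zero_mul]; exact h2) h3
  rw [mul_comm]
  refine h4.unique (h1.congr_of_eventuallyEq (Filter.Eventually.of_forall fun t ↦ ?_))
  simp only [Function.comp_apply]
  rw [← hw x hx c hc, scaleCoord_add_smul]

theorem euler_identity {m : ℕ} (hh : AnalyticOnNhd ℂ h (W ×ˢ Set.univ))
    (hw : ∀ x ∈ W, ∀ c : ℂ, c ≠ 0 → ∀ v, h (x, scaleCoord c v) = c ^ m * h (x, v))
    {x : Cn n} (hx : x ∈ W) (v : Fin k → Cn n) :
    m * h (x, v) = ∑ p : Fin k, ∑ l, ((p : ℕ) + 1 : ℂ) * (v p l * coordDeriv h p l (x, v)) := by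
  have h1 : HasDerivAt (fun c : ℂ ↦ ((x, scaleCoord c v) : Cn n × (Fin k → Cn n)))
      (0, fun p ↦ ((p : ℕ) + 1 : ℂ) • v p) 1 := by
    refine (hasDerivAt_const _ _).prodMk (hasDerivAt_pi.2 fun p ↦ ?_)
    simpa [scaleCoord] using (hasDerivAt_pow ((p : ℕ) + 1) (1 : ℂ)).smul_const (v p)
  have h2 : HasFDerivAt h (fderiv ℂ h (x, v)) (x, scaleCoord 1 v) := by
    rw [scaleCoord_one]
    exact (hh (x, v) ⟨hx, trivial⟩).differentiableAt.hasFDerivAt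
  have h3 := h2.comp_hasDerivAt (1 : ℂ) h1
  have h4 : HasDerivAt (fun c : ℂ ↦ c ^ m * h (x, v)) (m * h (x, v)) 1 := by
    simpa using (hasDerivAt_pow m (1 : ℂ)).mul_const (h (x, v))
  have h5 := h4.unique (h3.congr_of_eventuallyEq
    ((eventually_ne_nhds one_ne_zero).mono fun c hc ↦ (hw x hx c hc v).symm))
  rw [h5, eq_sum_coordVec (fun p : Fin k ↦ ((p : ℕ) + 1 : ℂ) • v p)]
  have h6 : ((0, ∑ p : Fin k, ∑ l, (((p : ℕ) + 1 : ℂ) • v p) l • coordVec p l) :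
      Cn n × (Fin k → Cn n)) = ∑ p : Fin k, ∑ l, (((p : ℕ) + 1 : ℂ) * v p l) •
        ((0, coordVec p l) : Cn n × (Fin k → Cn n)) := by
    ext1
    · simp [Prod.fst_sum]
    · simp [Prod.snd_sum]
  rw [h6]
  simp only [map_sum, map_smul, smul_eq_mul, coordDeriv, mul_assoc]

theorem tendsto_scaleCoord_comp {g : Cn n × (Fin k → Cn n) → ℂ} {x : Cn n}
    (hg : ContinuousAt g (x, 0)) (v : Fin k → Cn n) :
    Filter.Tendsto (fun c : ℂ ↦ g (x, scaleCoord c v)) (nhdsWithin 0 {0}ᶜ) (nhds (g (x, 0))) :=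
  hg.tendsto.comp (tendsto_const_nhds.prodMk_nhds (tendsto_scaleCoord_zero v))

/-- A holomorphic function of the jet coordinates which is weighted homogeneous of weight `m` is a
polynomial in them.  Euler's identity expresses it through its partial derivatives, which have
smaller weight. -/
theorem isJetPolynomial_of_homogeneous {m : ℕ} (hh : AnalyticOnNhd ℂ h (W ×ˢ Set.univ))
    (hw : ∀ x ∈ W, ∀ c : ℂ, c ≠ 0 → ∀ v, h (x, scaleCoord c v) = c ^ m * h (x, v)) :
    IsJetPolynomial m W h := by
  induction m using Nat.strong_induction_on generalizing h with
  | _ m ih =>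
  rcases Nat.eq_zero_or_pos m with rfl | hm
  · -- a function of weight `0` is constant along the orbits, hence equal to its value at `v = 0`
    refine ⟨Unit, inferInstance, fun _ ↦ 0, fun _ x ↦ h (x, 0), fun _ ↦ by simp [jetWeight],
      fun _ x hx ↦ ?_, fun x hx v ↦ ?_⟩
    · exact AnalyticAt.fun_comp (hh (x, 0) ⟨hx, trivial⟩) (analyticAt_id.prod analyticAt_const)
    · have h1 := tendsto_scaleCoord_comp (hh (x, 0) ⟨hx, trivial⟩).continuousAt v
      have h2 : Filter.Tendsto (fun c : ℂ ↦ h (x, scaleCoord c v)) (nhdsWithin 0 {0}ᶜ)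
          (nhds (h (x, v))) := by
        refine tendsto_const_nhds.congr' ?_
        filter_upwards [self_mem_nhdsWithin] with c hc
        rw [hw x hx c hc v, pow_zero, one_mul]
      simpa [jetMonomial] using tendsto_nhds_unique h2 h1
  · have key : ∀ (p : Fin k) (l : Fin n),
        IsJetPolynomial m W (fun y ↦ y.2 p l * coordDeriv h p l y) := fun p l ↦ by
      have ha := analyticOnNhd_coordDeriv hh p l
      rcases le_or_gt ((p : ℕ) + 1) m with hp | hp
      · obtain ⟨r, rfl⟩ := Nat.exists_eq_add_of_le' hp
        refine (ih r (by omega) ha fun x hx c hc v ↦ ?_).coord_mul p l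
        refine mul_left_cancel₀ (pow_ne_zero ((p : ℕ) + 1) hc) ?_
        rw [coordDeriv_scaleCoord hh hw hx hc p l v]
        ring
      · -- the partial derivative would have negative weight, so it vanishes
        obtain ⟨r, hr⟩ := Nat.exists_eq_add_of_lt hp
        refine IsJetPolynomial.zero.congr fun x hx v ↦ ?_
        have h1 := tendsto_scaleCoord_comp (ha (x, 0) ⟨hx, trivial⟩).continuousAt v
        have h0 : Filter.Tendsto (fun c : ℂ ↦ c ^ (r + 1)) (nhdsWithin 0 {0}ᶜ) (nhds 0) := by
          have : Continuous fun c : ℂ ↦ c ^ (r + 1) := by fun_prop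
          simpa using (this.tendsto 0).mono_left nhdsWithin_le_nhds
        have h2 : Filter.Tendsto (fun c : ℂ ↦ c ^ (r + 1) * coordDeriv h p l (x, scaleCoord c v))
            (nhdsWithin 0 {0}ᶜ) (nhds (coordDeriv h p l (x, v))) := by
          refine tendsto_const_nhds.congr' ?_
          filter_upwards [self_mem_nhdsWithin] with c hc
          refine mul_left_cancel₀ (pow_ne_zero m hc) ?_
          rw [← coordDeriv_scaleCoord hh hw hx hc p l v, hr]
          ring
        have h3 := tendsto_nhds_unique h2 (h0.mul h1)
        simp only [h3, zero_mul, mul_zero]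
    have h1 : IsJetPolynomial m W (fun y ↦ (m : ℂ)⁻¹ * ∑ p : Fin k, ∑ l,
        ((p : ℕ) + 1 : ℂ) * (y.2 p l * coordDeriv h p l y)) :=
      (IsJetPolynomial.sum fun p ↦ IsJetPolynomial.sum fun l ↦ (key p l).const_mul _).const_mul _
    refine h1.congr fun x hx v ↦ ?_
    have hm' : (m : ℂ) ≠ 0 := Nat.cast_ne_zero.2 hm.ne'
    rw [eq_inv_mul_iff_mul_eq₀ hm']
    exact euler_identity hh hw hx v

end Euler

/-! ### Higher derivatives of a composition -/

section ChainRule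

variable {E F : Type*} [NormedAddCommGroup E] [NormedSpace ℂ E] [NormedAddCommGroup F]
  [NormedSpace ℂ F]

theorem analyticAt_clm_apply {G : Type*} [NormedAddCommGroup G] [NormedSpace ℂ G]
    {A : G → E →L[ℂ] F} {b : G → E} {y : G}
    (hA : AnalyticAt ℂ A y) (hb : AnalyticAt ℂ b y) : AnalyticAt ℂ (fun z ↦ A z (b z)) y :=
  ((ContinuousLinearMap.id ℂ (E →L[ℂ] F)).analyticAt_bilinear (A y, b y)).comp₂ hA hb

theorem hasDerivAt_iteratedDeriv [CompleteSpace E] {f : ℂ → E} {t : ℂ}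
    (hf : AnalyticAt ℂ f t) (p : ℕ) :
    HasDerivAt (iteratedDeriv p f) (iteratedDeriv (p + 1) f t) t := by
  rw [iteratedDeriv_succ, iteratedDeriv_eq_iterate]
  exact (hf.iterated_deriv p).differentiableAt.hasDerivAt

/-- The chain rule for higher derivatives: `(φ ∘ f)^{(p + 1)}` is the sum of `dφ (f^{(p + 1)})` and
of a holomorphic function of `f, f', …, f^{(p)}`. -/
theorem exists_iteratedDeriv_comp [CompleteSpace E] [CompleteSpace F] {W : Set E} (hW : IsOpen W)
    {φ : E → F} (hφ : AnalyticOnNhd ℂ φ W) (p : ℕ) :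
    ∃ R : E × (Fin p → E) → F, AnalyticOnNhd ℂ R (W ×ˢ Set.univ) ∧
      ∀ (f : ℂ → E) (t : ℂ), AnalyticAt ℂ f t → f t ∈ W →
        iteratedDeriv (p + 1) (φ ∘ f) t = fderiv ℂ φ (f t) (iteratedDeriv (p + 1) f t) +
          R (f t, fun q ↦ iteratedDeriv ((q : ℕ) + 1) f t) := by
  induction p with
  | zero =>
    refine ⟨0, analyticOnNhd_const, fun f t hf ht ↦ ?_⟩
    simp only [zero_add, iteratedDeriv_one, Pi.zero_apply, add_zero]
    exact ((hφ _ ht).differentiableAt.hasFDerivAt.comp_hasDerivAt t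
      hf.differentiableAt.hasDerivAt).deriv
  | succ p ih =>
    obtain ⟨R, hR, h⟩ := ih
    refine ⟨fun y ↦ fderiv ℂ (fderiv ℂ φ) y.1 (y.2 0) (y.2 (Fin.last p)) +
      fderiv ℂ R (y.1, Fin.init y.2) (y.2 0, Fin.tail y.2), fun y hy ↦ ?_, fun f t hf ht ↦ ?_⟩
    · have e : ∀ q, AnalyticAt ℂ (fun y : E × (Fin (p + 1) → E) ↦ y.2 q) y := fun q ↦
        ((ContinuousLinearMap.proj (R := ℂ) q).comp
          (ContinuousLinearMap.snd ℂ E (Fin (p + 1) → E))).analyticAt y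
      refine (analyticAt_clm_apply (analyticAt_clm_apply ?_ (e 0)) (e (Fin.last p))).add
        (analyticAt_clm_apply ?_ ((e 0).prod (AnalyticAt.pi fun q ↦ e q.succ)))
      · exact (hφ.fderiv.fderiv y.1 hy.1).comp analyticAt_fst
      · exact (hR.fderiv (y.1, Fin.init y.2) ⟨hy.1, trivial⟩).comp_of_eq
          (analyticAt_fst.prod (AnalyticAt.pi fun q ↦ e q.castSucc)) rfl
    · have h1 : iteratedDeriv (p + 1) (φ ∘ f) =ᶠ[nhds t] fun s ↦
          fderiv ℂ φ (f s) (iteratedDeriv (p + 1) f s) +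
            R (f s, fun q ↦ iteratedDeriv ((q : ℕ) + 1) f s) := by
        filter_upwards [hf.eventually_analyticAt,
          hf.continuousAt.eventually_mem (hW.mem_nhds ht)] with s hs hs' using h f s hs hs'
      rw [iteratedDeriv_succ, h1.deriv_eq]
      have hf1 := hasDerivAt_iteratedDeriv hf
      have hf0 : HasDerivAt f (iteratedDeriv 1 f t) t := by simpa using hf1 0
      have h2 := ((hφ.fderiv _ ht).differentiableAt.hasFDerivAt.comp_hasDerivAt t hf0).clm_apply
        (hf1 (p + 1))
      have h3 := (hR (f t, fun q ↦ iteratedDeriv ((q : ℕ) + 1) f t)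
        ⟨ht, trivial⟩).differentiableAt.hasFDerivAt.comp_hasDerivAt t
          (hf0.prodMk (hasDerivAt_pi.2 fun q : Fin p ↦ hf1 ((q : ℕ) + 1)))
      refine (h2.add h3).deriv.trans ?_
      rw [add_assoc, add_comm, add_assoc]
      refine congrArg₂ _ rfl ?_
      rw [add_comm]
      rfl

/-- The map which describes the effect of `φ` on jet coordinates is holomorphic, and the entry of
order `p + 1` depends on the derivative of order `p + 1` in an affine way, with linear part
`dφ`, and only on the derivatives up to this order. -/
theorem exists_jet_transition [CompleteSpace E] [CompleteSpace F] {W : Set E} (hW : IsOpen W)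
    {φ : E → F} (hφ : AnalyticOnNhd ℂ φ W) (k : ℕ) :
    ∃ Ψ : E × (Fin k → E) → Fin k → F, AnalyticOnNhd ℂ Ψ (W ×ˢ Set.univ) ∧
      (∀ (f : ℂ → E), AnalyticAt ℂ f 0 → f 0 ∈ W →
        (fun p : Fin k ↦ iteratedDeriv ((p : ℕ) + 1) (φ ∘ f) 0) =
          Ψ (f 0, fun p ↦ iteratedDeriv ((p : ℕ) + 1) f 0)) ∧
      ∀ (x : E) (v v' : Fin k → E) (p : Fin k), (∀ q < p, v q = v' q) →
        Ψ (x, v') p = Ψ (x, v) p + fderiv ℂ φ x (v' p - v p) := by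
  choose R hR h using exists_iteratedDeriv_comp hW hφ
  refine ⟨fun y p ↦ fderiv ℂ φ y.1 (y.2 p) + R p (y.1, fun q ↦ y.2 (Fin.castLE p.2.le q)),
    fun y hy ↦ AnalyticAt.pi fun p ↦ ?_, fun f hf hf0 ↦ funext fun p ↦ h p f 0 hf hf0,
    fun x v v' p hp ↦ ?_⟩
  · have e : ∀ q, AnalyticAt ℂ (fun y : E × (Fin k → E) ↦ y.2 q) y := fun q ↦
      ((ContinuousLinearMap.proj (R := ℂ) q).comp
        (ContinuousLinearMap.snd ℂ E (Fin k → E))).analyticAt y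
    refine (analyticAt_clm_apply ((hφ.fderiv y.1 hy.1).comp analyticAt_fst) (e p)).add ?_
    exact (hR p (y.1, fun q ↦ y.2 (Fin.castLE p.2.le q)) ⟨hy.1, trivial⟩).comp_of_eq
      (analyticAt_fst.prod (AnalyticAt.pi fun q ↦ e _)) rfl
  · have e : (fun q : Fin p ↦ v (Fin.castLE p.2.le q)) = fun q ↦ v' (Fin.castLE p.2.le q) :=
      funext fun q ↦ hp _ q.2
    simp only [e, map_sub]
    abel

theorem hasDerivAt_taylorSum (N : ℕ) (c : ℕ → E) (t : ℂ) :
    HasDerivAt (fun t : ℂ ↦ ∑ j ∈ Finset.range (N + 1), (t ^ j / (j.factorial : ℂ)) • c j)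
      (∑ j ∈ Finset.range N, (t ^ j / (j.factorial : ℂ)) • c (j + 1)) t := by
  simp only [Finset.sum_range_succ' _ N]
  have h : ∀ j : ℕ, HasDerivAt
      (fun t : ℂ ↦ (t ^ (j + 1) / ((j + 1).factorial : ℂ)) • c (j + 1))
      ((t ^ j / (j.factorial : ℂ)) • c (j + 1)) t := fun j ↦ by
    have h1 := ((hasDerivAt_pow (j + 1) t).div_const ((j + 1).factorial : ℂ)).smul_const (c (j + 1))
    convert h1 using 2
    have : (j.factorial : ℂ) ≠ 0 := Nat.cast_ne_zero.2 j.factorial_ne_zero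
    have : ((j : ℂ) + 1) ≠ 0 := Nat.cast_add_one_ne_zero j
    rw [Nat.factorial_succ]
    push_cast
    field_simp
  exact (HasDerivAt.fun_sum (u := Finset.range N) fun j _ ↦ h j).add_const
    ((t ^ 0 / (Nat.factorial 0 : ℂ)) • c 0)

theorem iteratedDeriv_taylorSum (N : ℕ) (c : ℕ → E) {q : ℕ} (hq : q < N) :
    iteratedDeriv q (fun t : ℂ ↦ ∑ j ∈ Finset.range N, (t ^ j / (j.factorial : ℂ)) • c j) 0 =
      c q := by
  induction q generalizing N c with
  | zero =>
    obtain ⟨N, rfl⟩ := Nat.exists_eq_add_of_lt hq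
    simp [Finset.sum_range_succ']
  | succ q ih =>
    obtain ⟨N, rfl⟩ : ∃ M, N = M + 1 := ⟨N - 1, by omega⟩
    rw [iteratedDeriv_succ', funext fun t ↦ (hasDerivAt_taylorSum N c t).deriv]
    exact ih N (fun j ↦ c (j + 1)) (by omega)

/-- There are curves with arbitrary derivatives of order `1, …, k` at `0`. -/
theorem exists_curve (x : E) {k : ℕ} (v : Fin k → E) :
    ∃ f : ℂ → E, (∀ t, AnalyticAt ℂ f t) ∧ f 0 = x ∧
      ∀ p : Fin k, iteratedDeriv ((p : ℕ) + 1) f 0 = v p := by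
  let c : ℕ → E := fun j ↦ if h : j - 1 < k then (if j = 0 then x else v ⟨j - 1, h⟩) else x
  have hc : c 0 = x := by simp [c]
  refine ⟨fun t ↦ ∑ j ∈ Finset.range (k + 1), (t ^ j / (j.factorial : ℂ)) • c j, fun t ↦ ?_,
    ?_, fun p ↦ ?_⟩
  · refine Finset.analyticAt_fun_sum _ fun j _ ↦ AnalyticAt.smul ?_ analyticAt_const
    exact (analyticAt_id.pow j).div_const
  · rw [← hc]
    exact iteratedDeriv_taylorSum (k + 1) c (Nat.succ_pos k)
  · rw [iteratedDeriv_taylorSum (k + 1) c (by omega)]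
    simp [c]

end ChainRule

/-! ### Jet coordinates -/

section Jets

variable {n k : ℕ} {X : Type u} [TopologicalSpace X] [ChartedSpace (Cn n) X]

theorem jet_surjective {x : X} (ξ : JetFiber n k x) : ∃ f : HolCurve n x, jet k f = ξ :=
  Quotient.exists_rep ξ

/-- The coordinates of a jet in a chart `z`, computed with a representative.  For a chart of the
atlas whose domain contains the base point the representative does not matter, see
`coord_jet`. -/
def coord (k : ℕ) (z : OpenPartialHomeomorph X (Cn n)) {x : X} (ξ : JetFiber n k x) :
    Fin k → Cn n :=
  jetCoord k z (Quotient.out (s := jetSetoid n k x) ξ).toFun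

/-- The differential of a chart. -/
def diffl (z : OpenPartialHomeomorph X (Cn n)) (x : X) :
    TangentSpace 𝓘(ℂ, Cn n) x →L[ℂ] Cn n :=
  mfderiv 𝓘(ℂ, Cn n) 𝓘(ℂ, Cn n) z x

variable [IsManifold 𝓘(ℂ, Cn n) ω X]
variable {z w : OpenPartialHomeomorph X (Cn n)} (hz : z ∈ atlas (Cn n) X)
  (hw : w ∈ atlas (Cn n) X) {x : X} (hx : x ∈ z.source) (hxw : x ∈ w.source)

include hz hx in
theorem analyticAt_chart_comp (f : HolCurve n x) : AnalyticAt ℂ (z ∘ f.toFun) 0 := by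
  have h1 : ContMDiffAt 𝓘(ℂ, Cn n) 𝓘(ℂ, Cn n) ω z (f.toFun 0) := by
    rw [f.map_zero]
    exact contMDiffAt_of_mem_maximalAtlas (IsManifold.subset_maximalAtlas hz) hx
  exact (h1.comp (0 : ℂ) f.holo).contDiffAt.analyticAt

include hz hw in
theorem analyticOnNhd_transition :
    AnalyticOnNhd ℂ (w ∘ z.symm) (z.symm ≫ₕ w).source := by
  intro y hy
  rw [OpenPartialHomeomorph.trans_source] at hy
  have h1 : ContMDiffAt 𝓘(ℂ, Cn n) 𝓘(ℂ, Cn n) ω z.symm y :=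
    contMDiffAt_symm_of_mem_maximalAtlas (IsManifold.subset_maximalAtlas hz) hy.1
  have h2 : ContMDiffAt 𝓘(ℂ, Cn n) 𝓘(ℂ, Cn n) ω w (z.symm y) :=
    contMDiffAt_of_mem_maximalAtlas (IsManifold.subset_maximalAtlas hw) hy.2
  exact (h2.comp y h1).contDiffAt.analyticAt

omit [ChartedSpace (Cn n) X] [IsManifold 𝓘(ℂ, Cn n) ω X] in
include hx hxw in
theorem mem_transition_source : z x ∈ (z.symm ≫ₕ w).source := by
  rw [OpenPartialHomeomorph.trans_source]
  refine ⟨z.map_source hx, ?_⟩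
  rw [Set.mem_preimage, z.left_inv hx]
  exact hxw

omit [IsManifold 𝓘(ℂ, Cn n) ω X] in
include hx in
theorem jetCoord_transition (f : HolCurve n x) (p : ℕ) :
    iteratedDeriv p (w ∘ f.toFun) 0 = iteratedDeriv p ((w ∘ z.symm) ∘ (z ∘ f.toFun)) 0 := by
  refine Filter.EventuallyEq.iteratedDeriv_eq p ?_
  have h : f.toFun 0 ∈ z.source := by rw [f.map_zero]; exact hx
  filter_upwards [f.holo.continuousAt.eventually_mem (z.open_source.mem_nhds h)] with t ht
  simp [z.left_inv ht]

instance : IsManifold 𝓘(ℂ, Cn n) 1 X := IsManifold.of_le (n := ω) le_top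

/-- The differential of a chart, as an isomorphism. -/
def difflEquiv : TangentSpace 𝓘(ℂ, Cn n) x ≃L[ℂ] Cn n :=
  (mdifferentiable_of_mem_atlas (I := 𝓘(ℂ, Cn n)) hz).mfderiv hx

theorem difflEquiv_apply (v : TangentSpace 𝓘(ℂ, Cn n) x) : difflEquiv hz hx v = diffl z x v := rfl

include hz hw hx hxw in
theorem diffl_transition (v : TangentSpace 𝓘(ℂ, Cn n) x) :
    diffl w x v = fderiv ℂ (w ∘ z.symm) (z x) (diffl z x v) := by
  have h1 : MDifferentiableAt 𝓘(ℂ, Cn n) 𝓘(ℂ, Cn n) z x := mdifferentiableAt_atlas hz hx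
  have h2 : MDifferentiableAt 𝓘(ℂ, Cn n) 𝓘(ℂ, Cn n) (w ∘ z.symm) (z x) :=
    (analyticOnNhd_transition hz hw _
      (mem_transition_source hx hxw)).differentiableAt.mdifferentiableAt
  have h3 := mfderiv_comp x h2 h1
  rw [mfderiv_eq_fderiv] at h3
  have h4 : (w ∘ z.symm) ∘ z =ᶠ[nhds x] w := by
    filter_upwards [z.open_source.mem_nhds hx] with y hy
    simp [z.left_inv hy]
  rw [h4.mfderiv_eq] at h3
  exact DFunLike.congr_fun h3 v

variable (k) in
include hz hw in
/-- The change of jet coordinates between two charts. -/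
theorem exists_coord_transition :
    ∃ Ψ : Cn n × (Fin k → Cn n) → Fin k → Cn n,
      AnalyticOnNhd ℂ Ψ ((z.symm ≫ₕ w).source ×ˢ Set.univ) ∧
      (∀ x : X, x ∈ z.source → x ∈ w.source → ∀ f : HolCurve n x,
        jetCoord k w f.toFun = Ψ (z x, jetCoord k z f.toFun)) ∧
      ∀ (x : Cn n) (v v' : Fin k → Cn n) (p : Fin k), (∀ q < p, v q = v' q) →
        Ψ (x, v') p = Ψ (x, v) p + fderiv ℂ (w ∘ z.symm) x (v' p - v p) := by
  obtain ⟨Ψ, h1, h2, h3⟩ := exists_jet_transition (z.symm ≫ₕ w).open_source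
    (analyticOnNhd_transition hz hw) k
  refine ⟨Ψ, h1, fun x hx hxw f ↦ ?_, h3⟩
  have h4 : (z ∘ f.toFun) 0 = z x := congrArg z f.map_zero
  have h5 := h2 (z ∘ f.toFun) (analyticAt_chart_comp hz hx f)
    (by rw [h4]; exact mem_transition_source hx hxw)
  rw [h4] at h5
  refine Eq.trans ?_ h5
  funext p
  exact jetCoord_transition hx f _

include hz hx in
theorem jet_eq_iff (f g : HolCurve n x) :
    jet k f = jet k g ↔ jetCoord k z f.toFun = jetCoord k z g.toFun := by
  have hc := chart_mem_atlas (Cn n) x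
  have hxc := mem_chart_source (Cn n) x
  have h : jet k f = jet k g ↔
      jetCoord k (chartAt (Cn n) x) f.toFun = jetCoord k (chartAt (Cn n) x) g.toFun :=
    Quotient.eq (r := jetSetoid n k x)
  rw [h]
  constructor
  · intro e
    obtain ⟨Ψ, -, h2, -⟩ := exists_coord_transition k hc hz
    rw [h2 x hxc hx, h2 x hxc hx, e]
  · intro e
    obtain ⟨Ψ, -, h2, -⟩ := exists_coord_transition k hz hc
    rw [h2 x hx hxc, h2 x hx hxc, e]

include hz hx in
theorem coord_jet (f : HolCurve n x) : coord k z (jet k f) = jetCoord k z f.toFun := by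
  refine (jet_eq_iff hz hx _ _).1 ?_
  exact Quotient.out_eq (s := jetSetoid n k x) _

include hz hx in
theorem exists_holCurve (v : Fin k → Cn n) : ∃ f : HolCurve n x, jetCoord k z f.toFun = v := by
  obtain ⟨f, hf, hf0, hv⟩ := exists_curve (z x) v
  have h0 : ContMDiffAt 𝓘(ℂ, Cn n) 𝓘(ℂ, Cn n) ω z.symm (f 0) := by
    rw [hf0]
    exact contMDiffAt_symm_of_mem_maximalAtlas (IsManifold.subset_maximalAtlas hz)
      (z.map_source hx)
  refine ⟨⟨z.symm ∘ f, ?_, h0.comp (0 : ℂ) (hf 0).contDiffAt.contMDiffAt⟩, funext fun p ↦ ?_⟩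
  · simp [hf0, z.left_inv hx]
  · refine Eq.trans (Filter.EventuallyEq.iteratedDeriv_eq _ ?_) (hv p)
    have h : f 0 ∈ z.target := by rw [hf0]; exact z.map_source hx
    filter_upwards [(hf 0).continuousAt.eventually_mem (z.open_target.mem_nhds h)] with t ht
    simp [z.right_inv ht]

include hz hx in
theorem coord_bijective : Function.Bijective (coord k z : JetFiber n k x → Fin k → Cn n) := by
  constructor
  · intro ξ η h
    obtain ⟨f, rfl⟩ := jet_surjective ξ
    obtain ⟨g, rfl⟩ := jet_surjective η
    rw [coord_jet hz hx, coord_jet hz hx] at h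
    exact (jet_eq_iff hz hx f g).2 h
  · intro v
    obtain ⟨f, hf⟩ := exists_holCurve (k := k) hz hx v
    exact ⟨jet k f, (coord_jet hz hx f).trans hf⟩

variable (k) in
include hz hw in
/-- The change of coordinates of jets between two charts. -/
theorem exists_coord_transition' :
    ∃ Ψ : Cn n × (Fin k → Cn n) → Fin k → Cn n,
      AnalyticOnNhd ℂ Ψ ((z.symm ≫ₕ w).source ×ˢ Set.univ) ∧
      (∀ x : X, x ∈ z.source → x ∈ w.source → ∀ ξ : JetFiber n k x,
        coord k w ξ = Ψ (z x, coord k z ξ)) ∧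
      ∀ (x : Cn n) (v v' : Fin k → Cn n) (p : Fin k), (∀ q < p, v q = v' q) →
        Ψ (x, v') p = Ψ (x, v) p + fderiv ℂ (w ∘ z.symm) x (v' p - v p) := by
  obtain ⟨Ψ, h1, h2, h3⟩ := exists_coord_transition k hz hw
  refine ⟨Ψ, h1, fun x hx hxw ξ ↦ ?_, h3⟩
  obtain ⟨f, rfl⟩ := jet_surjective ξ
  rw [coord_jet hz hx, coord_jet hw hxw, h2 x hx hxw]

include hz hx in
theorem coord_jetScale (c : ℂˣ) (ξ : JetFiber n k x) :
    coord k z (jetScale k c ξ) = scaleCoord (c : ℂ) (coord k z ξ) := by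
  obtain ⟨f, rfl⟩ := jet_surjective ξ
  have h : jetScale k c (jet k f) = jet k (HolCurve.reparam (c : ℂ) f) := rfl
  rw [h, coord_jet hz hx, coord_jet hz hx]
  funext p
  have := congrFun (iteratedDeriv_comp_mul (c : ℂ) (z ∘ f.toFun) ((p : ℕ) + 1)) 0
  simpa [jetCoord, HolCurve.reparam, Function.comp_def, scaleCoord] using this

include hz hx in
theorem coord_jetProj {j : ℕ} (h : j ≤ k) (ξ : JetFiber n k x) :
    coord j z (jetProj h x ξ) = fun p ↦ coord k z ξ (Fin.castLE h p) := by
  obtain ⟨f, rfl⟩ := jet_surjective ξ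
  have e : jetProj h x (jet k f) = jet j f := rfl
  rw [e, coord_jet hz hx, coord_jet hz hx]
  rfl

/-- Translation of a jet of order `k + 1` along the fibre of `J^{k+1} X → J^k X` by a tangent
vector: in every chart the vector is added to the derivative of order `k + 1`, see
`coord_jetTranslate`. -/
def jetTranslate (ξ : JetFiber n (k + 1) x) (v : TangentSpace 𝓘(ℂ, Cn n) x) :
    JetFiber n (k + 1) x :=
  (Equiv.ofBijective _ (coord_bijective (k := k + 1) (chart_mem_atlas (Cn n) x)
    (mem_chart_source (Cn n) x))).symm
      (coord (k + 1) (chartAt (Cn n) x) ξ + Pi.single (Fin.last k) (diffl (chartAt (Cn n) x) x v))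

include hz hx in
theorem coord_jetTranslate (ξ : JetFiber n (k + 1) x) (v : TangentSpace 𝓘(ℂ, Cn n) x) :
    coord (k + 1) z (jetTranslate ξ v) =
      coord (k + 1) z ξ + Pi.single (Fin.last k) (diffl z x v) := by
  have hc := chart_mem_atlas (Cn n) x
  have hxc := mem_chart_source (Cn n) x
  have h0 : coord (k + 1) (chartAt (Cn n) x) (jetTranslate ξ v) =
      coord (k + 1) (chartAt (Cn n) x) ξ +
        Pi.single (Fin.last k) (diffl (chartAt (Cn n) x) x v) :=
    (Equiv.ofBijective _ (coord_bijective (k := k + 1) hc hxc)).apply_symm_apply _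
  obtain ⟨Ψ, -, h2, h3⟩ := exists_coord_transition' (k + 1) hc hz
  rw [h2 x hxc hx, h2 x hxc hx, h0]
  funext p
  have e : ∀ q < Fin.last k, coord (k + 1) (chartAt (Cn n) x) ξ q =
      (coord (k + 1) (chartAt (Cn n) x) ξ + (Pi.single (Fin.last k)
        (diffl (chartAt (Cn n) x) x v) : Fin (k + 1) → Cn n)) q := fun q hq ↦ by
    simp [hq.ne]
  rw [h3 _ _ _ p fun q hq ↦ e q (hq.trans_le (Fin.le_last p)), Pi.add_apply, Pi.add_apply,
    add_sub_cancel_left]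
  congr 1
  rcases eq_or_ne p (Fin.last k) with rfl | hp
  · rw [Pi.single_eq_same, Pi.single_eq_same, diffl_transition hc hz hxc hx]
  · rw [Pi.single_eq_of_ne hp, Pi.single_eq_of_ne hp, map_zero]

theorem jetProj_jetTranslate (ξ : JetFiber n (k + 1) x) (v : TangentSpace 𝓘(ℂ, Cn n) x) :
    jetProj (Nat.le_succ k) x (jetTranslate ξ v) = jetProj (Nat.le_succ k) x ξ := by
  have hc := chart_mem_atlas (Cn n) x
  have hxc := mem_chart_source (Cn n) x
  refine (coord_bijective hc hxc).1 ?_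
  rw [coord_jetProj hc hxc, coord_jetProj hc hxc, coord_jetTranslate hc hxc]
  funext p
  have : Fin.castLE (Nat.le_succ k) p ≠ Fin.last k := (Fin.castSucc_lt_last p).ne
  simp [this]

/-- The fibres of `J^{k+1} X → J^k X` are orbits under translation. -/
theorem exists_jetTranslate_eq {ξ η : JetFiber n (k + 1) x}
    (h : jetProj (Nat.le_succ k) x ξ = jetProj (Nat.le_succ k) x η) :
    ∃ v, jetTranslate ξ v = η := by
  have hc := chart_mem_atlas (Cn n) x
  have hxc := mem_chart_source (Cn n) x
  refine ⟨(difflEquiv hc hxc).symm (coord (k + 1) (chartAt (Cn n) x) η (Fin.last k) -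
    coord (k + 1) (chartAt (Cn n) x) ξ (Fin.last k)), (coord_bijective hc hxc).1 ?_⟩
  have h1 := congrArg (coord k (chartAt (Cn n) x)) h
  rw [coord_jetProj hc hxc, coord_jetProj hc hxc] at h1
  rw [coord_jetTranslate hc hxc, ← difflEquiv_apply hc hxc, ContinuousLinearEquiv.apply_symm_apply]
  funext p
  refine Fin.lastCases ?_ (fun q ↦ ?_) p
  · simp
  · have : q.castSucc ≠ Fin.last k := (Fin.castSucc_lt_last q).ne
    simp only [Pi.add_apply, Pi.single_eq_of_ne this, add_zero]
    exact congrFun h1 q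

/-- A jet of order `k + 1` over a given jet of order `k`. -/
def jetLift (ξ : JetFiber n k x) : JetFiber n (k + 1) x :=
  jet (k + 1) (Quotient.out (s := jetSetoid n k x) ξ)

omit [IsManifold 𝓘(ℂ, Cn n) ω X] in
theorem jetProj_jetLift (ξ : JetFiber n k x) : jetProj (Nat.le_succ k) x (jetLift ξ) = ξ :=
  Quotient.out_eq (s := jetSetoid n k x) ξ

end Jets

/-! ### Polynomial functions of one variable and their top coefficients -/

section TopCoefficient

/-- `g` is a polynomial function of degree at most `i`, and the coefficient of degree `i` is
`c`. -/
def HasTopCoeff (i : ℕ) (c : ℂ) (g : ℂ → ℂ) : Prop :=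
  ∃ q : Polynomial ℂ, q.natDegree ≤ i ∧ q.coeff i = c ∧ ∀ t, g t = q.eval t

/-- The coefficient of degree `i` of a polynomial function of degree at most `i`, computed as
an iterated difference: this expression is additive in arbitrary functions `g`. -/
def topCoeff (i : ℕ) (g : ℂ → ℂ) : ℂ := (i.factorial : ℂ)⁻¹ * (fwdDiff 1)^[i] g 0

theorem topCoeff_add (i : ℕ) (g h : ℂ → ℂ) :
    topCoeff i (g + h) = topCoeff i g + topCoeff i h := by
  simp only [topCoeff, fwdDiff_iter_add, Pi.add_apply, mul_add]

theorem topCoeff_const_mul (i : ℕ) (c : ℂ) (g : ℂ → ℂ) :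
    topCoeff i (fun t ↦ c * g t) = c * topCoeff i g := by
  have h : (fwdDiff 1)^[i] (fun t ↦ c * g t) = c • (fwdDiff 1)^[i] g :=
    fwdDiff_iter_const_smul (h := (1 : ℂ)) c g i
  simp only [topCoeff, h, Pi.smul_apply, smul_eq_mul]
  ring

theorem HasTopCoeff.topCoeff_eq {i : ℕ} {c : ℂ} {g : ℂ → ℂ} (h : HasTopCoeff i c g) :
    topCoeff i g = c := by
  obtain ⟨q, hq, rfl, hg⟩ := h
  have e : g = q.eval := funext hg
  unfold topCoeff
  rcases hq.eq_or_lt with h | h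
  · rw [e, ← h, Polynomial.fwdDiff_iter_degree_eq_factorial]
    have : (q.natDegree.factorial : ℂ) ≠ 0 := Nat.cast_ne_zero.2 (Nat.factorial_ne_zero _)
    simp only [Pi.smul_apply, Pi.natCast_apply, smul_eq_mul, Polynomial.leadingCoeff]
    field_simp
  · rw [e, Polynomial.fwdDiff_iter_eq_zero_of_degree_lt h,
      Polynomial.coeff_eq_zero_of_natDegree_lt h]
    simp

theorem hasTopCoeff_const (c : ℂ) : HasTopCoeff 0 c (fun _ ↦ c) :=
  ⟨Polynomial.C c, by simp, by simp, by simp⟩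

theorem hasTopCoeff_linear (a b : ℂ) : HasTopCoeff 1 b (fun t ↦ a + t * b) :=
  ⟨Polynomial.C a + Polynomial.X * Polynomial.C b, by compute_degree, by simp [Polynomial.coeff_C],
    fun t ↦ by simp only [Polynomial.eval_add, Polynomial.eval_mul, Polynomial.eval_C,
      Polynomial.eval_X]⟩

theorem HasTopCoeff.mul {i j : ℕ} {c d : ℂ} {g h : ℂ → ℂ} (hg : HasTopCoeff i c g)
    (hh : HasTopCoeff j d h) : HasTopCoeff (i + j) (c * d) (fun t ↦ g t * h t) := by
  obtain ⟨q, hq, rfl, e⟩ := hg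
  obtain ⟨r, hr, rfl, e'⟩ := hh
  exact ⟨q * r, Polynomial.natDegree_mul_le_of_le hq hr,
    Polynomial.coeff_mul_add_eq_of_natDegree_le hq hr, fun t ↦ by
      simp only [e, e', Polynomial.eval_mul]⟩

theorem HasTopCoeff.pow {i : ℕ} {c : ℂ} {g : ℂ → ℂ} (hg : HasTopCoeff i c g) (r : ℕ) :
    HasTopCoeff (r * i) (c ^ r) (fun t ↦ g t ^ r) := by
  obtain ⟨q, hq, rfl, e⟩ := hg
  refine ⟨q ^ r, Polynomial.natDegree_pow_le_of_le r hq, ?_,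
    fun t ↦ by simp only [e, Polynomial.eval_pow]⟩
  rw [Polynomial.coeff_pow_of_natDegree_le hq]

theorem HasTopCoeff.prod {ι : Type*} (s : Finset ι) {i : ι → ℕ} {c : ι → ℂ} {g : ι → ℂ → ℂ}
    (h : ∀ j, HasTopCoeff (i j) (c j) (g j)) :
    HasTopCoeff (∑ j ∈ s, i j) (∏ j ∈ s, c j) (fun t ↦ ∏ j ∈ s, g j t) := by
  classical
  induction s using Finset.induction_on with
  | empty => simpa using hasTopCoeff_const 1
  | insert a s ha ih =>
    simp only [Finset.sum_insert ha, Finset.prod_insert ha]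
    exact (h a).mul ih

theorem HasTopCoeff.sum {ι : Type*} (s : Finset ι) {i : ℕ} {c : ι → ℂ} {g : ι → ℂ → ℂ}
    (h : ∀ j ∈ s, HasTopCoeff i (c j) (g j)) :
    HasTopCoeff i (∑ j ∈ s, c j) (fun t ↦ ∑ j ∈ s, g j t) := by
  choose! q hq hc e using h
  refine ⟨∑ j ∈ s, q j, Polynomial.natDegree_sum_le_of_forall_le _ _ hq, ?_, fun t ↦ ?_⟩
  · rw [Polynomial.finsetSum_coeff]
    exact Finset.sum_congr rfl hc
  · rw [Polynomial.eval_finsetSum]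
    exact Finset.sum_congr rfl fun j hj ↦ e j hj t

theorem HasTopCoeff.const_mul {i : ℕ} {c : ℂ} {g : ℂ → ℂ} (hg : HasTopCoeff i c g) (a : ℂ) :
    HasTopCoeff i (a * c) (fun t ↦ a * g t) := by
  simpa using (hasTopCoeff_const a).mul hg

theorem HasTopCoeff.of_lt {i j : ℕ} {c : ℂ} {g : ℂ → ℂ} (hg : HasTopCoeff i c g) (h : i < j) :
    HasTopCoeff j 0 g := by
  obtain ⟨q, hq, -, e⟩ := hg
  exact ⟨q, hq.trans h.le, Polynomial.coeff_eq_zero_of_natDegree_lt (hq.trans_lt h), e⟩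

theorem HasTopCoeff.of_zero {i : ℕ} {g : ℂ → ℂ} (hg : HasTopCoeff (i + 1) 0 g) :
    ∃ c, HasTopCoeff i c g := by
  obtain ⟨q, hq, h0, e⟩ := hg
  refine ⟨_, q, ?_, rfl, e⟩
  refine Polynomial.natDegree_le_iff_coeff_eq_zero.2 fun N hN ↦ ?_
  rcases Nat.lt_iff_add_one_le.1 hN |>.eq_or_lt with rfl | h
  · exact h0
  · exact Polynomial.coeff_eq_zero_of_natDegree_lt (hq.trans_lt h)

end TopCoefficient

/-! ### The degree of a jet polynomial in the highest derivative -/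

section FibreDegree

variable {n k : ℕ}

/-- The monomial `u^β` in the coordinates of `u ∈ ℂⁿ`. -/
def coordMonomial (β : Fin n → ℕ) (u : Cn n) : ℂ := ∏ l, u l ^ β l

/-- The tuple `(u_1, …, u_k, y)`. -/
def snocCoord (u : Fin k → Cn n) (y : Cn n) : Fin (k + 1) → Cn n := Fin.snoc (α := fun _ ↦ Cn n) u y

theorem snocCoord_castSucc (u : Fin k → Cn n) (y : Cn n) (p : Fin k) :
    snocCoord u y p.castSucc = u p := Fin.snoc_castSucc (α := fun _ ↦ Cn n) y u p

theorem snocCoord_last (u : Fin k → Cn n) (y : Cn n) : snocCoord u y (Fin.last k) = y :=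
  Fin.snoc_last (α := fun _ ↦ Cn n) y u

theorem snocCoord_init (v : Fin (k + 1) → Cn n) :
    snocCoord (fun p ↦ v p.castSucc) (v (Fin.last k)) = v :=
  Fin.snoc_init_self (α := fun _ ↦ Cn n) v

theorem snocCoord_add_single (u : Fin k → Cn n) (y y' : Cn n) :
    snocCoord u y + Pi.single (Fin.last k) y' = snocCoord u (y + y') := by
  funext p
  refine Fin.lastCases ?_ (fun q ↦ ?_) p
  · simp [snocCoord_last]
  · have : q.castSucc ≠ Fin.last k := (Fin.castSucc_lt_last q).ne
    simp [snocCoord_castSucc, this]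

/-- The exponents of the derivatives of order less than `k + 1`. -/
def initExp (α : Fin (k + 1) → Fin n → ℕ) : Fin k → Fin n → ℕ := fun p ↦ α p.castSucc

theorem jetMonomial_snocCoord (α : Fin (k + 1) → Fin n → ℕ) (u : Fin k → Cn n) (y : Cn n) :
    jetMonomial α (snocCoord u y) =
      jetMonomial (initExp α) u * coordMonomial (α (Fin.last k)) y := by
  simp only [jetMonomial, Fin.prod_univ_castSucc, snocCoord_castSucc, snocCoord_last, initExp,
    coordMonomial]

theorem jetWeight_eq_initExp (α : Fin (k + 1) → Fin n → ℕ) :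
    jetWeight α = jetWeight (initExp α) + (k + 1) * ∑ l, α (Fin.last k) l := by
  simp only [jetWeight, Fin.sum_univ_castSucc, initExp, Fin.val_castSucc, Fin.val_last]

theorem jetMonomial_scaleCoord (α : Fin k → Fin n → ℕ) (c : ℂ) (v : Fin k → Cn n) :
    jetMonomial α (scaleCoord c v) = c ^ jetWeight α * jetMonomial α v := by
  simp only [jetMonomial, scaleCoord, PiLp.smul_apply, smul_eq_mul, mul_pow,
    Finset.prod_mul_distrib, jetWeight, ← Finset.prod_pow_eq_pow_sum, ← pow_mul, Finset.mul_sum]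

theorem coordMonomial_smul (β : Fin n → ℕ) (c : ℂ) (u : Cn n) :
    coordMonomial β (c • u) = c ^ (∑ l, β l) * coordMonomial β u := by
  simp only [coordMonomial, PiLp.smul_apply, smul_eq_mul, mul_pow, Finset.prod_mul_distrib,
    Finset.prod_pow_eq_pow_sum]

theorem hasTopCoeff_coordMonomial (β : Fin n → ℕ) (u y : Cn n) :
    HasTopCoeff (∑ l, β l) (coordMonomial β y) (fun t ↦ coordMonomial β (u + t • y)) := by
  have h := HasTopCoeff.prod Finset.univ
    (fun l : Fin n ↦ (hasTopCoeff_linear (u l) (y l)).pow (β l))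
  simp only [mul_one] at h
  exact h

theorem mem_jetExponents_succ {m i : ℕ} {α : Fin (k + 1) → Fin n → ℕ} :
    α ∈ jetExponents n (k + 1) m i ↔ jetWeight α = m ∧ ∑ l, α (Fin.last k) l ≤ i := by
  rw [mem_jetExponents]
  refine and_congr_right fun _ ↦ ⟨fun h ↦ h _ rfl, fun h p hp ↦ ?_⟩
  have : p = Fin.last k := Fin.ext (Nat.succ_injective hp)
  rwa [this]

/-- A polynomial with exponents in `jetExponents n (k + 1) m i` has degree at most `i` in the
highest derivative; its top coefficient collects the exponents with `|I_{k + 1}| = i`. -/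
theorem hasTopCoeff_jetPolynomial {m i : ℕ} (b : (Fin (k + 1) → Fin n → ℕ) → ℂ)
    (u : Fin k → Cn n) (y y' : Cn n) :
    HasTopCoeff i (∑ α ∈ jetExponents n (k + 1) m i with ∑ l, α (Fin.last k) l = i,
        b α * jetMonomial α (snocCoord u y'))
      (fun t ↦ ∑ α ∈ jetExponents n (k + 1) m i,
        b α * jetMonomial α (snocCoord u (y + t • y'))) := by
  rw [Finset.sum_filter]
  refine HasTopCoeff.sum _ fun α hα ↦ ?_
  simp only [jetMonomial_snocCoord, ← mul_assoc]
  have h := hasTopCoeff_coordMonomial (α (Fin.last k)) y y'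
  split_ifs with hi
  · rw [hi] at h
    exact h.const_mul _
  · simpa using (h.of_lt (lt_of_le_of_ne (mem_jetExponents_succ.1 hα).2 hi)).const_mul
      (b α * jetMonomial (initExp α) u)

/-- Comparison of coefficients: if a jet polynomial `P` is such that, as a function of the highest
derivative `t y`, it only involves powers `t ^ d` with `S d`, then only the exponents with
`S |I_{k + 1}|` contribute to `P`. -/
theorem sum_eq_sum_filter {E : Finset (Fin (k + 1) → Fin n → ℕ)} (S : ℕ → Prop)
    [DecidablePred S] (b : (Fin (k + 1) → Fin n → ℕ) → ℂ) (u : Fin k → Cn n) (y : Cn n)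
    (q : Polynomial ℂ) (hq : ∀ d, ¬ S d → q.coeff d = 0)
    (h : ∀ t : ℂ, t ≠ 0 → ∑ α ∈ E, b α * jetMonomial α (snocCoord u (t • y)) = q.eval t) :
    ∑ α ∈ E, b α * jetMonomial α (snocCoord u y) =
      ∑ α ∈ E with S (∑ l, α (Fin.last k) l), b α * jetMonomial α (snocCoord u y) := by
  classical
  let r : Finset (Fin (k + 1) → Fin n → ℕ) → Polynomial ℂ := fun E ↦
    ∑ α ∈ E, Polynomial.C (b α * jetMonomial α (snocCoord u y)) *
      Polynomial.X ^ (∑ l, α (Fin.last k) l)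
  have hr : ∀ E t, (r E).eval t = ∑ α ∈ E, b α * jetMonomial α (snocCoord u (t • y)) := fun E t ↦ by
    simp only [r, Polynomial.eval_finsetSum, Polynomial.eval_mul, Polynomial.eval_C,
      Polynomial.eval_pow, Polynomial.eval_X, jetMonomial_snocCoord, coordMonomial_smul]
    exact Finset.sum_congr rfl fun α _ ↦ by ring
  have e1 : r E = q := by
    refine Polynomial.eq_of_infinite_eval_eq _ _
      ((Set.infinite_univ (α := ℂ)).sdiff (Set.finite_singleton 0) |>.mono fun t ht ↦ ?_)
    change (r E).eval t = q.eval t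
    rw [hr]
    exact h t ht.2
  have e2 : r E = r (E.filter fun α ↦ S (∑ l, α (Fin.last k) l)) := by
    ext d
    by_cases hd : S d
    · simp only [r, Polynomial.finsetSum_coeff, Polynomial.coeff_C_mul_X_pow]
      rw [Finset.sum_filter]
      refine Finset.sum_congr rfl fun α _ ↦ ?_
      by_cases hα : d = ∑ l, α (Fin.last k) l
      · rw [if_pos hα, if_pos (hα ▸ hd)]
      · simp [hα]
    · rw [e1, hq d hd]
      simp only [r, Polynomial.finsetSum_coeff, Polynomial.coeff_C_mul_X_pow]
      refine (Finset.sum_eq_zero fun α hα ↦ if_neg ?_).symm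
      rintro rfl
      exact hd (Finset.mem_filter.1 hα).2
  have e3 := congrArg (Polynomial.eval 1) e2
  simpa only [hr, one_smul] using e3

end FibreDegree

/-! ### The filtration in terms of the degree along the fibres of `J^{k+1} X → J^k X` -/

section Filtration

variable {n k m i : ℕ} {X : Type u} [TopologicalSpace X] [ChartedSpace (Cn n) X]
  [IsManifold 𝓘(ℂ, Cn n) ω X] {U : Opens X}

omit [IsManifold 𝓘(ℂ, Cn n) ω X] in
theorem SectionSheaf.ofCharts_pred_iff {A : X → Type u} [∀ x, AddCommGroup (A x)]
    [∀ x, Module ℂ (A x)]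
    {Q : OpenPartialHomeomorph X (Cn n) → (V : Opens X) → (∀ x : V, A x) → Prop}
    {h1 h2 h3 h4} {s : ∀ x : U, A x} :
    (SectionSheaf.ofCharts Q h1 h2 h3 h4).pred (U := U) s ↔
      ∀ z ∈ atlas (Cn n) X, ∀ x ∈ U, x ∈ z.source → ∃ V : Opens X, x ∈ V ∧
        (V : Set X) ⊆ z.source ∧ ∃ hVU : V ≤ U, Q z V (fun y ↦ s ⟨y, hVU y.2⟩) :=
  Iff.rfl

theorem forall_jet_iff {z : OpenPartialHomeomorph X (Cn n)} (hz : z ∈ atlas (Cn n) X) {x : X}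
    (hx : x ∈ z.source) {g : JetFiber n k x → ℂ} {h : (Fin k → Cn n) → ℂ} :
    (∀ f : HolCurve n x, g (jet k f) = h (jetCoord k z f.toFun)) ↔
      ∀ ξ, g ξ = h (coord k z ξ) := by
  constructor
  · intro H ξ
    obtain ⟨f, rfl⟩ := jet_surjective ξ
    rw [H, coord_jet hz hx]
  · intro H f
    rw [H, coord_jet hz hx]

theorem jetFunctions_pred_iff {s : ∀ x : U, JetFiber n k (x : X) → ℂ} :
    (jetFunctions n X k).pred (U := U) s ↔ ∀ z ∈ atlas (Cn n) X, ∀ x ∈ U, x ∈ z.source →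
      ∃ V : Opens X, x ∈ V ∧ (V : Set X) ⊆ z.source ∧ ∃ hVU : V ≤ U,
        ∃ h : Cn n × (Fin k → Cn n) → ℂ, AnalyticOnNhd ℂ h ((z '' V) ×ˢ Set.univ) ∧
          ∀ (y : V) (ξ : JetFiber n k (y : X)), s ⟨y, hVU y.2⟩ ξ = h (z y, coord k z ξ) := by
  unfold jetFunctions
  rw [SectionSheaf.ofCharts_pred_iff]
  refine forall₄_congr fun z hz x hx ↦ forall_congr' fun hxz ↦ exists_congr fun V ↦
    and_congr_right fun _ ↦ and_congr_right fun hVz ↦ exists_congr fun hVU ↦ exists_congr fun h ↦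
    and_congr_right fun _ ↦ forall_congr' fun y ↦ ?_
  exact forall_jet_iff hz (hVz y.2) (h := fun v ↦ h (z y, v))

theorem jetFiltration_pred_iff {s : ∀ x : U, JetFiber n k (x : X) → ℂ} :
    (jetFiltration n X k m i).pred (U := U) s ↔ ∀ z ∈ atlas (Cn n) X, ∀ x ∈ U, x ∈ z.source →
      ∃ V : Opens X, x ∈ V ∧ (V : Set X) ⊆ z.source ∧ ∃ hVU : V ≤ U,
        ∃ a : (Fin k → Fin n → ℕ) → Cn n → ℂ,
          (∀ α ∈ jetExponents n k m i, AnalyticOnNhd ℂ (a α) (z '' V)) ∧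
          ∀ (y : V) (ξ : JetFiber n k (y : X)), s ⟨y, hVU y.2⟩ ξ =
            ∑ α ∈ jetExponents n k m i, a α (z y) * jetMonomial α (coord k z ξ) := by
  unfold jetFiltration
  rw [SectionSheaf.ofCharts_pred_iff]
  refine forall₄_congr fun z hz x hx ↦ forall_congr' fun hxz ↦ exists_congr fun V ↦
    and_congr_right fun _ ↦ and_congr_right fun hVz ↦ exists_congr fun hVU ↦ exists_congr fun a ↦
    and_congr_right fun _ ↦ forall_congr' fun y ↦ ?_
  exact forall_jet_iff hz (hVz y.2)
    (h := fun v ↦ ∑ α ∈ jetExponents n k m i, a α (z y) * jetMonomial α v)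

omit [IsManifold 𝓘(ℂ, Cn n) ω X] in
theorem analyticOnNhd_jetPolynomial {W : Set (Cn n)} {E : Finset (Fin k → Fin n → ℕ)}
    {a : (Fin k → Fin n → ℕ) → Cn n → ℂ} (ha : ∀ α ∈ E, AnalyticOnNhd ℂ (a α) W) :
    AnalyticOnNhd ℂ (fun y : Cn n × (Fin k → Cn n) ↦ ∑ α ∈ E, a α y.1 * jetMonomial α y.2)
      (W ×ˢ Set.univ) := by
  intro y hy
  refine Finset.analyticAt_fun_sum _ fun α hα ↦ ((ha α hα y.1 hy.1).comp analyticAt_fst).mul ?_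
  refine Finset.analyticAt_fun_prod _ fun p _ ↦ Finset.analyticAt_fun_prod _ fun l _ ↦
    AnalyticAt.pow ?_ _
  exact ((EuclideanSpace.proj (𝕜 := ℂ) l).comp ((ContinuousLinearMap.proj (R := ℂ) p).comp
    (ContinuousLinearMap.snd ℂ (Cn n) (Fin k → Cn n)))).analyticAt y

/-- The degree of a family of functions on the fibres of `J^{k+1} X`, along the fibres of
`J^{k+1} X → J^k X`, is at most `i`. -/
def FibreDegreeLE (i : ℕ) (s : ∀ x : U, JetFiber n (k + 1) (x : X) → ℂ) : Prop :=
  ∀ (x : U) (ξ : JetFiber n (k + 1) (x : X)) (v : TangentSpace 𝓘(ℂ, Cn n) (x : X)),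
    ∃ c, HasTopCoeff i c (fun t : ℂ ↦ s x (jetTranslate ξ (t • v)))

theorem jetTranslate_zero {x : X} (ξ : JetFiber n (k + 1) x) : jetTranslate ξ 0 = ξ := by
  have hc := chart_mem_atlas (Cn n) x
  have hxc := mem_chart_source (Cn n) x
  refine (coord_bijective hc hxc).1 ?_
  rw [coord_jetTranslate hc hxc, map_zero, Pi.single_zero, add_zero]

/-- The jet coordinates of the points on a line in a fibre of `J^{k+1} X → J^k X`. -/
theorem coord_jetTranslate_smul {z : OpenPartialHomeomorph X (Cn n)} (hz : z ∈ atlas (Cn n) X)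
    {x : X} (hx : x ∈ z.source) (ξ : JetFiber n (k + 1) x) (v : TangentSpace 𝓘(ℂ, Cn n) x)
    (t : ℂ) :
    coord (k + 1) z (jetTranslate ξ (t • v)) =
      snocCoord (coord k z (jetProj (Nat.le_succ k) x ξ))
        (coord (k + 1) z ξ (Fin.last k) + t • diffl z x v) := by
  rw [coord_jetTranslate hz hx, ← snocCoord_init (coord (k + 1) z ξ), snocCoord_add_single,
    snocCoord_last, coord_jetProj hz hx, map_smul]
  rfl

/-- A weighted homogeneous jet polynomial describing a family of functions on the fibres over a
subset of a chart domain. -/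
theorem exists_jetPolynomial_of_homogeneous {z : OpenPartialHomeomorph X (Cn n)}
    (hz : z ∈ atlas (Cn n) X) {V : Opens X} (hVz : (V : Set X) ⊆ z.source)
    {s : ∀ x : V, JetFiber n k (x : X) → ℂ} {h : Cn n × (Fin k → Cn n) → ℂ}
    (hh : AnalyticOnNhd ℂ h ((z '' V) ×ˢ Set.univ))
    (hs : ∀ (y : V) (ξ : JetFiber n k (y : X)), s y ξ = h (z y, coord k z ξ))
    (hw : ∀ (y : V) (c : ℂˣ) (ξ : JetFiber n k (y : X)),
      s y (jetScale k c ξ) = (c : ℂ) ^ m * s y ξ) :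
    ∃ a : (Fin k → Fin n → ℕ) → Cn n → ℂ, (∀ α, AnalyticOnNhd ℂ (a α) (z '' V)) ∧
      ∀ (y : V) (ξ : JetFiber n k (y : X)), s y ξ =
        ∑ α ∈ jetExponents n k m (m / k), a α (z y) * jetMonomial α (coord k z ξ) := by
  have key : IsJetPolynomial m (z '' V) h := by
    refine isJetPolynomial_of_homogeneous hh ?_
    rintro _ ⟨y, hy, rfl⟩ c hc v
    obtain ⟨ξ, rfl⟩ := (coord_bijective (k := k) hz (hVz hy)).2 v
    have h1 := hw ⟨y, hy⟩ (Units.mk0 c hc) ξ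
    rw [hs, hs, coord_jetScale hz (hVz hy)] at h1
    exact h1
  obtain ⟨a, ha, h1⟩ := key.exists_coeff
  exact ⟨a, ha, fun y ξ ↦ (hs y ξ).trans (h1 _ ⟨y, y.2, rfl⟩ _)⟩

omit [IsManifold 𝓘(ℂ, Cn n) ω X] in
theorem jetExponents_eq_filter :
    jetExponents n (k + 1) m i =
      (jetExponents n (k + 1) m (m / (k + 1))).filter fun α ↦ ∑ l, α (Fin.last k) l ≤ i := by
  ext α
  simp only [Finset.mem_filter, mem_jetExponents_succ]
  constructor
  · rintro ⟨h1, h2⟩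
    refine ⟨⟨h1, ?_⟩, h2⟩
    rw [Nat.le_div_iff_mul_le (Nat.succ_pos k), mul_comm, ← h1, jetWeight_eq_initExp]
    exact Nat.le_add_left _ _
  · rintro ⟨⟨h1, -⟩, h2⟩
    exact ⟨h1, h2⟩

/-- A chart-free description of `ℱ^i`: jet differentials of degree at most `i` along the fibres of
`J^{k+1} X → J^k X`. -/
theorem jetFiltration_pred_iff_fibreDegreeLE {s : ∀ x : U, JetFiber n (k + 1) (x : X) → ℂ} :
    (jetFiltration n X (k + 1) m i).pred (U := U) s ↔
      (jetDifferentials n X (k + 1) m).pred (U := U) s ∧ FibreDegreeLE i s := by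
  constructor
  · intro H
    rw [jetFiltration_pred_iff] at H
    refine ⟨⟨jetFunctions_pred_iff.2 fun z hz x hx hxz ↦ ?_, fun x c ξ ↦ ?_⟩, fun x ξ v ↦ ?_⟩
    · obtain ⟨V, hxV, hVz, hVU, a, ha, h⟩ := H z hz x hx hxz
      exact ⟨V, hxV, hVz, hVU, _, analyticOnNhd_jetPolynomial ha, h⟩
    · have hc := chart_mem_atlas (Cn n) (x : X)
      have hxc := mem_chart_source (Cn n) (x : X)
      obtain ⟨V, hxV, hVz, hVU, a, ha, h⟩ := H _ hc x x.2 hxc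
      rw [h ⟨x, hxV⟩, h ⟨x, hxV⟩, Finset.mul_sum]
      refine Finset.sum_congr rfl fun α hα ↦ ?_
      rw [coord_jetScale hc hxc, jetMonomial_scaleCoord, (mem_jetExponents.1 hα).1]
      ring
    · have hc := chart_mem_atlas (Cn n) (x : X)
      have hxc := mem_chart_source (Cn n) (x : X)
      obtain ⟨V, hxV, hVz, hVU, a, ha, h⟩ := H _ hc x x.2 hxc
      refine ⟨?_, ?_⟩
      swap
      · simp only [h ⟨x, hxV⟩, coord_jetTranslate_smul hc hxc]
        exact hasTopCoeff_jetPolynomial _ _ _ _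
  · rintro ⟨⟨H1, H2⟩, H3⟩
    rw [jetFunctions_pred_iff] at H1
    refine jetFiltration_pred_iff.2 fun z hz x hx hxz ↦ ?_
    obtain ⟨V, hxV, hVz, hVU, h, hh, hs⟩ := H1 z hz x hx hxz
    obtain ⟨a, ha, hs'⟩ := exists_jetPolynomial_of_homogeneous hz hVz
      (s := fun y ↦ s ⟨y, hVU y.2⟩) hh hs (fun y c ξ ↦ H2 ⟨y, hVU y.2⟩ c ξ)
    refine ⟨V, hxV, hVz, hVU, a, fun α _ ↦ ha α, fun y ξ ↦ ?_⟩
    have hy := hVz y.2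
    -- the line through the point with the same coordinates as `ξ`, except for the highest one,
    -- which is `0`
    obtain ⟨η, hη⟩ := (coord_bijective (k := k + 1) hz hy).2
      (snocCoord (fun p ↦ coord (k + 1) z ξ p.castSucc) 0)
    obtain ⟨c, q, hq, -, e⟩ := H3 ⟨y, hVU y.2⟩ η
      ((difflEquiv hz hy).symm (coord (k + 1) z ξ (Fin.last k)))
    have h1 := sum_eq_sum_filter (E := jetExponents n (k + 1) m (m / (k + 1))) (fun d ↦ d ≤ i)
      (fun α ↦ a α (z y)) (fun p ↦ coord (k + 1) z ξ p.castSucc) (coord (k + 1) z ξ (Fin.last k))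
      q (fun d hd ↦ Polynomial.coeff_eq_zero_of_natDegree_lt (hq.trans_lt (not_le.1 hd)))
      (fun t _ ↦ by
        refine Eq.trans ?_ (e t)
        simp only
        rw [hs' y, coord_jetTranslate hz hy, hη, snocCoord_add_single, zero_add, map_smul,
          ← difflEquiv_apply hz hy, ContinuousLinearEquiv.apply_symm_apply])
    rw [snocCoord_init] at h1
    rw [hs' y, h1, ← jetExponents_eq_filter]

theorem jetFiltration_le_succ (i : ℕ) :
    jetFiltration n X (k + 1) m i ≤ jetFiltration n X (k + 1) m (i + 1) := by
  intro U s hs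
  rw [jetFiltration_pred_iff_fibreDegreeLE] at hs ⊢
  refine ⟨hs.1, fun x ξ v ↦ ?_⟩
  obtain ⟨c, hc⟩ := hs.2 x ξ v
  exact ⟨0, hc.of_lt (Nat.lt_succ_self i)⟩

omit [IsManifold 𝓘(ℂ, Cn n) ω X] in
theorem SectionSheaf.ext_pred {A : X → Type u} [∀ x, AddCommGroup (A x)] [∀ x, Module ℂ (A x)]
    {F G : SectionSheaf n A}
    (h : ∀ (U : Opens X) (s : ∀ x : U, A x), F.pred (U := U) s ↔ G.pred (U := U) s) : F = G := by
  obtain ⟨⟨⟨p, _⟩, _⟩, _, _, _⟩ := F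
  obtain ⟨⟨⟨q, _⟩, _⟩, _, _, _⟩ := G
  obtain rfl : @p = @q := by
    funext U s
    exact propext (h U s)
  rfl

/-- `ℱ^{[m/(k+1)]} = 𝒥_{k+1}^m X`. -/
theorem jetFiltration_eq_jetDifferentials :
    jetFiltration n X (k + 1) m (m / (k + 1)) = jetDifferentials n X (k + 1) m := by
  refine SectionSheaf.ext_pred fun U s ↦
    ⟨fun h ↦ (jetFiltration_pred_iff_fibreDegreeLE.1 h).1, fun H ↦
      jetFiltration_pred_iff.2 fun z hz x hx hxz ↦ ?_⟩
  obtain ⟨V, hxV, hVz, hVU, h, hh, hs⟩ := jetFunctions_pred_iff.1 H.1 z hz x hx hxz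
  obtain ⟨a, ha, hs'⟩ := exists_jetPolynomial_of_homogeneous hz hVz
    (s := fun y ↦ s ⟨y, hVU y.2⟩) hh hs (fun y c ξ ↦ H.2 ⟨y, hVU y.2⟩ c ξ)
  exact ⟨V, hxV, hVz, hVU, a, fun α _ ↦ ha α, hs'⟩

omit [IsManifold 𝓘(ℂ, Cn n) ω X] in
theorem jetProj_jetScale {j : ℕ} (h : j ≤ k) {x : X} (c : ℂˣ) (ξ : JetFiber n k x) :
    jetProj h x (jetScale k c ξ) = jetScale j c (jetProj h x ξ) := by
  obtain ⟨f, rfl⟩ := jet_surjective ξ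
  rfl

/-- `ℱ^0` is the image of `𝒥_k^m X`: degree `0` along the fibres means that a function comes from
`J^k X`. -/
theorem jetFiltration_zero_pred_iff {s : ∀ x : U, JetFiber n (k + 1) (x : X) → ℂ} :
    (jetFiltration n X (k + 1) m 0).pred (U := U) s ↔
      ∃! t : ∀ x : U, JetFiber n k (x : X) → ℂ,
        (jetDifferentials n X k m).pred (U := U) t ∧ s = jetPullback (Nat.le_succ k) U t := by
  rw [jetFiltration_pred_iff_fibreDegreeLE]
  constructor
  · rintro ⟨⟨H1, H2⟩, H3⟩
    have e : s = jetPullback (Nat.le_succ k) U fun x ξ ↦ s x (jetLift ξ) := by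
      funext x ξ
      obtain ⟨v, hv⟩ := exists_jetTranslate_eq
        (jetProj_jetLift (jetProj (Nat.le_succ k) (x : X) ξ))
      obtain ⟨c, q, hq, -, h⟩ := H3 x (jetLift (jetProj (Nat.le_succ k) (x : X) ξ)) v
      have h0 := h 0
      have h1 := h 1
      rw [Polynomial.eq_C_of_natDegree_le_zero hq, Polynomial.eval_C] at h0 h1
      simp only [zero_smul, one_smul, hv, jetTranslate_zero] at h0 h1
      exact h1.trans h0.symm
    refine ⟨fun x ξ ↦ s x (jetLift ξ), ⟨⟨?_, fun x c ξ ↦ ?_⟩, e⟩, ?_⟩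
    · rw [jetFunctions_pred_iff] at H1 ⊢
      intro z hz x hx hxz
      obtain ⟨V, hxV, hVz, hVU, h, hh, hs⟩ := H1 z hz x hx hxz
      refine ⟨V, hxV, hVz, hVU, fun y ↦ h (y.1, snocCoord y.2 0), fun y hy ↦ ?_, fun y ξ ↦ ?_⟩
      · refine (hh (y.1, snocCoord y.2 0) ⟨hy.1, trivial⟩).comp_of_eq
          (analyticAt_fst.prod (AnalyticAt.pi fun p ↦ ?_)) rfl
        refine Fin.lastCases ?_ (fun q ↦ ?_) p
        · simp only [snocCoord_last]
          exact analyticAt_const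
        · simp only [snocCoord_castSucc]
          exact ((ContinuousLinearMap.proj (R := ℂ) q).comp
            (ContinuousLinearMap.snd ℂ (Cn n) (Fin k → Cn n))).analyticAt y
      · obtain ⟨η, hη⟩ := (coord_bijective (k := k + 1) hz (hVz y.2)).2
          (snocCoord (coord k z ξ) 0)
        have hp : jetProj (Nat.le_succ k) (y : X) η = ξ := by
          refine (coord_bijective hz (hVz y.2)).1 ?_
          rw [coord_jetProj hz (hVz y.2), hη]
          funext p
          exact snocCoord_castSucc _ _ p
        have h1 := congrFun (congrFun e ⟨y, hVU y.2⟩) η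
        simp only [jetPullback, hp] at h1
        rw [← h1, hs y, hη]
    · have h1 := congrFun (congrFun e x) (jetScale (k + 1) c (jetLift ξ))
      simp only [jetPullback, jetProj_jetScale, jetProj_jetLift] at h1
      exact h1.symm.trans (H2 x c _)
    · rintro t ⟨-, ht⟩
      funext x ξ
      rw [ht]
      simp only [jetPullback, jetProj_jetLift]
  · rintro ⟨t, ⟨⟨H1, H2⟩, rfl⟩, -⟩
    refine ⟨⟨?_, fun x c ξ ↦ ?_⟩, fun x ξ v ↦ ?_⟩
    · rw [jetFunctions_pred_iff] at H1 ⊢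
      intro z hz x hx hxz
      obtain ⟨V, hxV, hVz, hVU, h, hh, hs⟩ := H1 z hz x hx hxz
      refine ⟨V, hxV, hVz, hVU, fun y ↦ h (y.1, fun p ↦ y.2 p.castSucc), fun y hy ↦ ?_,
        fun y ξ ↦ ?_⟩
      · refine (hh (y.1, fun p ↦ y.2 p.castSucc) ⟨hy.1, trivial⟩).comp_of_eq
          (analyticAt_fst.prod (AnalyticAt.pi fun p ↦ ?_)) rfl
        exact ((ContinuousLinearMap.proj (R := ℂ) p.castSucc).comp
            (ContinuousLinearMap.snd ℂ (Cn n) (Fin (k + 1) → Cn n))).analyticAt y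
      · rw [jetPullback, hs y, coord_jetProj hz (hVz y.2)]
        rfl
    · simp only [jetPullback, jetProj_jetScale, H2]
    · refine ⟨?_, ?_⟩
      swap
      · simp only [jetPullback, jetProj_jetTranslate]
        exact hasTopCoeff_const _

end Filtration

/-! ### Independence of the chart -/

section ChartChange

variable {n k : ℕ} {X : Type u} [TopologicalSpace X] [ChartedSpace (Cn n) X]

/-- The intersection of an open subset with a chart domain. -/
def interSource (V : Opens X) (z : OpenPartialHomeomorph X (Cn n)) : Opens X :=
  V ⊓ ⟨z.source, z.open_source⟩

omit [ChartedSpace (Cn n) X] in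
theorem image_interSource_subset {V : Opens X} {z w : OpenPartialHomeomorph X (Cn n)}
    (hVz : (V : Set X) ⊆ z.source) :
    w '' (interSource V w : Set X) ⊆ (w.symm ≫ₕ z).source := by
  rintro _ ⟨y, hy, rfl⟩
  exact mem_transition_source hy.2 (hVz hy.1)

omit [ChartedSpace (Cn n) X] in
theorem transition_mem_image {V : Opens X} {z w : OpenPartialHomeomorph X (Cn n)} {y : Cn n}
    (hy : y ∈ w '' (interSource V w : Set X)) : (z ∘ w.symm) y ∈ z '' V := by
  obtain ⟨y, hy, rfl⟩ := hy
  refine ⟨y, hy.1, ?_⟩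
  simp [w.left_inv hy.2]

variable [IsManifold 𝓘(ℂ, Cn n) ω X] {U : Opens X}

/-- Holomorphy of a family of functions on the fibres of `J^k X` can be checked in one chart around
each point. -/
theorem jetFunctions_pred_of_chart {s : ∀ x : U, JetFiber n k (x : X) → ℂ}
    (H : ∀ x ∈ U, ∃ z ∈ atlas (Cn n) X, ∃ V : Opens X, x ∈ V ∧ (V : Set X) ⊆ z.source ∧
      ∃ hVU : V ≤ U, ∃ h : Cn n × (Fin k → Cn n) → ℂ,
        AnalyticOnNhd ℂ h ((z '' V) ×ˢ Set.univ) ∧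
          ∀ (y : V) (ξ : JetFiber n k (y : X)), s ⟨y, hVU y.2⟩ ξ = h (z y, coord k z ξ)) :
    (jetFunctions n X k).pred (U := U) s := by
  refine jetFunctions_pred_iff.2 fun w hw x hx hxw ↦ ?_
  obtain ⟨z, hz, V, hxV, hVz, hVU, h, hh, hs⟩ := H x hx
  obtain ⟨Ψ, h1, h2, -⟩ := exists_coord_transition' k hw hz
  refine ⟨interSource V w, ⟨hxV, hxw⟩, fun y hy ↦ hy.2, inf_le_left.trans hVU,
    fun y ↦ h ((z ∘ w.symm) y.1, Ψ y), fun y hy ↦ ?_, fun y ξ ↦ ?_⟩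
  · have hy' := image_interSource_subset (z := z) hVz hy.1
    exact (hh ((z ∘ w.symm) y.1, Ψ y) ⟨transition_mem_image hy.1, trivial⟩).comp_of_eq
      (((analyticOnNhd_transition hw hz y.1 hy').comp analyticAt_fst).prod
        (h1 y ⟨hy', trivial⟩)) rfl
  · rw [hs ⟨y, y.2.1⟩, h2 y y.2.2 (hVz y.2.1)]
    simp [w.left_inv y.2.2]

/-- Jet polynomials of one chart with exponents as in `ℱ^i` are sections of `ℱ^i`. -/
theorem jetFiltration_pred_of_chart {m i : ℕ} {s : ∀ x : U, JetFiber n (k + 1) (x : X) → ℂ}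
    {z : OpenPartialHomeomorph X (Cn n)} (hz : z ∈ atlas (Cn n) X) (hU : (U : Set X) ⊆ z.source)
    {a : (Fin (k + 1) → Fin n → ℕ) → Cn n → ℂ}
    (ha : ∀ α ∈ jetExponents n (k + 1) m i, AnalyticOnNhd ℂ (a α) (z '' U))
    (hs : ∀ (y : U) (ξ : JetFiber n (k + 1) (y : X)), s y ξ =
      ∑ α ∈ jetExponents n (k + 1) m i, a α (z y) * jetMonomial α (coord (k + 1) z ξ)) :
    (jetFiltration n X (k + 1) m i).pred (U := U) s := by
  refine jetFiltration_pred_iff_fibreDegreeLE.2 ⟨⟨jetFunctions_pred_of_chart fun x hx ↦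
    ⟨z, hz, U, hx, hU, le_rfl, _, analyticOnNhd_jetPolynomial ha, hs⟩, fun x c ξ ↦ ?_⟩,
    fun x ξ v ↦ ?_⟩
  · rw [hs, hs, Finset.mul_sum]
    refine Finset.sum_congr rfl fun α hα ↦ ?_
    rw [coord_jetScale hz (hU x.2), jetMonomial_scaleCoord, (mem_jetExponents.1 hα).1]
    ring
  · refine ⟨?_, ?_⟩
    swap
    · simp only [hs, coord_jetTranslate_smul hz (hU x.2)]
      exact hasTopCoeff_jetPolynomial _ _ _ _

end ChartChange

/-! ### The sheaf of symbols -/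

section Symbols

variable {n k : ℕ} {X : Type u} [TopologicalSpace X] [ChartedSpace (Cn n) X]
  [IsManifold 𝓘(ℂ, Cn n) ω X]

variable (n X) in
/-- The sheaf of holomorphic functions on the fibre product of `J^k X` and the tangent bundle. -/
def symbolFunctions (k : ℕ) :
    SectionSheaf n (fun x : X ↦ JetFiber n k x → TangentSpace 𝓘(ℂ, Cn n) x → ℂ) :=
  SectionSheaf.ofCharts
    (fun z V s ↦ ∃ h : Cn n × (Fin (k + 1) → Cn n) → ℂ,
      AnalyticOnNhd ℂ h ((z '' V) ×ˢ Set.univ) ∧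
        ∀ (x : V) (ξ : JetFiber n k (x : X)) (v : TangentSpace 𝓘(ℂ, Cn n) (x : X)),
          s x ξ v = h (z x, snocCoord (coord k z ξ) (diffl z x v)))
    (by
      rintro z V W h s ⟨a, ha, hs⟩
      exact ⟨a, ha.mono (Set.prod_mono (Set.image_mono h) subset_rfl), fun x ↦ hs ⟨x, h x.2⟩⟩)
    (fun z V ↦ ⟨0, analyticOnNhd_const, fun x ξ v ↦ rfl⟩)
    (by
      rintro z V s t ⟨a, ha, hs⟩ ⟨b, hb, ht⟩
      refine ⟨a + b, ha.add hb, fun x ξ v ↦ ?_⟩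
      change s x ξ v + t x ξ v = _
      rw [hs, ht]
      rfl)
    (by
      rintro z hz V hV g s ⟨a, ha, hs⟩
      obtain ⟨b, hb, hg⟩ := Holo.exists_analytic z hz V hV g
      refine ⟨fun w ↦ b w.1 • a w, fun w hw ↦ ?_, fun x ξ v ↦ ?_⟩
      · exact ((hb w.1 hw.1).comp (f := Prod.fst) (g := b) analyticAt_fst).smul (ha w hw)
      · change g x • s x ξ v = _
        rw [hs, hg])

theorem symbolFunctions_pred_iff {U : Opens X}
    {s : ∀ x : U, JetFiber n k (x : X) → TangentSpace 𝓘(ℂ, Cn n) (x : X) → ℂ} :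
    (symbolFunctions n X k).pred (U := U) s ↔ ∀ z ∈ atlas (Cn n) X, ∀ x ∈ U, x ∈ z.source →
      ∃ V : Opens X, x ∈ V ∧ (V : Set X) ⊆ z.source ∧ ∃ hVU : V ≤ U,
        ∃ h : Cn n × (Fin (k + 1) → Cn n) → ℂ, AnalyticOnNhd ℂ h ((z '' V) ×ˢ Set.univ) ∧
          ∀ (y : V) (ξ : JetFiber n k (y : X)) (v : TangentSpace 𝓘(ℂ, Cn n) (y : X)),
            s ⟨y, hVU y.2⟩ ξ v = h (z y, snocCoord (coord k z ξ) (diffl z y v)) :=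
  Iff.rfl

variable (n X) in
/-- The sheaf of symbols: holomorphic functions `σ(ξ, v)` of a jet `ξ ∈ J^k X` and a tangent vector
`v` at the same point which are homogeneous of weight `d` in `ξ` and of degree `i` in `v`. -/
def symbolSheaf (k d i : ℕ) :
    SectionSheaf n (fun x : X ↦ JetFiber n k x → TangentSpace 𝓘(ℂ, Cn n) x → ℂ) where
  pred {U} s := (symbolFunctions n X k).pred (U := U) s ∧
    ∀ (x : U) (c : ℂˣ) (ξ : JetFiber n k (x : X)) (v : TangentSpace 𝓘(ℂ, Cn n) (x : X)),
      s x (jetScale k c ξ) v = (c : ℂ) ^ d * s x ξ v ∧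
        s x ξ ((c : ℂ) • v) = (c : ℂ) ^ i * s x ξ v
  res i s h := ⟨(symbolFunctions n X k).res i s h.1, fun x ↦ h.2 ⟨x.1, i.le x.2⟩⟩
  locality s h := ⟨(symbolFunctions n X k).locality s fun x ↦ by
      obtain ⟨V, hxV, i, h⟩ := h x
      exact ⟨V, hxV, i, h.1⟩, fun x ↦ by
      obtain ⟨V, hxV, i, h⟩ := h x
      exact h.2 ⟨x.1, hxV⟩⟩
  zero_mem U := ⟨(symbolFunctions n X k).zero_mem U, fun x c ξ v ↦ by simp⟩
  add_mem U s t hs ht := ⟨(symbolFunctions n X k).add_mem U s t hs.1 ht.1, fun x c ξ v ↦ by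
    simp only [Pi.add_apply, (hs.2 x c ξ v).1, (ht.2 x c ξ v).1, (hs.2 x c ξ v).2,
      (ht.2 x c ξ v).2, mul_add, and_self]⟩
  smul_mem U g s hs := ⟨(symbolFunctions n X k).smul_mem U g s hs.1, fun x c ξ v ↦ by
    simp only [Pi.smul_apply, (hs.2 x c ξ v).1, (hs.2 x c ξ v).2, smul_eq_mul, mul_left_comm,
      and_self]⟩

variable {U : Opens X} {m i : ℕ}

/-- The symbol of degree `i`: the coefficient of `t ^ i` in the restriction of a function to the
line `t ↦ ξ + t v` in a fibre of `J^{k+1} X → J^k X`. -/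
def symbol (i : ℕ) (s : ∀ x : U, JetFiber n (k + 1) (x : X) → ℂ) :
    ∀ x : U, JetFiber n k (x : X) → TangentSpace 𝓘(ℂ, Cn n) (x : X) → ℂ :=
  fun x ξ v ↦ topCoeff i fun t ↦ s x (jetTranslate (jetLift ξ) (t • v))

theorem symbol_add (s t : ∀ x : U, JetFiber n (k + 1) (x : X) → ℂ) :
    symbol i (fun x ↦ s x + t x) = fun x ↦ symbol i s x + symbol i t x := by
  funext x ξ v
  exact topCoeff_add i _ _

theorem symbol_smul (g : U → ℂ) (s : ∀ x : U, JetFiber n (k + 1) (x : X) → ℂ) :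
    symbol i (fun x ↦ g x • s x) = fun x ↦ g x • symbol i s x := by
  funext x ξ v
  exact topCoeff_const_mul i _ _

/-- The top coefficient along a line in a fibre of `J^{k+1} X → J^k X`, in coordinates. -/
theorem hasTopCoeff_of_chart {z : OpenPartialHomeomorph X (Cn n)} (hz : z ∈ atlas (Cn n) X)
    {x : X} (hx : x ∈ z.source) {g : JetFiber n (k + 1) x → ℂ}
    {b : (Fin (k + 1) → Fin n → ℕ) → ℂ}
    (hg : ∀ ξ, g ξ = ∑ α ∈ jetExponents n (k + 1) m i, b α * jetMonomial α (coord (k + 1) z ξ))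
    (ξ : JetFiber n (k + 1) x) (v : TangentSpace 𝓘(ℂ, Cn n) x) :
    HasTopCoeff i (∑ α ∈ jetExponents n (k + 1) m i with ∑ l, α (Fin.last k) l = i,
        b α * jetMonomial α
          (snocCoord (coord k z (jetProj (Nat.le_succ k) x ξ)) (diffl z x v)))
      (fun t : ℂ ↦ g (jetTranslate ξ (t • v))) := by
  simp only [hg, coord_jetTranslate_smul hz hx]
  exact hasTopCoeff_jetPolynomial _ _ _ _

/-- The symbol in coordinates. -/
theorem symbol_of_chart {z : OpenPartialHomeomorph X (Cn n)} (hz : z ∈ atlas (Cn n) X)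
    {s : ∀ x : U, JetFiber n (k + 1) (x : X) → ℂ} {x : U} (hx : (x : X) ∈ z.source)
    {b : (Fin (k + 1) → Fin n → ℕ) → ℂ}
    (hs : ∀ ξ, s x ξ = ∑ α ∈ jetExponents n (k + 1) m i, b α * jetMonomial α (coord (k + 1) z ξ))
    (ξ : JetFiber n k (x : X)) (v : TangentSpace 𝓘(ℂ, Cn n) (x : X)) :
    symbol i s x ξ v = ∑ α ∈ jetExponents n (k + 1) m i with ∑ l, α (Fin.last k) l = i,
        b α * jetMonomial α (snocCoord (coord k z ξ) (diffl z x v)) := by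
  have h := (hasTopCoeff_of_chart hz hx hs (jetLift ξ) v).topCoeff_eq
  rw [jetProj_jetLift] at h
  exact h

theorem jetWeight_initExp_of_mem {α : Fin (k + 1) → Fin n → ℕ}
    (hα : α ∈ (jetExponents n (k + 1) m i).filter fun α ↦ ∑ l, α (Fin.last k) l = i) :
    jetWeight (initExp α) = m - (k + 1) * i ∧ ∑ l, α (Fin.last k) l = i := by
  obtain ⟨h1, h2⟩ := Finset.mem_filter.1 hα
  have h3 := (mem_jetExponents_succ.1 h1).1
  rw [jetWeight_eq_initExp, h2] at h3
  exact ⟨by omega, h2⟩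

/-- The symbol of a section of `ℱ^i` is holomorphic and homogeneous. -/
theorem symbol_mem {s : ∀ x : U, JetFiber n (k + 1) (x : X) → ℂ}
    (hs : (jetFiltration n X (k + 1) m i).pred (U := U) s) :
    (symbolSheaf n X k (m - (k + 1) * i) i).pred (U := U) (symbol i s) := by
  rw [jetFiltration_pred_iff] at hs
  refine ⟨?_, fun x c ξ v ↦ ?_⟩
  · refine symbolFunctions_pred_iff.2 fun z hz x hx hxz ↦ ?_
    obtain ⟨V, hxV, hVz, hVU, a, ha, h⟩ := hs z hz x hx hxz
    refine ⟨V, hxV, hVz, hVU, fun y ↦ ∑ α ∈ jetExponents n (k + 1) m i with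
      ∑ l, α (Fin.last k) l = i, a α y.1 * jetMonomial α y.2, analyticOnNhd_jetPolynomial fun α hα ↦
      ha α (Finset.mem_filter.1 hα).1, fun y ξ v ↦ ?_⟩
    exact symbol_of_chart hz (x := ⟨y, hVU y.2⟩) (hVz y.2) (h y) ξ v
  · have hc := chart_mem_atlas (Cn n) (x : X)
    have hxc := mem_chart_source (Cn n) (x : X)
    obtain ⟨V, hxV, hVz, hVU, a, ha, h⟩ := hs _ hc x x.2 hxc
    simp only [symbol_of_chart hc hxc (h ⟨x, hxV⟩), Finset.mul_sum, jetMonomial_snocCoord,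
      coord_jetScale hc hxc, jetMonomial_scaleCoord, map_smul, coordMonomial_smul]
    constructor
    · refine Finset.sum_congr rfl fun α hα ↦ ?_
      rw [(jetWeight_initExp_of_mem hα).1]
      ring
    · refine Finset.sum_congr rfl fun α hα ↦ ?_
      rw [(jetWeight_initExp_of_mem hα).2]
      ring

/-- The kernel of the symbol of degree `i + 1` is `ℱ^i`. -/
theorem jetFiltration_pred_of_symbol_eq_zero {s : ∀ x : U, JetFiber n (k + 1) (x : X) → ℂ}
    (hs : (jetFiltration n X (k + 1) m (i + 1)).pred (U := U) s) (h0 : symbol (i + 1) s = 0) :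
    (jetFiltration n X (k + 1) m i).pred (U := U) s := by
  refine jetFiltration_pred_iff_fibreDegreeLE.2
    ⟨(jetFiltration_pred_iff_fibreDegreeLE.1 hs).1, fun x ξ v ↦ ?_⟩
  have hc := chart_mem_atlas (Cn n) (x : X)
  have hxc := mem_chart_source (Cn n) (x : X)
  obtain ⟨V, hxV, hVz, hVU, a, ha, h⟩ := jetFiltration_pred_iff.1 hs _ hc x x.2 hxc
  refine HasTopCoeff.of_zero ?_
  have h1 := symbol_of_chart hc hxc (h ⟨x, hxV⟩) (jetProj (Nat.le_succ k) (x : X) ξ) v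
  have h2 := hasTopCoeff_of_chart hc hxc (h ⟨x, hxV⟩) ξ v
  rw [← h1, h0] at h2
  exact h2

theorem symbol_eq_zero {s : ∀ x : U, JetFiber n (k + 1) (x : X) → ℂ}
    (hs : (jetFiltration n X (k + 1) m i).pred (U := U) s) : symbol (i + 1) s = 0 := by
  funext x ξ v
  obtain ⟨c, hc⟩ := (jetFiltration_pred_iff_fibreDegreeLE.1 hs).2 x (jetLift ξ) v
  exact (hc.of_lt (Nat.lt_succ_self i)).topCoeff_eq

/-- Sections of the sheaf of symbols are polynomials in coordinates. -/
theorem exists_symbolPolynomial (hm : (k + 1) * i ≤ m)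
    {s : ∀ x : U, JetFiber n k (x : X) → TangentSpace 𝓘(ℂ, Cn n) (x : X) → ℂ}
    (hs : (symbolSheaf n X k (m - (k + 1) * i) i).pred (U := U) s)
    {z : OpenPartialHomeomorph X (Cn n)} (hz : z ∈ atlas (Cn n) X) {x : X} (hx : x ∈ U)
    (hxz : x ∈ z.source) :
    ∃ V : Opens X, x ∈ V ∧ (V : Set X) ⊆ z.source ∧ ∃ hVU : V ≤ U,
      ∃ a : (Fin (k + 1) → Fin n → ℕ) → Cn n → ℂ, (∀ α, AnalyticOnNhd ℂ (a α) (z '' V)) ∧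
        ∀ (y : V) (ξ : JetFiber n k (y : X)) (v : TangentSpace 𝓘(ℂ, Cn n) (y : X)),
          s ⟨y, hVU y.2⟩ ξ v =
            ∑ α ∈ jetExponents n (k + 1) m i with ∑ l, α (Fin.last k) l = i,
              a α (z y) * jetMonomial α (snocCoord (coord k z ξ) (diffl z y v)) := by
  obtain ⟨V, hxV, hVz, hVU, h, hh, e⟩ := symbolFunctions_pred_iff.1 hs.1 z hz x hx hxz
  have e' : ∀ (y : V) (ξ : JetFiber n k (y : X)) (v : Cn n),
      s ⟨y, hVU y.2⟩ ξ ((difflEquiv hz (hVz y.2)).symm v) =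
        h (z y, snocCoord (coord k z ξ) v) := fun y ξ v ↦ by
    rw [e y, ← difflEquiv_apply hz (hVz y.2), ContinuousLinearEquiv.apply_symm_apply]
  -- taken together, `ξ` and `v` have weight `m`, if `v` is treated as a derivative of order `k + 1`
  have key : IsJetPolynomial m (z '' V) h := by
    refine isJetPolynomial_of_homogeneous hh ?_
    rintro _ ⟨y, hy, rfl⟩ c hc v
    obtain ⟨ξ, hξ⟩ := (coord_bijective (k := k) hz (hVz hy)).2 fun p ↦ v p.castSucc
    have h1 := (hs.2 ⟨y, hVU hy⟩ (Units.mk0 c hc) ξ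
      ((difflEquiv hz (hVz hy)).symm (c ^ (k + 1) • v (Fin.last k)))).1
    have h2 := (hs.2 ⟨y, hVU hy⟩ (Units.mk0 c hc ^ (k + 1)) ξ
      ((difflEquiv hz (hVz hy)).symm (v (Fin.last k)))).2
    rw [Units.val_pow_eq_pow_val, Units.val_mk0, ← map_smul] at h2
    rw [h2, e' ⟨y, hy⟩, e' ⟨y, hy⟩, coord_jetScale hz (hVz hy), hξ, snocCoord_init,
      Units.val_mk0, ← mul_assoc, ← pow_mul, ← pow_add, Nat.sub_add_cancel hm] at h1
    rw [← h1]
    congr 2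
    funext p
    refine Fin.lastCases ?_ (fun q ↦ ?_) p
    · rw [snocCoord_last]
      rfl
    · rw [snocCoord_castSucc]
      rfl
  obtain ⟨a, ha, h1⟩ := key.exists_coeff
  refine ⟨V, hxV, hVz, hVU, a, ha, fun y ξ v ↦ ?_⟩
  rw [e y, h1 _ ⟨y, y.2, rfl⟩]
  have h2 := sum_eq_sum_filter (E := jetExponents n (k + 1) m (m / (k + 1))) (fun d ↦ d = i)
    (fun α ↦ a α (z y)) (coord k z ξ) (diffl z y v)
    (Polynomial.C (s ⟨y, hVU y.2⟩ ξ v) * Polynomial.X ^ i)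
    (fun d hd ↦ by rw [Polynomial.coeff_C_mul_X_pow, if_neg hd])
    (fun t ht ↦ by
      have h3 := (hs.2 ⟨y, hVU y.2⟩ (Units.mk0 t ht) ξ v).2
      rw [Units.val_mk0, e y, map_smul, h1 _ ⟨y, y.2, rfl⟩] at h3
      simp only [Polynomial.eval_mul, Polynomial.eval_C, Polynomial.eval_pow, Polynomial.eval_X]
      rw [mul_comm, ← h3])
  rw [h2]
  congr 1
  rw [jetExponents_eq_filter (i := i), Finset.filter_filter]
  exact Finset.filter_congr fun α _ ↦ ⟨fun h ↦ ⟨h.le, h⟩, fun h ↦ h.2⟩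

/-- Locally, every symbol is the symbol of a section of `ℱ^i`. -/
theorem exists_symbol_eq (hm : (k + 1) * i ≤ m)
    {t : ∀ x : U, JetFiber n k (x : X) → TangentSpace 𝓘(ℂ, Cn n) (x : X) → ℂ}
    (ht : (symbolSheaf n X k (m - (k + 1) * i) i).pred (U := U) t) {x : X} (hx : x ∈ U) :
    ∃ V : Opens X, x ∈ V ∧ ∃ hVU : V ≤ U, ∃ s : ∀ x : V, JetFiber n (k + 1) (x : X) → ℂ,
      (jetFiltration n X (k + 1) m i).pred (U := V) s ∧
        symbol i s = fun y : V ↦ t ⟨y, hVU y.2⟩ := by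
  have hc := chart_mem_atlas (Cn n) x
  have hxc := mem_chart_source (Cn n) x
  obtain ⟨V, hxV, hVz, hVU, a, ha, h⟩ := exists_symbolPolynomial hm ht hc hx hxc
  let b : (Fin (k + 1) → Fin n → ℕ) → Cn n → ℂ := fun α ↦
    if ∑ l, α (Fin.last k) l = i then a α else 0
  refine ⟨V, hxV, hVU, fun y ξ ↦ ∑ α ∈ jetExponents n (k + 1) m i,
    b α (chartAt (Cn n) x y) * jetMonomial α (coord (k + 1) (chartAt (Cn n) x) ξ),
    jetFiltration_pred_of_chart hc hVz (a := b) (fun α _ ↦ ?_) (fun y ξ ↦ rfl), ?_⟩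
  · by_cases hα : ∑ l, α (Fin.last k) l = i
    · simp only [b, if_pos hα]
      exact ha α
    · simp only [b, if_neg hα]
      exact analyticOnNhd_const
  · funext y ξ v
    rw [h y, symbol_of_chart hc (hVz y.2) (fun ξ ↦ rfl)]
    refine Finset.sum_congr rfl fun α hα ↦ ?_
    simp only [b, if_pos (Finset.mem_filter.1 hα).2]

end Symbols

/-! ### The quotient by the kernel of the symbol -/

section Quotient

variable {n : ℕ} {X : Type u} [TopologicalSpace X] [ChartedSpace (Cn n) X]
variable {A : X → Type u} [∀ x, AddCommGroup (A x)] [∀ x, Module ℂ (A x)]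

/-- A morphism of sheaves of modules which is locally surjective on sections is an epimorphism. -/
theorem epi_of_isLocallySurjective {M N : SheafOfModules.{u} (structureSheaf n X)} (φ : M ⟶ N)
    (h : ∀ (U : Opens X) (t : N.val.obj (op U)), ∀ x ∈ U, ∃ (V : Opens X) (j : V ⟶ U), x ∈ V ∧
      ∃ s : M.val.obj (op V), φ.val.app (op V) s = N.val.map j.op t) : Epi φ where
  left_cancellation {P} g g' e := by
    ext U t
    have hS : Presheaf.imageSieve ((PresheafOfModules.toPresheaf _).map φ.val) t ∈
        Opens.grothendieckTopology (TopCat.of X) U.unop := fun x hx ↦ by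
      obtain ⟨V, j, hxV, s, hs⟩ := h U.unop t x hx
      exact ⟨V, j, ⟨s, hs⟩, hxV⟩
    have key := P.isSheaf.isSeparated (X := U.unop) _ hS
    refine key (g.val.app U t : P.val.obj U) (g'.val.app U t : P.val.obj U) ?_
    rintro V j ⟨s, hs⟩
    have hs' : φ.val.app (op V) s = N.val.map j.op t := hs
    have e1 : g.val.app (op V) (φ.val.app (op V) s) = g'.val.app (op V) (φ.val.app (op V) s) :=
      congrArg (fun f : M ⟶ P ↦ f.val.app (op V) s) e
    rw [hs'] at e1
    have e2 := PresheafOfModules.naturality_apply g.val j.op t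
    have e3 := PresheafOfModules.naturality_apply g'.val j.op t
    exact e2.symm.trans (e1.trans e3)

theorem incl_comp_eq_zero {F G : SectionSheaf n A} (hFG : F ≤ G)
    {N : SheafOfModules.{u} (structureSheaf n X)} (σ : G.toSheafOfModules ⟶ N)
    (h0 : ∀ (U : Opens X) (s : F.sections U),
      σ.val.app (op U) (⟨s.1, hFG U s.1 s.2⟩ : G.sections U) = 0) :
    SectionSheaf.incl hFG ≫ σ = 0 := by
  ext U s
  exact h0 U.unop s

/-- If `F` consists of the sections which are annihilated by an epimorphism `σ` on `G`, then `σ`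
induces an isomorphism from the quotient `G / F`. -/
theorem nonempty_quotient_iso {F G : SectionSheaf n A} (hFG : F ≤ G)
    {N : SheafOfModules.{u} (structureSheaf n X)} (σ : G.toSheafOfModules ⟶ N) [Epi σ]
    (h0 : ∀ (U : Opens X) (s : F.sections U),
      σ.val.app (op U) (⟨s.1, hFG U s.1 s.2⟩ : G.sections U) = 0)
    (h1 : ∀ (U : Opens X) (s : G.sections U), σ.val.app (op U) s = 0 → F.pred (U := U) s.1) :
    Nonempty (SectionSheaf.quotient hFG ≅ N) := by
  have w := incl_comp_eq_zero hFG σ h0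
  have hk : Limits.IsLimit (Limits.KernelFork.ofι (SectionSheaf.incl hFG) w) := by
    refine Limits.KernelFork.IsLimit.ofι _ _
      (fun {W} g hg ↦
        { val :=
            { app := fun U ↦ ModuleCat.ofHom
                { toFun := fun s ↦ (⟨(g.val.app U s : G.sections U.unop).1,
                    h1 U.unop (g.val.app U s)
                      (congrArg (fun f : W ⟶ N ↦ f.val.app U s) hg)⟩ : F.sections U.unop)
                  map_add' := fun s t ↦ Subtype.ext
                    (congrArg (fun r : G.sections U.unop ↦ r.1) ((g.val.app U).hom.map_add s t))
                  map_smul' := fun c s ↦ Subtype.ext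
                    (congrArg (fun r : G.sections U.unop ↦ r.1) ((g.val.app U).hom.map_smul c s)) }
              naturality := fun {U V} j ↦ by
                ext s
                exact Subtype.ext
                  (congrArg (fun r : G.sections V.unop ↦ r.1)
                    (PresheafOfModules.naturality_apply g.val j s)) } })
      (fun g hg ↦ ?_) (fun g hg m hm ↦ ?_)
    · ext U s
      rfl
    · ext U s
      exact Subtype.ext (congrArg (fun r : G.sections U.unop ↦ r.1)
        (congrArg (fun f : _ ⟶ G.toSheafOfModules ↦ f.val.app U s) hm))
  exact ⟨(Limits.cokernelIsCokernel (SectionSheaf.incl hFG)).coconePointUniqueUpToIso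
    (Abelian.epiIsCokernelOfKernel _ hk)⟩

variable [IsManifold 𝓘(ℂ, Cn n) ω X]

variable (n X) in
/-- The symbol as a morphism from `ℱ^i` to the sheaf of symbols. -/
def symbolHom (k m i : ℕ) : (jetFiltration n X (k + 1) m i).toSheafOfModules ⟶
    (symbolSheaf n X k (m - (k + 1) * i) i).toSheafOfModules where
  val :=
    { app := fun U ↦ ModuleCat.ofHom
        { toFun := fun s ↦ (⟨symbol i s.1, symbol_mem s.2⟩ :
            (symbolSheaf n X k (m - (k + 1) * i) i).sections U.unop)
          map_add' := fun s t ↦ Subtype.ext (symbol_add s.1 t.1)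
          map_smul' := fun g s ↦ Subtype.ext (symbol_smul (show Holo n U.unop from g) s.1) }
      naturality := fun _ ↦ rfl }

theorem epi_symbolHom {k m i : ℕ} (hm : (k + 1) * i ≤ m) : Epi (symbolHom n X k m i) := by
  refine epi_of_isLocallySurjective _ fun U t x hx ↦ ?_
  obtain ⟨V, hxV, hVU, s, hs, e⟩ := exists_symbol_eq (U := U) hm
    (show (symbolSheaf n X k (m - (k + 1) * i) i).sections U from t).2 hx
  exact ⟨V, homOfLE hVU, hxV, (⟨s, hs⟩ : (jetFiltration n X (k + 1) m i).sections V),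
    Subtype.ext (p := (symbolSheaf n X k (m - (k + 1) * i) i).pred (U := V)) e⟩

/-- `ℱ^{i+1} / ℱ^i` is the sheaf of symbols. -/
theorem nonempty_quotient_iso_symbolSheaf {k m i : ℕ} (hm : (k + 1) * (i + 1) ≤ m)
    (h : jetFiltration n X (k + 1) m i ≤ jetFiltration n X (k + 1) m (i + 1)) :
    Nonempty (SectionSheaf.quotient h ≅
      (symbolSheaf n X k (m - (k + 1) * (i + 1)) (i + 1)).toSheafOfModules) := by
  have := epi_symbolHom (n := n) (X := X) hm
  exact nonempty_quotient_iso h (symbolHom n X k m (i + 1))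
    (fun U s ↦ Subtype.ext (p := (symbolSheaf n X k (m - (k + 1) * (i + 1)) (i + 1)).pred (U := U))
      (symbol_eq_zero s.2))
    (fun U s hs ↦ jetFiltration_pred_of_symbol_eq_zero s.2
      (congrArg (fun r : (symbolSheaf n X k (m - (k + 1) * (i + 1)) (i + 1)).sections U ↦ r.1) hs))

end Quotient

/-! ### Cotangent sections in a chart -/

section Cotangent

variable {n k : ℕ} {X : Type u} [TopologicalSpace X] [ChartedSpace (Cn n) X]
  [IsManifold 𝓘(ℂ, Cn n) ω X] {U V : Opens X}

theorem cotangentSheaf_pred_iff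
    {s : ∀ x : U, ULift.{u} (TangentSpace 𝓘(ℂ, Cn n) (x : X) →L[ℂ] ℂ)} :
    (cotangentSheaf n X).pred (U := U) s ↔ ∀ z ∈ atlas (Cn n) X, ∀ x ∈ U, x ∈ z.source →
      ∃ V : Opens X, x ∈ V ∧ (V : Set X) ⊆ z.source ∧ ∃ hVU : V ≤ U,
        ∃ a : Cn n → (Cn n →L[ℂ] ℂ), AnalyticOnNhd ℂ a (z '' V) ∧
          ∀ (y : V), (s ⟨y, hVU y.2⟩).down = (a (z y)).comp (diffl z (y : X)) :=
  Iff.rfl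

/-- The holomorphic function on a subset of a chart domain with a given coordinate expression. -/
def holoOfChart {z : OpenPartialHomeomorph X (Cn n)} (hz : z ∈ atlas (Cn n) X)
    (hV : (V : Set X) ⊆ z.source) {a : Cn n → ℂ} (ha : AnalyticOnNhd ℂ a (z '' V)) : Holo n V :=
  ⟨fun x ↦ a (z x), fun x ↦ by
    have h1 : ContMDiffAt 𝓘(ℂ, Cn n) 𝓘(ℂ, Cn n) ω z (x : X) :=
      contMDiffAt_of_mem_maximalAtlas (IsManifold.subset_maximalAtlas hz) (hV x.2)
    have h2 : ContMDiffAt 𝓘(ℂ, Cn n) 𝓘(ℂ) ω a (z x) :=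
      (ha _ ⟨x, x.2, rfl⟩).contDiffAt.contMDiffAt
    exact contMDiffAt_subtype_iff (f := a ∘ z).2 (h2.comp (x : X) h1)⟩

/-- The section `dz_l` of the cotangent sheaf on a subset of the domain of the chart `z`. -/
def dCoord {z : OpenPartialHomeomorph X (Cn n)} (hz : z ∈ atlas (Cn n) X)
    (hV : (V : Set X) ⊆ z.source) (l : Fin n) : (cotangentSheaf n X).sections V :=
  ⟨fun x ↦ ⟨(EuclideanSpace.proj l : Cn n →L[ℂ] ℂ).comp (diffl z (x : X))⟩, by
    refine cotangentSheaf_pred_iff.2 fun w hw x hx hxw ↦ ?_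
    refine ⟨interSource V w, ⟨hx, hxw⟩, fun y hy ↦ hy.2, inf_le_left,
      fun y ↦ (EuclideanSpace.proj l : Cn n →L[ℂ] ℂ).comp (fderiv ℂ (z ∘ w.symm) y),
      fun y hy ↦ ?_, fun y ↦ ?_⟩
    · have h1 := (analyticOnNhd_transition hw hz).fderiv y
        (image_interSource_subset (z := z) hV hy)
      exact ((ContinuousLinearMap.compL ℂ (Cn n) (Cn n) ℂ (EuclideanSpace.proj l)).analyticAt
        _).comp h1
    · ext v
      exact congrArg (fun u : Cn n ↦ u l) (diffl_transition hw hz y.2.2 (hV y.2.1) v)⟩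

theorem dCoord_apply {z : OpenPartialHomeomorph X (Cn n)} (hz : z ∈ atlas (Cn n) X)
    (hV : (V : Set X) ⊆ z.source) (l : Fin n) (x : V) (v : TangentSpace 𝓘(ℂ, Cn n) (x : X)) :
    ((dCoord hz hV l).1 x).down v = diffl z x v l := rfl

/-- The coefficients of a section of the cotangent sheaf with respect to a chart. -/
theorem exists_cotangent_coeff (θ : (cotangentSheaf n X).sections U)
    {z : OpenPartialHomeomorph X (Cn n)} (hz : z ∈ atlas (Cn n) X) :
    ∃ a : Fin n → Cn n → ℂ, (∀ l, AnalyticOnNhd ℂ (a l) (z '' (interSource U z : Set X))) ∧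
      ∀ (x : U), (x : X) ∈ z.source → ∀ v : TangentSpace 𝓘(ℂ, Cn n) (x : X),
        (θ.1 x).down v = ∑ l, a l (z x) * diffl z x v l := by
  classical
  let a : Fin n → Cn n → ℂ := fun l w ↦
    if h : z.symm w ∈ U ∧ z.symm w ∈ z.source then
      (θ.1 ⟨z.symm w, h.1⟩).down ((difflEquiv hz h.2).symm (EuclideanSpace.single l 1)) else 0
  have ha : ∀ (l : Fin n) (x : X) (hxU : x ∈ U) (hxz : x ∈ z.source),
      a l (z x) = (θ.1 ⟨x, hxU⟩).down ((difflEquiv hz hxz).symm (EuclideanSpace.single l 1)) := by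
    intro l x hxU hxz
    have e : z.symm (z x) = x := z.left_inv hxz
    have key : ∀ (y : X) (hyx : y = x) (h : y ∈ U ∧ y ∈ z.source),
        (θ.1 ⟨y, h.1⟩).down ((difflEquiv hz h.2).symm (EuclideanSpace.single l 1)) =
          (θ.1 ⟨x, hxU⟩).down ((difflEquiv hz hxz).symm (EuclideanSpace.single l 1)) := by
      rintro _ rfl _
      rfl
    simp only [a]
    have hm : z.symm (z x) ∈ U ∧ z.symm (z x) ∈ z.source := by
      rw [e]
      exact ⟨hxU, hxz⟩
    rw [dif_pos hm]
    exact key _ e hm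
  refine ⟨a, fun l ↦ ?_, fun x hx v ↦ ?_⟩
  · rintro _ ⟨x, hx, rfl⟩
    obtain ⟨V, hxV, hVz, hVU, b, hb, h⟩ := cotangentSheaf_pred_iff.1 θ.2 z hz x hx.1 hx.2
    have hopen : IsOpen (z '' V) := z.isOpen_image_of_subset_source V.isOpen hVz
    have h1 : AnalyticAt ℂ (fun w ↦ b w (EuclideanSpace.single l 1)) (z x) :=
      analyticAt_clm_apply (hb _ ⟨x, hxV, rfl⟩) analyticAt_const
    refine h1.congr ?_
    filter_upwards [hopen.mem_nhds ⟨x, hxV, rfl⟩]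
    rintro _ ⟨y, hy, rfl⟩
    rw [ha l y (hVU hy) (hVz hy), h ⟨y, hy⟩, ContinuousLinearMap.comp_apply,
      ← difflEquiv_apply hz (hVz hy), ContinuousLinearEquiv.apply_symm_apply]
  · have e : v = ∑ l, diffl z x v l • (difflEquiv hz hx).symm (EuclideanSpace.single l 1) := by
      refine (difflEquiv hz hx).injective ?_
      rw [map_sum]
      simp only [map_smul, ContinuousLinearEquiv.apply_symm_apply, difflEquiv_apply]
      ext j
      simp [Pi.single_apply]
    conv_lhs => rw [e]
    rw [map_sum]
    refine Finset.sum_congr rfl fun l _ ↦ ?_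
    rw [map_smul, ha l x x.2 hx, smul_eq_mul, mul_comm]

/-- On a subset of a chart domain the cotangent sheaf is generated by the `dz_l`. -/
theorem exists_eq_sum_dCoord {z : OpenPartialHomeomorph X (Cn n)} (hz : z ∈ atlas (Cn n) X)
    (hV : (V : Set X) ⊆ z.source) (θ : (cotangentSheaf n X).sections V) :
    ∃ c : Fin n → Holo n V, θ = ∑ l, c l • dCoord hz hV l := by
  obtain ⟨a, ha, h⟩ := exists_cotangent_coeff θ hz
  have ha' : ∀ l, AnalyticOnNhd ℂ (a l) (z '' V) := fun l ↦
    (ha l).mono (Set.image_mono fun x hx ↦ ⟨hx, hV hx⟩)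
  refine ⟨fun l ↦ holoOfChart hz hV (ha' l), Subtype.ext (funext fun x ↦ ULift.ext _ _ ?_)⟩
  ext v
  rw [h x (hV x.2)]
  have e : ∀ (s : Finset (Fin n)), ((∑ l ∈ s, holoOfChart hz hV (ha' l) • dCoord hz hV l :
      (cotangentSheaf n X).sections V).1 x).down v = ∑ l ∈ s, a l (z x) * diffl z x v l := by
    intro s
    induction s using Finset.cons_induction with
    | empty => rfl
    | cons l s hl ih =>
      rw [Finset.sum_cons, Finset.sum_cons, ← ih]
      rfl
  exact (e _).symm

/-- The jet differential on a subset of a chart domain which is given by a single monomial. -/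
def monomialDifferential {z : OpenPartialHomeomorph X (Cn n)} (hz : z ∈ atlas (Cn n) X)
    (hV : (V : Set X) ⊆ z.source) {a : Cn n → ℂ} (ha : AnalyticOnNhd ℂ a (z '' V))
    (β : Fin k → Fin n → ℕ) {d : ℕ} (hβ : jetWeight β = d) :
    (jetDifferentials n X k d).sections V :=
  ⟨fun x ξ ↦ a (z x) * jetMonomial β (coord k z ξ), jetFunctions_pred_of_chart fun x hx ↦
    ⟨z, hz, V, hx, hV, le_rfl, _, analyticOnNhd_jetPolynomial (E := {β}) (a := fun _ ↦ a)
      (fun _ _ ↦ ha), fun y ξ ↦ by simp⟩, fun x c ξ ↦ by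
      beta_reduce
      rw [coord_jetScale hz (hV x.2), jetMonomial_scaleCoord, hβ]
      ring⟩

/-- The product `ω(ξ) θ_1(v) ⋯ θ_i(v)` of a jet differential and of linear forms is a symbol. -/
theorem symbolSheaf_pred_mul {d i : ℕ} {ι : Type u} [Fintype ι] (hι : Fintype.card ι = i)
    (s : (jetDifferentials n X k d).sections U) (θ : ι → (cotangentSheaf n X).sections U) :
    (symbolSheaf n X k d i).pred (U := U)
      (fun x ξ v ↦ s.1 x ξ * ∏ j, ((θ j).1 x).down v) := by
  refine ⟨symbolFunctions_pred_iff.2 fun z hz x hx hxz ↦ ?_, fun x c ξ v ↦ ⟨?_, ?_⟩⟩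
  · obtain ⟨V, hxV, hVz, hVU, h, hh, e⟩ := jetFunctions_pred_iff.1 s.2.1 z hz x hx hxz
    choose a ha e' using fun j ↦ exists_cotangent_coeff (θ j) hz
    refine ⟨V, hxV, hVz, hVU, fun y ↦ h (y.1, fun p ↦ y.2 p.castSucc) *
      ∏ j, ∑ l, a j l y.1 * y.2 (Fin.last k) l, fun y hy ↦ ?_, fun y ξ v ↦ ?_⟩
    · have hp : ∀ p, AnalyticAt ℂ (fun y : Cn n × (Fin (k + 1) → Cn n) ↦ y.2 p) y := fun p ↦
        ((ContinuousLinearMap.proj (R := ℂ) p).comp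
          (ContinuousLinearMap.snd ℂ (Cn n) (Fin (k + 1) → Cn n))).analyticAt y
      have hl : ∀ l, AnalyticAt ℂ
          (fun y : Cn n × (Fin (k + 1) → Cn n) ↦ y.2 (Fin.last k) l) y := fun l ↦
        ((EuclideanSpace.proj (𝕜 := ℂ) l).comp ((ContinuousLinearMap.proj (R := ℂ)
          (Fin.last k)).comp
            (ContinuousLinearMap.snd ℂ (Cn n) (Fin (k + 1) → Cn n)))).analyticAt y
      refine AnalyticAt.mul ?_ (Finset.analyticAt_fun_prod _ fun j _ ↦
        Finset.analyticAt_fun_sum _ fun l _ ↦ ?_)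
      · exact (hh (y.1, fun p ↦ y.2 p.castSucc) ⟨hy.1, trivial⟩).comp_of_eq
          (analyticAt_fst.prod (AnalyticAt.pi fun p ↦ hp _)) rfl
      · refine AnalyticAt.mul ((ha j l y.1 ?_).comp analyticAt_fst) (hl l)
        obtain ⟨x', hx', e⟩ := hy.1
        exact ⟨x', ⟨hVU hx', hVz hx'⟩, e⟩
    · simp only [snocCoord_castSucc, snocCoord_last]
      rw [e y]
      congr 1
      exact Finset.prod_congr rfl fun j _ ↦ e' j ⟨y, hVU y.2⟩ (hVz y.2) v
  · simp only [s.2.2 x c ξ, mul_assoc]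
  · simp only [map_smul, smul_eq_mul, Finset.prod_mul_distrib, Finset.prod_const,
      Finset.card_univ, hι]
    ring

end Cotangent

/-! ### Products of linear forms -/

section SymmetricProducts

/-- The linear map on the symmetric power induced by a symmetric multilinear map. -/
theorem exists_symPower_lift {R : Type u} [CommRing R] {M N : Type u} [AddCommGroup M]
    [Module R M] [AddCommGroup N] [Module R N] {ι : Type u}
    (T : MultilinearMap R (fun _ : ι ↦ M) N)
    (hT : ∀ (e : Equiv.Perm ι) (f : ι → M), T (fun j ↦ f (e j)) = T f) :
    ∃ L : SymmetricPower R ι M →ₗ[R] N, ∀ f, L (SymmetricPower.tprod R f) = T f := by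
  have hT' : ∀ f : ι → M, PiTensorProduct.lift T (PiTensorProduct.tprod R f) = T f := fun f ↦
    PiTensorProduct.lift.tprod f
  let G : SymmetricPower R ι M →+ N :=
    AddCon.lift _ (PiTensorProduct.lift T).toAddMonoidHom
      (AddCon.addConGen_le.2 (by
        rintro _ _ ⟨e, f⟩
        rw [AddCon.ker_rel]
        exact (hT' f).trans ((hT e f).symm.trans (hT' fun i ↦ f (e i)).symm)))
  refine ⟨
    { toFun := G
      map_add' := G.map_add
      map_smul' := fun c x ↦ ?_ }, hT'⟩
  induction x using AddCon.induction_on with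
  | H x => exact (PiTensorProduct.lift T).map_smul c x

variable {n i : ℕ}

/-- A monomial of degree `i` is a product of `i` coordinates. -/
theorem exists_prod_eq_coordMonomial {β : Fin n → ℕ} (hβ : ∑ l, β l = i) :
    ∃ f : Fin i → Fin n, ∀ u : Cn n, ∏ j, u (f j) = coordMonomial β u := by
  have hc : Fintype.card (Fin i) = Fintype.card (Σ l, Fin (β l)) := by simp [hβ]
  let e := Fintype.equivOfCardEq hc
  refine ⟨fun j ↦ (e j).1, fun u ↦ ?_⟩
  rw [e.prod_comp (fun p : Σ l, Fin (β l) ↦ u p.1), Fintype.prod_sigma]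
  simp [coordMonomial]

theorem eq_of_sum_single_eq {f g : Fin i → Fin n} (hf : Monotone f) (hg : Monotone g)
    (h : ∑ j, Finsupp.single (f j) 1 = ∑ j, (Finsupp.single (g j) 1 : Fin n →₀ ℕ)) : f = g := by
  have key : ∀ f : Fin i → Fin n, Finsupp.toMultiset (∑ j, Finsupp.single (f j) 1) =
      (List.ofFn f : Multiset (Fin n)) := fun f ↦ by
    rw [map_sum]
    simp only [Finsupp.toMultiset_single, one_smul]
    rw [← Fin.univ_val_map]
    exact (Multiset.sum_map_singleton _).symm.trans (by rw [Multiset.map_map]; rfl) |>.symm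
  have h1 : (List.ofFn f : Multiset (Fin n)) = List.ofFn g := by rw [← key, ← key, h]
  exact List.ofFn_injective ((Multiset.coe_eq_coe.1 h1).eq_of_pairwise'
    hf.sortedLE_ofFn.pairwise hg.sortedLE_ofFn.pairwise)

/-- The monomials `u_{f 1} ⋯ u_{f i}` for monotone `f` are linearly independent. -/
theorem eq_zero_of_sum_prod_eq_zero [Fintype {f : Fin i → Fin n // Monotone f}]
    (b : {f : Fin i → Fin n // Monotone f} → ℂ)
    (h : ∀ u : Cn n, ∑ f, b f * ∏ j, u (f.1 j) = 0) : b = 0 := by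
  classical
  let p : MvPolynomial (Fin n) ℂ := ∑ f, MvPolynomial.monomial (∑ j, Finsupp.single (f.1 j) 1) (b f)
  have hp : p = 0 := by
    refine MvPolynomial.funext fun u ↦ ?_
    rw [map_zero, map_sum, ← h (WithLp.toLp 2 u)]
    refine Finset.sum_congr rfl fun f _ ↦ ?_
    rw [MvPolynomial.monomial_sum_index]
    simp [MvPolynomial.eval_monomial]
  funext f
  have h1 := congrArg (MvPolynomial.coeff (∑ j, Finsupp.single (f.1 j) 1)) hp
  simp only [p, MvPolynomial.coeff_sum, MvPolynomial.coeff_monomial, MvPolynomial.coeff_zero] at h1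
  rw [Finset.sum_eq_single f] at h1
  · simpa using h1
  · intro g _ hg
    exact if_neg fun e ↦ hg (Subtype.ext (eq_of_sum_single_eq g.2 f.2 e))
  · simp

end SymmetricProducts

/-! ### The tensor product with the symmetric power of the cotangent sheaf -/

section SymmetricTensors

variable {R : Type u} [CommRing R] {M N : Type u} [AddCommGroup M] [AddCommGroup N] [Module R M]
  [Module R N] {n i : ℕ}

/-- The symmetric power of a module with generators `g 1, …, g n` is spanned by the products
`g (f 1) ⋯ g (f i)` with `f` monotone. -/
theorem mem_span_tprod_monotone {g : Fin n → M} (hg : ∀ m, ∃ c : Fin n → R, m = ∑ l, c l • g l)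
    (x : SymmetricPower R (ULift.{u} (Fin i)) M) :
    x ∈ Submodule.span R (Set.range fun f : {f : Fin i → Fin n // Monotone f} ↦
      SymmetricPower.tprod R fun j : ULift.{u} (Fin i) ↦ g (f.1 j.down)) := by
  classical
  induction x using symPower_induction with
  | tprod m =>
    choose c hc using fun j ↦ hg (m j)
    rw [show m = fun j ↦ ∑ l, c j l • g l from funext hc, MultilinearMap.map_sum]
    refine Submodule.sum_mem _ fun r _ ↦ ?_
    rw [MultilinearMap.map_smul_univ]
    refine Submodule.smul_mem _ _ (Submodule.subset_span ?_)
    let r' : Fin i → Fin n := fun j ↦ r ⟨j⟩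
    refine ⟨⟨r' ∘ Tuple.sort r', Tuple.monotone_sort r'⟩, ?_⟩
    exact SymmetricPower.tprod_equiv
      ((Equiv.ulift.trans (Tuple.sort r')).trans Equiv.ulift.symm) fun j ↦ g (r j)
  | zero => exact Submodule.zero_mem _
  | add x y hx hy => exact Submodule.add_mem _ hx hy
  | smul c x hx => exact Submodule.smul_mem _ _ hx

theorem exists_eq_sum_tmul_tprod [Fintype {f : Fin i → Fin n // Monotone f}] {g : Fin n → M}
    (hg : ∀ m, ∃ c : Fin n → R, m = ∑ l, c l • g l)
    (x : N ⊗[R] SymmetricPower R (ULift.{u} (Fin i)) M) :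
    ∃ w : {f : Fin i → Fin n // Monotone f} → N,
      x = ∑ f, w f ⊗ₜ SymmetricPower.tprod R fun j : ULift.{u} (Fin i) ↦ g (f.1 j.down) := by
  induction x using TensorProduct.induction_on with
  | zero => exact ⟨0, by simp⟩
  | tmul w s =>
    obtain ⟨c, rfl⟩ := (Submodule.mem_span_range_iff_exists_fun R).1 (mem_span_tprod_monotone hg s)
    exact ⟨fun f ↦ c f • w, by simp only [TensorProduct.tmul_sum, TensorProduct.smul_tmul]⟩
  | add x y hx hy =>
    obtain ⟨a, rfl⟩ := hx
    obtain ⟨b, rfl⟩ := hy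
    exact ⟨a + b, by simp only [Pi.add_apply, TensorProduct.add_tmul, Finset.sum_add_distrib]⟩

end SymmetricTensors

section ProductMap

variable {n k d i : ℕ} {X : Type u} [TopologicalSpace X] [ChartedSpace (Cn n) X]
  [IsManifold 𝓘(ℂ, Cn n) ω X] {U V : Opens X}

theorem symbolSheaf_sum_apply {ι : Type*} (s : Finset ι)
    (t : ι → (symbolSheaf n X k d i).sections U) (x : U) (ξ : JetFiber n k (x : X))
    (v : TangentSpace 𝓘(ℂ, Cn n) (x : X)) :
    (∑ j ∈ s, t j).1 x ξ v = ∑ j ∈ s, (t j).1 x ξ v := by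
  induction s using Finset.cons_induction with
  | empty => rfl
  | cons j s hj ih =>
    rw [Finset.sum_cons, Finset.sum_cons, ← ih]
    rfl

theorem prod_update_eq {ι : Type*} [Fintype ι] [DecidableEq ι]
    (θ : ι → (cotangentSheaf n X).sections U) (j : ι) (c : (cotangentSheaf n X).sections U)
    (x : U) (v : TangentSpace 𝓘(ℂ, Cn n) (x : X)) :
    ∏ l, ((Function.update θ j c l).1 x).down v =
      (c.1 x).down v * ∏ l ∈ Finset.univ.erase j, ((θ l).1 x).down v := by
  rw [← Finset.mul_prod_erase _ _ (Finset.mem_univ j), Function.update_self]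
  congr 1
  refine Finset.prod_congr rfl fun l hl ↦ ?_
  rw [Function.update_of_ne (Finset.ne_of_mem_erase hl)]

/-- The multilinear map `(θ_1, …, θ_i) ↦ ω(ξ) θ_1(v) ⋯ θ_i(v)`. -/
def productMultilinear (s : (jetDifferentials n X k d).sections U) :
    MultilinearMap (Holo n U) (fun _ : ULift.{u} (Fin i) ↦ (cotangentSheaf n X).sections U)
      ((symbolSheaf n X k d i).sections U) where
  toFun θ := ⟨fun x ξ v ↦ s.1 x ξ * ∏ j, ((θ j).1 x).down v, symbolSheaf_pred_mul (by simp) s θ⟩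
  map_update_add' := fun {_} θ j a b ↦ Subtype.ext <| by
    funext x ξ v
    change s.1 x ξ * ∏ l, ((Function.update θ j (a + b) l).1 x).down v =
      s.1 x ξ * ∏ l, ((Function.update θ j a l).1 x).down v +
        s.1 x ξ * ∏ l, ((Function.update θ j b l).1 x).down v
    simp only [prod_update_eq]
    rw [← mul_add, ← add_mul]
    rfl
  map_update_smul' := fun {_} θ j c a ↦ Subtype.ext <| by
    funext x ξ v
    change s.1 x ξ * ∏ l, ((Function.update θ j (c • a) l).1 x).down v =
      c x * (s.1 x ξ * ∏ l, ((Function.update θ j a l).1 x).down v)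
    simp only [prod_update_eq]
    change s.1 x ξ * (c x * (a.1 x).down v * _) = c x * (s.1 x ξ * ((a.1 x).down v * _))
    ring

theorem exists_productLift (s : (jetDifferentials n X k d).sections U) :
    ∃ L : SymmetricPower (Holo n U) (ULift.{u} (Fin i)) ((cotangentSheaf n X).sections U)
        →ₗ[Holo n U] (symbolSheaf n X k d i).sections U,
      ∀ θ, L (SymmetricPower.tprod (Holo n U) θ) = productMultilinear s θ := by
  refine exists_symPower_lift (productMultilinear s) fun e θ ↦ Subtype.ext ?_
  funext x ξ v
  exact congrArg (s.1 x ξ * ·) (Equiv.prod_comp e fun j ↦ ((θ j).1 x).down v)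

/-- The linear map `θ_1 ⋯ θ_i ↦ ω(ξ) θ_1(v) ⋯ θ_i(v)` on the symmetric power. -/
def productLift (s : (jetDifferentials n X k d).sections U) :
    SymmetricPower (Holo n U) (ULift.{u} (Fin i)) ((cotangentSheaf n X).sections U)
      →ₗ[Holo n U] (symbolSheaf n X k d i).sections U :=
  (exists_productLift s).choose

theorem productLift_tprod (s : (jetDifferentials n X k d).sections U)
    (θ : ULift.{u} (Fin i) → (cotangentSheaf n X).sections U) :
    productLift s (SymmetricPower.tprod (Holo n U) θ) = productMultilinear s θ :=
  (exists_productLift s).choose_spec θ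

theorem productLift_add (s t : (jetDifferentials n X k d).sections U)
    (y : SymmetricPower (Holo n U) (ULift.{u} (Fin i)) ((cotangentSheaf n X).sections U)) :
    productLift (s + t) y = productLift s y + productLift t y := by
  induction y using symPower_induction with
  | tprod θ =>
    rw [productLift_tprod, productLift_tprod, productLift_tprod]
    refine Subtype.ext ?_
    funext x ξ v
    exact add_mul (s.1 x ξ) (t.1 x ξ) _
  | zero => simp only [map_zero, add_zero]
  | add y y' h h' =>
    simp only [map_add, h, h']
    abel
  | smul c y h => simp only [map_smul, h, smul_add]

theorem productLift_smul (c : Holo n U) (s : (jetDifferentials n X k d).sections U)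
    (y : SymmetricPower (Holo n U) (ULift.{u} (Fin i)) ((cotangentSheaf n X).sections U)) :
    productLift (c • s) y = c • productLift s y := by
  induction y using symPower_induction with
  | tprod θ =>
    rw [productLift_tprod, productLift_tprod]
    refine Subtype.ext ?_
    funext x ξ v
    exact mul_assoc (c x) (s.1 x ξ) _
  | zero => simp only [map_zero, smul_zero]
  | add y y' h h' => simp only [map_add, h, h', smul_add]
  | smul c' y h => simp only [map_smul, h, smul_comm c c']

variable (n k d i U) in
/-- The map `𝒥_k^d(U) ⊗ Sym^i T^*X(U) → S(U)` to the module of symbols which sends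
`ω ⊗ θ_1 ⋯ θ_i` to `ω(ξ) θ_1(v) ⋯ θ_i(v)`. -/
def productMap : (jetDifferentials n X k d).sections U ⊗[Holo n U]
    SymmetricPower (Holo n U) (ULift.{u} (Fin i)) ((cotangentSheaf n X).sections U)
      →ₗ[Holo n U] (symbolSheaf n X k d i).sections U :=
  TensorProduct.lift (LinearMap.mk₂ (Holo n U) (fun s y ↦ productLift s y) productLift_add
    productLift_smul (fun s ↦ map_add (productLift s)) (fun c s ↦ map_smul (productLift s) c))

theorem productMap_tmul_tprod (s : (jetDifferentials n X k d).sections U)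
    (θ : ULift.{u} (Fin i) → (cotangentSheaf n X).sections U) (x : U) (ξ : JetFiber n k (x : X))
    (v : TangentSpace 𝓘(ℂ, Cn n) (x : X)) :
    (productMap n k d i U (s ⊗ₜ SymmetricPower.tprod (Holo n U) θ)).1 x ξ v =
      s.1 x ξ * ∏ j, ((θ j).1 x).down v := by
  have h : productMap n k d i U (s ⊗ₜ SymmetricPower.tprod (Holo n U) θ) =
      productMultilinear s θ := productLift_tprod s θ
  rw [h]
  rfl

/-- On a subset of a chart domain every element of the tensor product is a sum of
`ω_f ⊗ dz_{f 1} ⋯ dz_{f i}` over monotone `f`; its image determines the `ω_f`, since the monomials in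
the coordinates of `v` are linearly independent. -/
theorem productMap_injective {z : OpenPartialHomeomorph X (Cn n)} (hz : z ∈ atlas (Cn n) X)
    (hV : (V : Set X) ⊆ z.source) : Function.Injective (productMap n k d i V) := by
  classical
  refine (injective_iff_map_eq_zero _).2 fun y hy ↦ ?_
  obtain ⟨w, rfl⟩ := exists_eq_sum_tmul_tprod (exists_eq_sum_dCoord hz hV) y
  suffices h : ∀ f, w f = 0 by simp [h]
  have key : ∀ (x : V) (ξ : JetFiber n k (x : X)), (fun f ↦ (w f).1 x ξ) = 0 := fun x ξ ↦ by
    refine eq_zero_of_sum_prod_eq_zero _ fun u ↦ ?_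
    have h := congrArg (fun r : (symbolSheaf n X k d i).sections V ↦
      r.1 x ξ ((difflEquiv hz (hV x.2)).symm u)) hy
    rw [map_sum] at h
    beta_reduce at h
    rw [symbolSheaf_sum_apply] at h
    refine Eq.trans (Finset.sum_congr rfl fun f _ ↦ ?_) h
    rw [productMap_tmul_tprod]
    simp only [dCoord_apply]
    rw [← difflEquiv_apply hz (hV x.2), ContinuousLinearEquiv.apply_symm_apply]
    exact congrArg _ (Equiv.ulift.prod_comp fun j : Fin i ↦ u (f.1 j)).symm
  exact fun f ↦ Subtype.ext (funext fun x ↦ funext fun ξ ↦ congrFun (key x ξ) f)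

/-- Locally every symbol is a sum of products of a jet differential and linear forms. -/
theorem exists_productMap_eq {m : ℕ} (hm : (k + 1) * i ≤ m)
    (s : (symbolSheaf n X k (m - (k + 1) * i) i).sections U) {x : X} (hx : x ∈ U) :
    ∃ V : Opens X, x ∈ V ∧ ∃ hVU : V ≤ U, ∃ y, ∀ w : V,
      (productMap n k (m - (k + 1) * i) i V y).1 w = s.1 ⟨w, hVU w.2⟩ := by
  obtain ⟨V, hxV, hV, hVU, a, ha, h⟩ := exists_symbolPolynomial hm s.2
    (chart_mem_atlas (Cn n) x) hx (mem_chart_source (Cn n) x)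
  have hz := chart_mem_atlas (Cn n) x
  set z := chartAt (Cn n) x
  have key : ∀ α ∈ (jetExponents n (k + 1) m i).filter (fun α ↦ ∑ l, α (Fin.last k) l = i),
      ∃ y, ∀ (w : V) (ξ : JetFiber n k (w : X)) (v : TangentSpace 𝓘(ℂ, Cn n) (w : X)),
        (productMap n k (m - (k + 1) * i) i V y).1 w ξ v =
          a α (z w) * jetMonomial α (snocCoord (coord k z ξ) (diffl z w v)) := fun α hα ↦ by
    obtain ⟨f, hf⟩ := exists_prod_eq_coordMonomial (jetWeight_initExp_of_mem hα).2
    refine ⟨monomialDifferential hz hV (ha α) (initExp α) (jetWeight_initExp_of_mem hα).1 ⊗ₜ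
      SymmetricPower.tprod (Holo n V) fun j ↦ dCoord hz hV (f j.down), fun w ξ v ↦ ?_⟩
    rw [productMap_tmul_tprod, jetMonomial_snocCoord, ← hf, ← mul_assoc]
    exact congrArg _ (Equiv.ulift.prod_comp fun j : Fin i ↦ diffl z w v (f j))
  choose! y hy using key
  refine ⟨V, hxV, hVU, ∑ α ∈ (jetExponents n (k + 1) m i).filter
    (fun α ↦ ∑ l, α (Fin.last k) l = i), y α, fun w ↦ ?_⟩
  funext ξ v
  rw [h w, map_sum, symbolSheaf_sum_apply]
  exact Finset.sum_congr rfl fun α hα ↦ hy α hα w ξ v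

end ProductMap

/-! ### Sheafification of the product map -/

section Sheafification

variable {n : ℕ} {X : Type u} [TopologicalSpace X] [ChartedSpace (Cn n) X]

/-- A locally bijective morphism from a presheaf of modules to a sheaf of modules identifies the
associated sheaf with its target. -/
theorem nonempty_sheafify_iso
    {P : PresheafOfModules.{u} (holoPresheaf n X ⋙ forget₂ CommRingCat RingCat)}
    {N : SheafOfModules.{u} (structureSheaf n X)} (φ : P ⟶ N.val)
    (hinj : ∀ (U : Opens X) (s : P.obj (op U)), φ.app (op U) s = 0 → ∀ x ∈ U, ∃ (V : Opens X)
      (j : V ⟶ U), x ∈ V ∧ P.map j.op s = 0)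
    (hsurj : ∀ (U : Opens X) (t : N.val.obj (op U)), ∀ x ∈ U, ∃ (V : Opens X) (j : V ⟶ U), x ∈ V ∧
      ∃ s : P.obj (op V), φ.app (op V) s = N.val.map j.op t) :
    Nonempty ((sheafify n X).obj P ≅ N) := by
  let J := Opens.grothendieckTopology (TopCat.of X)
  let f := (PresheafOfModules.toPresheaf _).map φ
  have h1 : Presheaf.IsLocallyInjective J f := ⟨fun {U} s t h x hx ↦ by
    have hs : φ.app U (show P.obj U from s) = φ.app U (show P.obj U from t) := h
    obtain ⟨V, j, hxV, e⟩ := hinj U.unop ((show P.obj U from s) - (show P.obj U from t))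
      (by rw [map_sub]; exact sub_eq_zero.2 hs) x hx
    rw [map_sub] at e
    exact ⟨V, j, sub_eq_zero.1 e, hxV⟩⟩
  have h2 : Presheaf.IsLocallySurjective J f := ⟨fun {U} t x hx ↦ by
    obtain ⟨V, j, hxV, s, e⟩ := hsurj U t x hx
    exact ⟨V, j, ⟨s, e⟩, hxV⟩⟩
  have hW : (J.W.inverseImage (PresheafOfModules.toPresheaf _)) φ := J.W_of_isLocallyBijective f
  rw [PresheafOfModules.inverseImage_W_toPresheaf_eq_inverseImage_isomorphisms
    (R := structureSheaf n X) (𝟙 _)] at hW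
  have : IsIso ((sheafify n X).map φ) := hW
  let adj := PresheafOfModules.sheafificationAdjunction (R₀ := (structureSheaf n X).obj)
    (R := structureSheaf n X) (𝟙 _)
  exact ⟨asIso ((sheafify n X).map φ) ≪≫ (asIso adj.counit).app N⟩

variable [IsManifold 𝓘(ℂ, Cn n) ω X]

/-- The restriction of a section, as in `SectionSheaf.toPresheaf`. -/
def SectionSheaf.restrict {A : X → Type u} [∀ x, AddCommGroup (A x)] [∀ x, Module ℂ (A x)]
    (F : SectionSheaf n A) {U V : Opens X} (h : V ≤ U) (s : F.sections U) : F.sections V :=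
  ⟨fun x ↦ s.1 ⟨x.1, h x.2⟩, F.res (homOfLE h) s.1 s.2⟩

/-- The product map commutes with restriction.  Here `σ` is the restriction on the symmetric
powers. -/
theorem productMap_restrict {k d i : ℕ} {U V : Opens X} (h : V ≤ U)
    (σ : SymmetricPower (Holo n U) (ULift.{u} (Fin i)) ((cotangentSheaf n X).sections U)
      →ₛₗ[(ContMDiffMap.restrictRingHom 𝓘(ℂ, Cn n) 𝓘(ℂ) ℂ h : Holo n U →+* Holo n V)]
        SymmetricPower (Holo n V) (ULift.{u} (Fin i)) ((cotangentSheaf n X).sections V))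
    (hσ : ∀ θ, σ (SymmetricPower.tprod (Holo n U) θ) =
      SymmetricPower.tprod (Holo n V) fun j ↦ (cotangentSheaf n X).restrict h (θ j))
    (s : (jetDifferentials n X k d).sections U)
    (y : SymmetricPower (Holo n U) (ULift.{u} (Fin i)) ((cotangentSheaf n X).sections U)) :
    productMap n k d i V ((jetDifferentials n X k d).restrict h s ⊗ₜ σ y) =
      (symbolSheaf n X k d i).restrict h (productMap n k d i U (s ⊗ₜ y)) := by
  induction y using symPower_induction with
  | tprod θ =>
    rw [hσ]
    refine Subtype.ext ?_
    funext x ξ v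
    exact (productMap_tmul_tprod _ _ x ξ v).trans
      (productMap_tmul_tprod s θ ⟨x.1, h x.2⟩ ξ v).symm
  | zero =>
    simp only [map_zero, TensorProduct.tmul_zero]
    rfl
  | add y y' e e' =>
    simp only [map_add, TensorProduct.tmul_add, e, e']
    rfl
  | smul c y e =>
    simp only [map_smulₛₗ, TensorProduct.tmul_smul, e]
    rfl

variable (n X) in
/-- The product `ω ⊗ θ_1 ⋯ θ_i ↦ ω(ξ) θ_1(v) ⋯ θ_i(v)` as a morphism of presheaves of modules. -/
def productHom (k d i : ℕ) :
    PresheafOfModules.Monoidal.tensorObj (R := holoPresheaf n X)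
      (jetDifferentials n X k d).toSheafOfModules.val
      (symPresheaf (cotangentSheaf n X).toSheafOfModules.val i) ⟶
      (symbolSheaf n X k d i).toSheafOfModules.val where
  app U := ModuleCat.ofHom (productMap n k d i U.unop)
  naturality j := ModuleCat.MonoidalCategory.tensor_ext fun s y ↦
    productMap_restrict j.unop.le
      (symRestrict (cotangentSheaf n X).toSheafOfModules.val i j)
      (symRestrict_tprod (cotangentSheaf n X).toSheafOfModules.val i j) s y

theorem nonempty_tensorSym_iso {k m i : ℕ} (hm : (k + 1) * i ≤ m) :
    Nonempty (tensorSym (jetDifferentials n X k (m - (k + 1) * i)).toSheafOfModules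
      (cotangentSheaf n X).toSheafOfModules i ≅
        (symbolSheaf n X k (m - (k + 1) * i) i).toSheafOfModules) := by
  refine nonempty_sheafify_iso (productHom n X k (m - (k + 1) * i) i) (fun U s hs x hx ↦ ?_)
    fun U t x hx ↦ ?_
  · let V := interSource U (chartAt (Cn n) x)
    have hV : V ≤ U := inf_le_left
    refine ⟨V, homOfLE hV, ⟨hx, mem_chart_source (Cn n) x⟩, ?_⟩
    have h := PresheafOfModules.naturality_apply (productHom n X k (m - (k + 1) * i) i)
      (homOfLE hV).op s
    rw [hs, map_zero] at h
    exact productMap_injective (chart_mem_atlas (Cn n) x) (fun y (hy : y ∈ V) ↦ hy.2)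
      (h.trans (map_zero (productMap n k (m - (k + 1) * i) i V)).symm)
  · obtain ⟨V, hxV, hVU, y, hy⟩ := exists_productMap_eq hm t hx
    exact ⟨V, homOfLE hVU, hxV, y, Subtype.ext
      (p := (symbolSheaf n X k (m - (k + 1) * i) i).pred (U := V)) (funext hy)⟩

end Sheafification

end JetDiff

end

/-- The Green–Griffiths filtration of the sheaf of `k`-jet differentials of weight `m`. -/
theorem theorem1p12 (n : ℕ) (X : Type*) [TopologicalSpace X]
    [ChartedSpace (JetDiff.Cn n) X] [IsManifold 𝓘(ℂ, JetDiff.Cn n) ω X]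
    (k m : ℕ) (hk : 1 ≤ k) :
    -- `ℱ^0` is the image of `𝒥_{k-1}^m X` under the injective pull-back map
    (∀ (U : Opens X) (s : ∀ x : U, JetDiff.JetFiber n k (x : X) → ℂ),
      (JetDiff.jetFiltration n X k m 0).pred (U := U) s ↔
        ∃! t : ∀ x : U, JetDiff.JetFiber n (k - 1) (x : X) → ℂ,
          (JetDiff.jetDifferentials n X (k - 1) m).pred (U := U) t ∧
            s = JetDiff.jetPullback (Nat.sub_le k 1) U t) ∧
    -- `ℱ^{[m/k]} = 𝒥_k^m X`
    JetDiff.jetFiltration n X k m (m / k) = JetDiff.jetDifferentials n X k m ∧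
    -- `ℱ^i ⊆ ℱ^{i+1}`, and `ℱ^{i+1} / ℱ^i ≅ 𝒥_{k-1}^{m-k(i+1)} X ⊗ Sym^{i+1} T^*X`
    ∃ hle : ∀ i, JetDiff.jetFiltration n X k m i ≤ JetDiff.jetFiltration n X k m (i + 1),
      ∀ i, i + 1 ≤ m / k →
        Nonempty (JetDiff.SectionSheaf.quotient (hle i) ≅
          JetDiff.tensorSym (JetDiff.jetDifferentials n X (k - 1) (m - k * (i + 1))).toSheafOfModules
            (JetDiff.cotangentSheaf n X).toSheafOfModules (i + 1)) := by
  obtain ⟨k, rfl⟩ := Nat.exists_eq_add_of_le' hk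
  refine ⟨fun U s ↦ JetDiff.jetFiltration_zero_pred_iff, JetDiff.jetFiltration_eq_jetDifferentials,
    fun i ↦ JetDiff.jetFiltration_le_succ i, fun i hi ↦ ?_⟩
  have hm : (k + 1) * (i + 1) ≤ m := by
    rw [mul_comm]
    exact (Nat.le_div_iff_mul_le k.succ_pos).1 hi
  obtain ⟨e⟩ := JetDiff.nonempty_quotient_iso_symbolSheaf (n := n) (X := X) hm
    (JetDiff.jetFiltration_le_succ i)
  obtain ⟨e'⟩ := JetDiff.nonempty_tensorSym_iso (n := n) (X := X) hm
  exact ⟨e ≪≫ e'.symm⟩
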